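/- Let $\Gamma$ be the chain graph made of rings indexed by $j\in\mathbb Z$; the $j$-th ring consists of an upper and a lower semicircle, each identified with $[0,\pi]$ and joining the vertex $j$ ($x=0$) to the vertex $j+1$ ($x=\pi$). Let $A\in\mathbb R$ and let $\mathcal D=\frac{d}{dx}+iA$ on the upper semicircles and $\mathcal D=\frac{d}{dx}-iA$ on the lower ones. For a real sequence $\boldsymbol\beta=(\beta_j)_{j\in\mathbb Z}$ let $-\Delta_{\boldsymbol\beta}$ be the operator in $L^2(\Gamma)$ (the Hilbert sum of the spaces $L^2(0,\pi)$ over all semicircles) that acts as $-\mathcal D^2$ on each semicircle. Its domain consists of all $f\in L^2(\Gamma)$ whose component $\psi_j$ on the upper and $\varphi_j$ on the lower semicircle of the $j$-th ring belong to $H^2(0,\pi)$ for every $j$, which satisfy $-\mathcal D^2f\in L^2(\Gamma)$, and for which, for every $j\in\mathbb Z$, $$\psi_j(0)=\varphi_j(0)=\psi_{j-1}(\pi)=\varphi_{j-1}(\pi),\qquad \mathcal D\psi_j(0)+\mathcal D\varphi_j(0)-\mathcal D\psi_{j-1}(\pi)-\mathcal D\varphi_{j-1}(\pi)=\beta_j\,\psi_j(0).$$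 The essential spectrum is the spectrum without the isolated eigenvalues of finite multiplicity. The gaps of the essential spectrum are the connected components of its complement in $\mathbb R$, numbered $1,2,3,\dots$ from left to right, so that the first gap is the one below the essential spectrum. **Theorem.** Let $A\in\mathbb R\setminus\mathbb Z$ and $\alpha,\gamma_1,\gamma_2\in\mathbb R$. Denote by $-\Delta_\alpha$ the operator with $\beta_j=\alpha$ for all $j$, and by $-\Delta_{\boldsymbol\alpha+\boldsymbol\gamma^{(2)}}$ the operator with $\beta_1=\alpha+\gamma_1$, $\beta_2=\alpha+\gamma_2$ and $\beta_j=\alpha$ for all other $j$. Then the essential spectrum of $-\Delta_{\boldsymbol\alpha+\boldsymbol\gamma^{(2)}}$ coincides with that of $-\Delta_\alpha$. If $\gamma_1+\gamma_2<0$, then $-\Delta_{\boldsymbol\alpha+\boldsymbol\gamma^{(2)}}$ has at least one and at most two eigenvalues, counted with multiplicity, in every odd gap of its essential spectrum. If $\gamma_1+\gamma_2>0$, then it has at least one and at most two eigenvalues, counted with multiplicity, in every even gap of its essential spectrum. -/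

import Mathlib

/-! General notions for unbounded operators on a complex Banach space. -/

namespace UnboundedOperator

variable {H : Type*} [NormedAddCommGroup H] [NormedSpace ℂ H]

/-- The eigenspace `{f ∈ dom T : T f = z f}`. -/
def eigenspace (T : H →ₗ.[ℂ] H) (z : ℂ) : Submodule ℂ H :=
  (LinearMap.ker (T.toFun - z • T.domain.subtype)).map T.domain.subtype

/-- The resolvent set: those `z` for which `T - z : dom T → H` has a bounded two-sided inverse. -/
def resolventSet (T : H →ₗ.[ℂ] H) : Set ℂ :=
  {z | ∃ R : H →L[ℂ] H,
    (∀ f : H, ∃ h : R f ∈ T.domain, T ⟨R f, h⟩ - z • R f = f) ∧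
    ∀ u : T.domain, R (T u - z • (u : H)) = u}

/-- The spectrum. -/
def spectrum (T : H →ₗ.[ℂ] H) : Set ℂ := (resolventSet T)ᶜ

/-- The discrete spectrum: eigenvalues of finite multiplicity that are isolated points of the
spectrum. -/
def discreteSpectrum (T : H →ₗ.[ℂ] H) : Set ℂ :=
  {z | z ∈ spectrum T ∧ ¬ AccPt z (Filter.principal (spectrum T)) ∧
    eigenspace T z ≠ ⊥ ∧ FiniteDimensional ℂ (eigenspace T z)}

/-- The essential spectrum (of a self-adjoint operator): the spectrum without the discrete
spectrum. -/
def essentialSpectrum (T : H →ₗ.[ℂ] H) : Set ℂ := spectrum T \ discreteSpectrum T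

/-- The real points of the essential spectrum. -/
def realEssentialSpectrum (T : H →ₗ.[ℂ] H) : Set ℝ := {E : ℝ | (E : ℂ) ∈ essentialSpectrum T}

/-- The eigenvalues of `T` in the set `I` of real numbers. -/
def eigenvaluesIn (T : H →ₗ.[ℂ] H) (I : Set ℝ) : Set ℝ :=
  {E | E ∈ I ∧ eigenspace T (E : ℂ) ≠ ⊥}

/-- The span of all eigenfunctions of `T` with eigenvalue in `I`; its dimension is the number
of eigenvalues in `I`, counted with multiplicity. -/
def eigenfunctionsIn (T : H →ₗ.[ℂ] H) (I : Set ℝ) : Submodule ℂ H :=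
  ⨆ E ∈ I, eigenspace T (E : ℂ)

/-- `T` has at least one and at most two eigenvalues in `I`; the upper bound holds also when the
eigenvalues are counted with multiplicity. -/
def HasOneOrTwoEigenvaluesIn (T : H →ₗ.[ℂ] H) (I : Set ℝ) : Prop :=
  1 ≤ (eigenvaluesIn T I).encard ∧ (eigenvaluesIn T I).encard ≤ 2 ∧
    Module.rank ℂ (eigenfunctionsIn T I) ≤ 2

end UnboundedOperator

/-- A gap of a set `S` of real numbers: a connected component of its complement. -/
def IsGap (S I : Set ℝ) : Prop := ∃ x ∈ Sᶜ, I = connectedComponentIn Sᶜ x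

/-- `I` is the `n`-th gap of `S`, counted from the left and starting with `n = 1`: exactly
`n - 1` gaps lie to the left of it. (If `S` is bounded below and non-empty, the first gap is
the unbounded one below `S`.) -/
def IsNthGap (S : Set ℝ) (n : ℕ) (I : Set ℝ) : Prop :=
  IsGap S I ∧ {J | IsGap S J ∧ ∀ x ∈ J, ∀ y ∈ I, x < y}.encard + 1 = n

/-! The chain graph and the magnetic Hamiltonian with delta couplings. -/

namespace MagneticChain

open MeasureTheory Set

/-- `L²(0, π)`, the state space of a single semicircle. -/
abbrev EdgeL2 : Type := Lp ℂ 2 (volume.restrict (Ioo (0 : ℝ) Real.pi))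

/-- The edges of the chain: `(j, true)` is the upper and `(j, false)` the lower semicircle of
the `j`-th ring. Both are parametrized by `x ∈ [0, π]`, from the `j`-th vertex (`x = 0`) to the
`(j+1)`-st vertex (`x = π`). -/
abbrev Edge : Type := ℤ × Bool

/-- `L²(Γ)`, the Hilbert sum over the edges of `L²(0, π)`. -/
abbrev ChainL2 : Type := lp (fun _ : Edge => EdgeL2) 2

/-- `u` is a function of the Sobolev class `H²(0, π)`, with derivative `v` and weak second
derivative `g`: `u` is continuously differentiable on `[0, π]`, and `u' = v` is absolutely
continuous with `v' = g ∈ L²(0, π)`. -/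
structure IsH2 (u v : ℝ → ℂ) (g : EdgeL2) : Prop where
  deriv : ∀ x ∈ Icc (0 : ℝ) Real.pi, HasDerivWithinAt u (v x) (Icc (0 : ℝ) Real.pi) x
  deriv₂ : ∀ x ∈ Icc (0 : ℝ) Real.pi, v x = v 0 + ∫ t in (0 : ℝ)..x, g t

/-- The constant `a` in the quasiderivative `D = d/dx + i a`: it is `A` on the upper and `-A` on
the lower semicircles (the tangential component of the vector potential is `-a`). -/
def pot (A : ℝ) (e : Edge) : ℝ := if e.2 then A else -A

/-- The quasiderivative `D u = u' + i a u` at `x` on the edge `e`, where `v = u'`. -/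
def quasiDeriv (A : ℝ) (e : Edge) (u v : ℝ → ℂ) (x : ℝ) : ℂ :=
  v x + Complex.I * (pot A e : ℂ) * u x

/-- `f` is in the domain of the Hamiltonian with vector potential `A` and coupling constants
`α j`, with edge components `u`, first derivatives `v` and second derivatives `g`, and the
Hamiltonian maps `f` to `h`. -/
structure IsAction (A : ℝ) (α : ℤ → ℝ) (f h : ChainL2)
    (u v : Edge → ℝ → ℂ) (g : Edge → EdgeL2) : Prop where
  sobolev : ∀ e, IsH2 (u e) (v e) (g e)
  repr : ∀ e, (f e : ℝ → ℂ) =ᵐ[volume.restrict (Ioo (0 : ℝ) Real.pi)] u e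
  /-- `h = -D² u = -(u'' + 2 i a u' - a² u)` on each edge -/
  action : ∀ e, (h e : ℝ → ℂ) =ᵐ[volume.restrict (Ioo (0 : ℝ) Real.pi)] fun x =>
    -(g e x + 2 * Complex.I * (pot A e : ℂ) * v e x - (pot A e : ℂ) ^ 2 * u e x)
  /-- continuity at the vertices -/
  continuity : ∀ j : ℤ, u (j, true) 0 = u (j, false) 0 ∧
    u (j, true) 0 = u (j - 1, true) Real.pi ∧ u (j, true) 0 = u (j - 1, false) Real.pi
  /-- the delta coupling at the vertices -/
  coupling : ∀ j : ℤ,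
    quasiDeriv A (j, true) (u (j, true)) (v (j, true)) 0 +
      quasiDeriv A (j, false) (u (j, false)) (v (j, false)) 0 -
      quasiDeriv A (j - 1, true) (u (j - 1, true)) (v (j - 1, true)) Real.pi -
      quasiDeriv A (j - 1, false) (u (j - 1, false)) (v (j - 1, false)) Real.pi =
    (α j : ℂ) * u (j, true) 0

theorem EdgeL2.integrableOn (g : EdgeL2) : IntegrableOn g (Ioo (0 : ℝ) Real.pi) volume :=
  (Lp.memLp g).integrable (by norm_num)

theorem EdgeL2.intervalIntegrable (g : EdgeL2) {a b : ℝ} (ha : a ∈ Icc (0 : ℝ) Real.pi)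
    (hb : b ∈ Icc (0 : ℝ) Real.pi) : IntervalIntegrable g volume a b := by
  have h : IntegrableOn g (Icc (0 : ℝ) Real.pi) volume :=
    (integrableOn_Icc_iff_integrableOn_Ioo (by simp) (by simp)).2 g.integrableOn
  exact (h.mono_set (uIcc_subset_Icc ha hb)).intervalIntegrable

theorem EdgeL2.integral_congr {g : EdgeL2} {k : ℝ → ℂ}
    (h : (g : ℝ → ℂ) =ᵐ[volume.restrict (Ioo (0 : ℝ) Real.pi)] k) {x : ℝ}
    (hx : x ∈ Icc (0 : ℝ) Real.pi) : ∫ t in (0 : ℝ)..x, g t = ∫ t in (0 : ℝ)..x, k t := by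
  rw [intervalIntegral.integral_of_le hx.1, intervalIntegral.integral_of_le hx.1,
    integral_Ioc_eq_integral_Ioo, integral_Ioc_eq_integral_Ioo]
  exact integral_congr_ae (ae_restrict_of_ae_restrict_of_subset (Ioo_subset_Ioo_right hx.2) h)

theorem IsH2.zero : IsH2 0 0 0 where
  deriv x _ := hasDerivWithinAt_const x _ (0 : ℂ)
  deriv₂ x hx := by
    rw [EdgeL2.integral_congr (Lp.coeFn_zero _ _ _) hx]; simp

theorem IsH2.add {u v u' v' : ℝ → ℂ} {g g' : EdgeL2} (h : IsH2 u v g) (h' : IsH2 u' v' g') :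
    IsH2 (u + u') (v + v') (g + g') where
  deriv x hx := (h.deriv x hx).add (h'.deriv x hx)
  deriv₂ x hx := by
    have h0 : (0 : ℝ) ∈ Icc (0 : ℝ) Real.pi := ⟨le_rfl, Real.pi_pos.le⟩
    rw [EdgeL2.integral_congr (Lp.coeFn_add g g') hx]
    simp only [Pi.add_apply]
    rw [intervalIntegral.integral_add (g.intervalIntegrable h0 hx) (g'.intervalIntegrable h0 hx),
      h.deriv₂ x hx, h'.deriv₂ x hx]
    ring

theorem IsH2.smul {u v : ℝ → ℂ} {g : EdgeL2} (h : IsH2 u v g) (c : ℂ) :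
    IsH2 (c • u) (c • v) (c • g) where
  deriv x hx := (h.deriv x hx).const_smul c
  deriv₂ x hx := by
    rw [EdgeL2.integral_congr (Lp.coeFn_smul c g) hx]
    simp only [Pi.smul_apply, smul_eq_mul]
    rw [intervalIntegral.integral_const_mul, h.deriv₂ x hx]
    ring

/-- The graph of the Hamiltonian. -/
def graph (A : ℝ) (α : ℤ → ℝ) : Submodule ℂ (ChainL2 × ChainL2) where
  carrier := {p | ∃ u v g, IsAction A α p.1 p.2 u v g}
  zero_mem' := by
    refine ⟨0, 0, 0, fun _ => IsH2.zero, fun e => ?_, fun e => ?_, fun j => by simp,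
      fun j => by simp [quasiDeriv]⟩
    · exact Lp.coeFn_zero _ _ _
    · filter_upwards [Lp.coeFn_zero ℂ 2 (volume.restrict (Ioo (0 : ℝ) Real.pi))] with x hx
      have hx' : (0 : EdgeL2) x = (0 : ℂ) := hx
      simp only [Prod.snd_zero, lp.coeFn_zero, Pi.zero_apply, hx']
      simp
  add_mem' := by
    rintro p q ⟨u, v, g, h⟩ ⟨u', v', g', h'⟩
    refine ⟨u + u', v + v', g + g', fun e => (h.sobolev e).add (h'.sobolev e), fun e => ?_,
      fun e => ?_, fun j => ?_, fun j => ?_⟩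
    · filter_upwards [Lp.coeFn_add (p.1 e) (q.1 e), h.repr e, h'.repr e] with x h1 h2 h3
      rw [Prod.fst_add, lp.coeFn_add, Pi.add_apply, h1, Pi.add_apply, h2, h3]
      rfl
    · filter_upwards [Lp.coeFn_add (p.2 e) (q.2 e), h.action e, h'.action e,
        Lp.coeFn_add (g e) (g' e)] with x h1 h2 h3 h4
      rw [Prod.snd_add, lp.coeFn_add, Pi.add_apply, h1, Pi.add_apply, h2, h3]
      simp only [Pi.add_apply] at h4 ⊢
      rw [h4]
      ring
    · obtain ⟨h1, h2, h3⟩ := h.continuity j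
      obtain ⟨h1', h2', h3'⟩ := h'.continuity j
      simp only [Pi.add_apply]
      exact ⟨by rw [h1, h1'], by rw [h2, h2'], by rw [h3, h3']⟩
    · have e1 := h.coupling j
      have e2 := h'.coupling j
      simp only [quasiDeriv, Pi.add_apply] at e1 e2 ⊢
      linear_combination e1 + e2
  smul_mem' := by
    rintro c p ⟨u, v, g, h⟩
    refine ⟨c • u, c • v, c • g, fun e => (h.sobolev e).smul c, fun e => ?_,
      fun e => ?_, fun j => ?_, fun j => ?_⟩
    · filter_upwards [Lp.coeFn_smul c (p.1 e), h.repr e] with x h1 h2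
      rw [Prod.smul_fst, lp.coeFn_smul, Pi.smul_apply, h1, Pi.smul_apply, h2]
      rfl
    · filter_upwards [Lp.coeFn_smul c (p.2 e), h.action e, Lp.coeFn_smul c (g e)] with x h1 h2 h4
      rw [Prod.smul_snd, lp.coeFn_smul, Pi.smul_apply, h1, Pi.smul_apply, h2]
      simp only [Pi.smul_apply, smul_eq_mul] at h4 ⊢
      rw [h4]
      ring
    · obtain ⟨h1, h2, h3⟩ := h.continuity j
      simp only [Pi.smul_apply]
      exact ⟨by rw [h1], by rw [h2], by rw [h3]⟩
    · have e1 := h.coupling j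
      simp only [quasiDeriv, Pi.smul_apply, smul_eq_mul] at e1 ⊢
      linear_combination c * e1

/-- The magnetic Hamiltonian of the chain, acting as `-D²` on each edge, with delta coupling of
strength `α j` at the `j`-th vertex; the domain consists of all `f ∈ L²(Γ)` that are `H²` on
each edge, satisfy the vertex conditions, and have `-D² f ∈ L²(Γ)`. -/
noncomputable def hamiltonian (A : ℝ) (α : ℤ → ℝ) : ChainL2 →ₗ.[ℂ] ChainL2 :=
  (graph A α).toLinearPMap

/-- `graph A α` is the graph of a function, so it is the graph of `hamiltonian A α`. -/
theorem hamiltonian_graph (A : ℝ) (α : ℤ → ℝ) : (hamiltonian A α).graph = graph A α := by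
  refine Submodule.toLinearPMap_graph_eq _ ?_
  rintro ⟨f, h⟩ ⟨u, v, g, H⟩ hf
  change f = 0 at hf
  subst hf
  have hpi := Real.pi_pos
  have huniq : UniqueDiffOn ℝ (Icc (0 : ℝ) Real.pi) := uniqueDiffOn_Icc hpi
  refine lp.ext (funext fun e => ?_)
  have hu0 : ∀ x ∈ Icc (0 : ℝ) Real.pi, u e x = 0 := by
    have hc : ContinuousOn (u e) (Icc (0 : ℝ) Real.pi) :=
      fun x hx => ((H.sobolev e).deriv x hx).continuousWithinAt
    have hae : u e =ᵐ[volume.restrict (Ioo (0 : ℝ) Real.pi)] fun _ => (0 : ℂ) := by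
      filter_upwards [H.repr e, Lp.coeFn_zero ℂ 2 (volume.restrict (Ioo (0 : ℝ) Real.pi))]
        with x h1 h2
      rw [← h1]
      exact h2
    have hae' : u e =ᵐ[volume.restrict (Icc (0 : ℝ) Real.pi)] fun _ => (0 : ℂ) := by
      rw [← restrict_Ioo_eq_restrict_Icc]
      exact hae
    exact Measure.eqOn_Icc_of_ae_eq volume hpi.ne hae' hc continuousOn_const
  have hv0 : ∀ x ∈ Icc (0 : ℝ) Real.pi, v e x = 0 := fun x hx => by
    have h1 := ((H.sobolev e).deriv x hx).congr (fun y hy => (hu0 y hy).symm) (hu0 x hx).symm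
    exact (huniq x hx).eq_deriv _ h1 (hasDerivWithinAt_const x _ (0 : ℂ))
  have h0 : (0 : ℝ) ∈ Icc (0 : ℝ) Real.pi := ⟨le_rfl, hpi.le⟩
  have hg0 : ∀ᵐ x ∂(volume.restrict (Ioo (0 : ℝ) Real.pi)), g e x = 0 := by
    have hint : ∀ x ∈ Icc (0 : ℝ) Real.pi, ∫ t in (0 : ℝ)..x, g e t = 0 := fun x hx => by
      have := (H.sobolev e).deriv₂ x hx
      rw [hv0 x hx, hv0 0 h0, zero_add] at this
      exact this.symm
    have hL := ((g e).intervalIntegrable h0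
      (⟨hpi.le, le_rfl⟩ : Real.pi ∈ Icc (0 : ℝ) Real.pi)).ae_hasDerivAt_integral
    rw [ae_restrict_iff' measurableSet_Ioo]
    filter_upwards [hL] with x hx hxI
    have hd := hx (by rw [uIcc_of_le hpi.le]; exact Ioo_subset_Icc_self hxI) 0
      (by rw [uIcc_of_le hpi.le]; exact h0)
    have hz : HasDerivAt (fun y => ∫ t in (0 : ℝ)..y, g e t) 0 x :=
      (hasDerivAt_const x (0 : ℂ)).congr_of_eventuallyEq (by
        filter_upwards [Ioo_mem_nhds hxI.1 hxI.2] with y hy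
        exact hint y (Ioo_subset_Icc_self hy))
    exact hd.unique hz
  refine Lp.ext ?_
  filter_upwards [H.action e, hg0, ae_restrict_mem measurableSet_Ioo,
    Lp.coeFn_zero ℂ 2 (volume.restrict (Ioo (0 : ℝ) Real.pi))] with x h1 h2 h3 h4
  rw [h1, h2, hu0 x (Ioo_subset_Icc_self h3), hv0 x (Ioo_subset_Icc_self h3)]
  rw [lp.coeFn_zero, Pi.zero_apply, h4]
  simp

/-- The coupling constants of a chain with coupling `α` at all vertices, perturbed by `γ₁` and
`γ₂` at the vertices `1` and `2`. -/
def twoImpurities (α γ₁ γ₂ : ℝ) (j : ℤ) : ℝ :=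
  if j = 1 then α + γ₁ else if j = 2 then α + γ₂ else α

end MagneticChain

/-! ### Absolutely continuous functions on `[0, π]` and Green's formula. -/

section

open MeasureTheory Set Filter Topology

/-! The gauge factor `e^{iax}` removes the vector potential from an edge, where `-D²u = Eu + r` is
then solved with the fundamental solutions `C = cosE E` and `S = sinE E`. Write `c = cos(Aπ)` and
take `C`, `S` at `π`. For `S ≠ 0`, that is, for `E ≠ n²` with `n ≥ 1`, solving `(H - E)f = r`
amounts to solving a Jacobi equation for the vertex values: `2c(y_{j+1} + y_{j-1}) - (4C + β_j S)
y_j` is a given source (`IsAction.jacobi_eq`, `exists_isAction_of_jacobi`).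

For constant coupling put `ξ = C + (α/4)S`. If `|ξ| > |c|`, a Neumann series inverts the Jacobi
operator, and the impurities change it only by a rank two term. If `|ξ| ≤ |c|`, solutions on a
half-line do not decay, which obstructs surjectivity (for `c = 0` the eigenvalue is infinitely
degenerate instead). Each `n²` is an infinitely degenerate eigenvalue. Hence the essential spectrum
is `essSet A α` for all impurities.

Since `A` is not an integer, `|c| < 1`. Between consecutive squares `(-1)^n ξ` runs from `1` (or
from large values, if `n = 0`) to `-1` and crosses each level of `[-1, 1]` only once (`xi_lt_iff`).
So every cell contains one band in its interior, bands alternate with the points `n²`, odd gaps lie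
to the left of a band and even gaps to the right.

Existence. In a gap choose the sign `s` with `sξ > |c|`, and put `T = sS` and `μ = sξ + √(ξ² - c²)`.
Decaying solutions on both sides match at the vertices `1` and `2` if and only if the symmetric
matrix with diagonal entries `μ + γ₁T/2`, `μ + γ₂T/2` and off-diagonal entries `-sc` is singular.
The function `secular` is its smaller eigenvalue. At the band edge `μ = |c|`, so it is negative when
`(γ₁ + γ₂)T < 0`; at the opposite end of the gap it is positive. As `T > 0` in odd and `T < 0` in
even gaps, the intermediate value theorem gives an eigenvalue in the gaps claimed.

Upper bound. On functions that vanish at the vertices `1` and `2` the operator agrees with the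
unperturbed one. More than two independent eigenfunctions in a gap would have a nonzero combination
of this kind, on which the unperturbed operator would be closer to a scalar than the distance to its
spectrum allows (`IsSymmetric.eq_zero_of_agree`). -/

theorem AbsolutelyContinuousOnInterval.of_dist_le {X Y : Type*} [PseudoMetricSpace X]
    [PseudoMetricSpace Y] {f : ℝ → X} {g : ℝ → Y} {a b : ℝ}
    (hg : AbsolutelyContinuousOnInterval g a b)
    (h : ∀ x ∈ uIcc a b, ∀ y ∈ uIcc a b, dist (f x) (f y) ≤ dist (g x) (g y)) :
    AbsolutelyContinuousOnInterval f a b := by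
  rw [absolutelyContinuousOnInterval_iff] at hg ⊢
  intro ε hε
  obtain ⟨δ, hδ, H⟩ := hg ε hε
  refine ⟨δ, hδ, fun E hE hs => lt_of_le_of_lt (Finset.sum_le_sum fun i hi => ?_) (H E hE hs)⟩
  exact h _ (hE.1 i hi).1 _ (hE.1 i hi).2

namespace MagneticChain

theorem zero_mem_Icc_pi : (0 : ℝ) ∈ Icc (0 : ℝ) Real.pi := ⟨le_rfl, Real.pi_pos.le⟩

theorem pi_mem_Icc_pi : Real.pi ∈ Icc (0 : ℝ) Real.pi := ⟨Real.pi_pos.le, le_rfl⟩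

/-- `u` is absolutely continuous on `[0, π]` with integrable derivative `v`. -/
structure IsPrimitive (u v : ℝ → ℂ) : Prop where
  integrable : IntervalIntegrable v volume 0 Real.pi
  eq : ∀ x ∈ Icc (0 : ℝ) Real.pi, u x = u 0 + ∫ t in (0 : ℝ)..x, v t

theorem intervalIntegrable_sub {v : ℝ → ℂ} (h : IntervalIntegrable v volume 0 Real.pi) {a b : ℝ}
    (ha : a ∈ Icc (0 : ℝ) Real.pi) (hb : b ∈ Icc (0 : ℝ) Real.pi) :
    IntervalIntegrable v volume a b :=
  h.mono_set (by rw [uIcc_of_le Real.pi_pos.le]; exact uIcc_subset_Icc ha hb)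

/-- Interval integrals over `[0, x]` only depend on the a.e. class on `(0, π)`. -/
theorem integral_congr_Ioo {k l : ℝ → ℂ}
    (h : k =ᵐ[volume.restrict (Ioo (0 : ℝ) Real.pi)] l) {x : ℝ}
    (hx : x ∈ Icc (0 : ℝ) Real.pi) : ∫ t in (0 : ℝ)..x, k t = ∫ t in (0 : ℝ)..x, l t := by
  rw [intervalIntegral.integral_of_le hx.1, intervalIntegral.integral_of_le hx.1,
    integral_Ioc_eq_integral_Ioo, integral_Ioc_eq_integral_Ioo]
  exact integral_congr_ae (ae_restrict_of_ae_restrict_of_subset (Ioo_subset_Ioo_right hx.2) h)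

theorem intervalIntegrable_iff_Ioo {k : ℝ → ℂ} :
    IntervalIntegrable k volume 0 Real.pi ↔ IntegrableOn k (Ioo (0 : ℝ) Real.pi) volume := by
  rw [intervalIntegrable_iff_integrableOn_Ioo_of_le Real.pi_pos.le]

theorem ae_Ioo_of_forall {p : ℝ → Prop} (h : ∀ x ∈ Icc (0 : ℝ) Real.pi, p x) :
    ∀ᵐ x ∂(volume.restrict (Ioo (0 : ℝ) Real.pi)), p x := by
  filter_upwards [ae_restrict_mem measurableSet_Ioo] with x hx
  exact h x (Ioo_subset_Icc_self hx)

namespace IsPrimitive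

variable {u v u' v' : ℝ → ℂ}

/-- Increments of `u` are dominated by those of the real primitive of `‖v‖`. -/
theorem absolutelyContinuous (h : IsPrimitive u v) :
    AbsolutelyContinuousOnInterval u 0 Real.pi := by
  refine (h.integrable.norm.absolutelyContinuousOnInterval_intervalIntegral
    (c := 0) left_mem_uIcc).of_dist_le fun x hx y hy => ?_
  rw [uIcc_of_le Real.pi_pos.le] at hx hy
  have h0 := zero_mem_Icc_pi
  rw [h.eq x hx, h.eq y hy, dist_add_left, dist_comm, dist_eq_norm, dist_comm, Real.dist_eq,
    intervalIntegral.integral_interval_sub_left (intervalIntegrable_sub h.integrable h0 hy)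
      (intervalIntegrable_sub h.integrable h0 hx),
    intervalIntegral.integral_interval_sub_left (intervalIntegrable_sub h.integrable h0 hy).norm
      (intervalIntegrable_sub h.integrable h0 hx).norm]
  exact intervalIntegral.norm_integral_le_abs_integral_norm

theorem continuousOn (h : IsPrimitive u v) : ContinuousOn u (Icc 0 Real.pi) := by
  have := h.absolutelyContinuous.continuousOn
  rwa [uIcc_of_le Real.pi_pos.le] at this

theorem ae_hasDerivAt (h : IsPrimitive u v) :
    ∀ᵐ x, x ∈ Ioo 0 Real.pi → HasDerivAt u (v x) x := by
  filter_upwards [h.integrable.ae_hasDerivAt_integral] with x hx hxI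
  have hd := hx (by rw [uIcc_of_le Real.pi_pos.le]; exact Ioo_subset_Icc_self hxI) 0 left_mem_uIcc
  refine (hd.const_add (u 0)).congr_of_eventuallyEq ?_
  filter_upwards [Ioo_mem_nhds hxI.1 hxI.2] with y hy
  exact h.eq y (Ioo_subset_Icc_self hy)

/-- The difference between `u` and the primitive of `v` is absolutely continuous with derivative
zero almost everywhere, hence constant. -/
theorem of_ae_hasDerivAt (hu : AbsolutelyContinuousOnInterval u 0 Real.pi)
    (hv : IntervalIntegrable v volume 0 Real.pi)
    (h : ∀ᵐ x, x ∈ Ioo 0 Real.pi → HasDerivAt u (v x) x) : IsPrimitive u v := by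
  have hI : IsPrimitive (fun x => ∫ t in (0 : ℝ)..x, v t) v := ⟨hv, fun x _ => by simp⟩
  obtain ⟨c, hc⟩ := (hu.sub hI.absolutelyContinuous).const_of_ae_hasDerivAt_zero (by
    have h1 : ∀ᵐ x : ℝ, x ≠ 0 := by simp [ae_iff, measure_singleton]
    have h2 : ∀ᵐ x : ℝ, x ≠ Real.pi := by simp [ae_iff, measure_singleton]
    filter_upwards [h, hI.ae_hasDerivAt, h1, h2] with x hx hx' n1 n2 hxI
    rw [uIcc_of_le Real.pi_pos.le] at hxI
    have hxo : x ∈ Ioo 0 Real.pi := ⟨lt_of_le_of_ne hxI.1 n1.symm, lt_of_le_of_ne hxI.2 n2⟩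
    simpa using (hx hxo).sub (hx' hxo))
  rw [uIcc_of_le Real.pi_pos.le] at hc
  refine ⟨hv, fun x hx => ?_⟩
  have e1 := hc x hx
  have e0 := hc 0 zero_mem_Icc_pi
  simp only [Pi.sub_apply, intervalIntegral.integral_same, sub_zero] at e1 e0
  rw [e0, ← e1]; ring

theorem congr (h : IsPrimitive u v) (hu : EqOn u' u (Icc 0 Real.pi))
    (hv : v' =ᵐ[volume.restrict (Ioo (0 : ℝ) Real.pi)] v) : IsPrimitive u' v' where
  integrable := by
    rw [intervalIntegrable_iff_Ioo] at *
    exact (intervalIntegrable_iff_Ioo.1 h.integrable).congr hv.symm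
  eq x hx := by
    rw [hu hx, hu zero_mem_Icc_pi, integral_congr_Ioo hv hx]
    exact h.eq x hx

theorem add (h : IsPrimitive u v) (h' : IsPrimitive u' v') :
    IsPrimitive (fun x => u x + u' x) (fun x => v x + v' x) where
  integrable := h.integrable.add h'.integrable
  eq x hx := by
    rw [intervalIntegral.integral_add (intervalIntegrable_sub h.integrable zero_mem_Icc_pi hx)
      (intervalIntegrable_sub h'.integrable zero_mem_Icc_pi hx), h.eq x hx, h'.eq x hx]
    ring

theorem const_mul (h : IsPrimitive u v) (c : ℂ) :
    IsPrimitive (fun x => c * u x) (fun x => c * v x) where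
  integrable := h.integrable.const_mul c
  eq x hx := by
    rw [intervalIntegral.integral_const_mul, h.eq x hx]
    ring

theorem sub (h : IsPrimitive u v) (h' : IsPrimitive u' v') :
    IsPrimitive (fun x => u x - u' x) (fun x => v x - v' x) := by
  have := h.add (h'.const_mul (-1))
  simpa [sub_eq_add_neg] using this

/-- Integration by parts. Second derivatives are only integrable, so the product rule holds almost
everywhere and absolute continuity has to close the argument. -/
theorem mul (h : IsPrimitive u v) (h' : IsPrimitive u' v') :
    IsPrimitive (fun x => u x * u' x) (fun x => v x * u' x + u x * v' x) := by
  have hp := Real.pi_pos.le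
  refine of_ae_hasDerivAt ?_ ?_ ?_
  · exact h.absolutelyContinuous.fun_smul h'.absolutelyContinuous
  · exact (h.integrable.mul_continuousOn (by rw [uIcc_of_le hp]; exact h'.continuousOn)).add
      (h'.integrable.continuousOn_mul (by rw [uIcc_of_le hp]; exact h.continuousOn))
  · filter_upwards [h.ae_hasDerivAt, h'.ae_hasDerivAt] with x h1 h2 hx
    exact (h1 hx).mul (h2 hx)

theorem of_integral {v : ℝ → ℂ} (hv : IntervalIntegrable v volume 0 Real.pi) :
    IsPrimitive (fun x => ∫ t in (0 : ℝ)..x, v t) v := ⟨hv, fun x _ => by simp⟩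

theorem of_hasDerivWithinAt (h : ∀ x ∈ Icc (0 : ℝ) Real.pi,
    HasDerivWithinAt u (v x) (Icc (0 : ℝ) Real.pi) x) (hv : ContinuousOn v (Icc 0 Real.pi)) :
    IsPrimitive u v where
  integrable := ContinuousOn.intervalIntegrable (by rwa [uIcc_of_le Real.pi_pos.le])
  eq x hx := by
    rw [intervalIntegral.integral_eq_sub_of_hasDeriv_right_of_le hx.1
      (fun y hy => ((h y ⟨hy.1, hy.2.trans hx.2⟩).continuousWithinAt).mono
        (Icc_subset_Icc_right hx.2))
      (fun y hy => ?_)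
      (ContinuousOn.intervalIntegrable (by
        rw [uIcc_of_le hx.1]; exact hv.mono (Icc_subset_Icc_right hx.2)))]
    · ring
    · have hyI : y ∈ Ioo 0 Real.pi := ⟨hy.1, hy.2.trans_le hx.2⟩
      exact ((h y (Ioo_subset_Icc_self hyI)).hasDerivAt
        (Icc_mem_nhds hyI.1 hyI.2)).hasDerivWithinAt

theorem of_hasDerivAt (h : ∀ x, HasDerivAt u (v x) x) (hv : Continuous v) : IsPrimitive u v :=
  of_hasDerivWithinAt (fun x _ => (h x).hasDerivWithinAt) hv.continuousOn

theorem hasDerivWithinAt (h : IsPrimitive u v) (hv : ContinuousOn v (Icc 0 Real.pi)) {x : ℝ}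
    (hx : x ∈ Icc (0 : ℝ) Real.pi) : HasDerivWithinAt u (v x) (Icc (0 : ℝ) Real.pi) x := by
  have : Fact (x ∈ Icc (0 : ℝ) Real.pi) := ⟨hx⟩
  have hd : HasDerivWithinAt (fun y => ∫ t in (0 : ℝ)..y, v t) (v x) (Icc 0 Real.pi) x :=
    intervalIntegral.integral_hasDerivWithinAt_right
      (intervalIntegrable_sub h.integrable zero_mem_Icc_pi hx)
      (hv.stronglyMeasurableAtFilter_nhdsWithin measurableSet_Icc x) (hv x hx)
  exact (hd.const_add (u 0)).congr (fun y hy => h.eq y hy) (h.eq x hx)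

/-- Integrated form: the boundary term of a primitive. -/
theorem integral_eq (h : IsPrimitive u v) : ∫ t in (0 : ℝ)..Real.pi, v t = u Real.pi - u 0 := by
  rw [h.eq _ pi_mem_Icc_pi]; ring

end IsPrimitive

/-- Green's formula: `∫ (w'' p - w p'') = [w' p - w p']`. -/
theorem IsPrimitive.green {w w₁ w₂ p p₁ p₂ : ℝ → ℂ} (h : IsPrimitive w w₁)
    (h₁ : IsPrimitive w₁ w₂) (k : IsPrimitive p p₁) (k₁ : IsPrimitive p₁ p₂) :
    IsPrimitive (fun x => w₁ x * p x - w x * p₁ x) (fun x => w₂ x * p x - w x * p₂ x) := by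
  refine ((h₁.mul k).sub (h.mul k₁)).congr (fun _ _ => rfl) (Eventually.of_forall fun x => ?_)
  simp only
  ring

theorem IsPrimitive.green_integral {w w₁ w₂ p p₁ p₂ : ℝ → ℂ} (h : IsPrimitive w w₁)
    (h₁ : IsPrimitive w₁ w₂) (k : IsPrimitive p p₁) (k₁ : IsPrimitive p₁ p₂) :
    ∫ x in (0 : ℝ)..Real.pi, (w₂ x * p x - w x * p₂ x) =
      (w₁ Real.pi * p Real.pi - w Real.pi * p₁ Real.pi) - (w₁ 0 * p 0 - w 0 * p₁ 0) :=
  (h.green h₁ k k₁).integral_eq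

end MagneticChain

end

/-! ### The fundamental solutions of `-w'' = E w`. -/

section

open MeasureTheory Set Filter Topology

namespace MagneticChain

/-- The solution `C` of `-w'' = E w` with `w 0 = 1` and `w' 0 = 0`. -/
noncomputable def cosE (E x : ℝ) : ℝ := Real.cos (√E * x) * Real.cosh (√(-E) * x)

/-- The solution `S` of `-w'' = E w` with `w 0 = 0` and `w' 0 = 1`. -/
noncomputable def sinE (E x : ℝ) : ℝ := ∫ t in (0 : ℝ)..x, cosE E t

theorem continuous_cosE : Continuous fun p : ℝ × ℝ => cosE p.1 p.2 := by
  unfold cosE; fun_prop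

theorem continuous_sinE : Continuous fun p : ℝ × ℝ => sinE p.1 p.2 :=
  intervalIntegral.continuous_parametric_primitive_of_continuous (f := cosE) continuous_cosE

theorem continuous_cosE_right (E : ℝ) : Continuous (cosE E) :=
  continuous_cosE.comp (by fun_prop : Continuous fun x : ℝ => (E, x))

theorem continuous_sinE_right (E : ℝ) : Continuous (sinE E) :=
  continuous_sinE.comp (by fun_prop : Continuous fun x : ℝ => (E, x))

theorem continuous_cosE_left (x : ℝ) : Continuous fun E => cosE E x :=
  continuous_cosE.comp (by fun_prop : Continuous fun E : ℝ => (E, x))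

theorem continuous_sinE_left (x : ℝ) : Continuous fun E => sinE E x :=
  continuous_sinE.comp (by fun_prop : Continuous fun E : ℝ => (E, x))

@[simp] theorem cosE_zero_right (E : ℝ) : cosE E 0 = 1 := by simp [cosE]

@[simp] theorem sinE_zero_right (E : ℝ) : sinE E 0 = 0 := by simp [sinE]

theorem hasDerivAt_sinE (E x : ℝ) : HasDerivAt (sinE E) (cosE E x) x :=
  (continuous_cosE_right E).integral_hasStrictDerivAt 0 x |>.hasDerivAt

theorem hasDerivAt_cosE (E x : ℝ) : HasDerivAt (cosE E) (-E * sinE E x) x := by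
  have hd (k y : ℝ) : HasDerivAt (fun y => k * y) k y := by
    simpa using (hasDerivAt_id y).const_mul k
  set G : ℝ → ℝ := fun y => -Real.sin (√E * y) * √E * Real.cosh (√(-E) * y) +
    Real.cos (√E * y) * (Real.sinh (√(-E) * y) * √(-E)) with hG
  have h1 (y : ℝ) : HasDerivAt (cosE E) (G y) y := (hd _ y).cos.mul (hd _ y).cosh
  -- `√` is zero on negative numbers, so one factor in `cosE` is identically `1`, and one formula
  -- serves both signs of `E`.
  have hs : √E * √(-E) = 0 := by
    rcases le_total E 0 with h | h
    · rw [Real.sqrt_eq_zero_of_nonpos h, zero_mul]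
    · rw [Real.sqrt_eq_zero_of_nonpos (neg_nonpos.2 h), mul_zero]
  have hs2 : √(-E) * √(-E) - √E * √E = -E := by
    rcases le_total E 0 with h | h
    · rw [Real.sqrt_eq_zero_of_nonpos h, Real.mul_self_sqrt (neg_nonneg.2 h)]; ring
    · rw [Real.sqrt_eq_zero_of_nonpos (neg_nonpos.2 h), Real.mul_self_sqrt h]; ring
  have h2 (y : ℝ) : HasDerivAt G (-E * cosE E y) y := by
    have := (((hd (√E) y).sin.neg.mul_const √E).mul (hd (√(-E)) y).cosh).add
      ((hd (√E) y).cos.mul ((hd (√(-E)) y).sinh.mul_const √(-E)))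
    refine this.congr_deriv ?_
    simp only [cosE, Pi.neg_apply]
    linear_combination (Real.cos (√E * y) * Real.cosh (√(-E) * y)) * hs2 -
      2 * Real.sin (√E * y) * Real.sinh (√(-E) * y) * hs
  have key (z : ℝ) : HasDerivAt (fun y => G y - -E * sinE E y) 0 z := by
    refine ((h2 z).sub ((hasDerivAt_sinE E z).const_mul (-E))).congr_deriv ?_
    ring
  have h4 := is_const_of_deriv_eq_zero (fun z => (key z).differentiableAt)
    (fun z => (key z).deriv) x 0
  simp only [sinE_zero_right] at h4
  have : G x = -E * sinE E x := by
    have : G 0 = 0 := by simp [hG]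
    linarith
  rw [← this]
  exact h1 x

/-- With the sum of the two arguments frozen at `x + y`, the right-hand side does not depend on how
it is split; compare the splittings `x + y` and `0 + (x + y)`. -/
theorem cosE_add (E x y : ℝ) : cosE E (x + y) = cosE E x * cosE E y - E * (sinE E x * sinE E y) := by
  have hr (z : ℝ) : HasDerivAt (fun t => x + y - t) (-1) z := by
    simpa using (hasDerivAt_id z).const_sub (x + y)
  have key (z : ℝ) : HasDerivAt (fun t => cosE E t * cosE E (x + y - t) -
      E * (sinE E t * sinE E (x + y - t))) 0 z := by
    refine (((hasDerivAt_cosE E z).mul ((hasDerivAt_cosE E _).comp z (hr z))).sub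
      (((hasDerivAt_sinE E z).mul ((hasDerivAt_sinE E _).comp z (hr z))).const_mul E)).congr_deriv ?_
    simp only [Function.comp_apply]
    ring
  have := is_const_of_deriv_eq_zero (fun z => (key z).differentiableAt) (fun z => (key z).deriv) x 0
  simp only [add_sub_cancel_left, cosE_zero_right, sub_zero, sinE_zero_right] at this
  linarith

theorem sinE_add (E x y : ℝ) : sinE E (x + y) = sinE E x * cosE E y + cosE E x * sinE E y := by
  have hr (z : ℝ) : HasDerivAt (fun t => x + y - t) (-1) z := by
    simpa using (hasDerivAt_id z).const_sub (x + y)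
  have key (z : ℝ) : HasDerivAt (fun t => sinE E t * cosE E (x + y - t) +
      cosE E t * sinE E (x + y - t)) 0 z := by
    refine (((hasDerivAt_sinE E z).mul ((hasDerivAt_cosE E _).comp z (hr z))).add
      ((hasDerivAt_cosE E z).mul ((hasDerivAt_sinE E _).comp z (hr z)))).congr_deriv ?_
    simp only [Function.comp_apply]
    ring
  have := is_const_of_deriv_eq_zero (fun z => (key z).differentiableAt) (fun z => (key z).deriv) x 0
  simp only [add_sub_cancel_left, cosE_zero_right, sub_zero, sinE_zero_right] at this
  linarith

theorem cosE_sq_add (E x : ℝ) : cosE E x ^ 2 + E * sinE E x ^ 2 = 1 := by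
  have key (z : ℝ) : HasDerivAt (fun t => cosE E t ^ 2 + E * sinE E t ^ 2) 0 z := by
    refine (((hasDerivAt_cosE E z).pow 2).add
      (((hasDerivAt_sinE E z).pow 2).const_mul E)).congr_deriv ?_
    ring
  have := is_const_of_deriv_eq_zero (fun z => (key z).differentiableAt) (fun z => (key z).deriv) x 0
  simpa using this

theorem cosE_of_nonneg {E : ℝ} (h : 0 ≤ E) (x : ℝ) : cosE E x = Real.cos (√E * x) := by
  simp [cosE, Real.sqrt_eq_zero_of_nonpos (neg_nonpos.2 h)]

theorem sqrt_mul_sinE {E : ℝ} (h : 0 ≤ E) (x : ℝ) : √E * sinE E x = Real.sin (√E * x) := by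
  have hd (k y : ℝ) : HasDerivAt (fun y => k * y) k y := by
    simpa using (hasDerivAt_id y).const_mul k
  have key (z : ℝ) : HasDerivAt (fun t => √E * sinE E t - Real.sin (√E * t)) 0 z := by
    refine (((hasDerivAt_sinE E z).const_mul √E).sub (hd _ z).sin).congr_deriv ?_
    rw [cosE_of_nonneg h]; ring
  have := is_const_of_deriv_eq_zero (fun z => (key z).differentiableAt) (fun z => (key z).deriv) x 0
  simp only [sinE_zero_right, mul_zero, Real.sin_zero, sub_zero] at this
  linarith

theorem one_le_cosE {E : ℝ} (h : E ≤ 0) (x : ℝ) : 1 ≤ cosE E x := by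
  simp [cosE, Real.sqrt_eq_zero_of_nonpos h]

theorem sinE_pos_of_nonpos {E x : ℝ} (h : E ≤ 0) (hx : 0 < x) : 0 < sinE E x :=
  intervalIntegral.intervalIntegral_pos_of_pos
    ((continuous_cosE_right E).intervalIntegrable _ _)
    (fun t => zero_lt_one.trans_le (one_le_cosE h t)) hx

/-- Drop the `1` in `C² = 1 + (-E)S²`. This makes `C` dominate every multiple of `S` far to the
left. -/
theorem sqrt_neg_mul_sinE_le {E : ℝ} (h : E ≤ 0) (x : ℝ) :
    √(-E) * sinE E x ≤ cosE E x := by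
  have h1 := cosE_sq_add E x
  have h2 := one_le_cosE h x
  refine le_of_sq_le_sq ?_ (by linarith)
  rw [mul_pow, Real.sq_sqrt (neg_nonneg.2 h)]
  linarith

theorem cosE_sq_nat (n : ℕ) : cosE ((n : ℝ) ^ 2) Real.pi = (-1) ^ n := by
  rw [cosE_of_nonneg (by positivity), Real.sqrt_sq (by positivity), Real.cos_nat_mul_pi]

theorem sinE_sq_nat {n : ℕ} (hn : 1 ≤ n) : sinE ((n : ℝ) ^ 2) Real.pi = 0 := by
  have h := sqrt_mul_sinE (E := (n : ℝ) ^ 2) (by positivity) Real.pi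
  rw [Real.sqrt_sq (by positivity), Real.sin_nat_mul_pi] at h
  have : (n : ℝ) ≠ 0 := by positivity
  exact (mul_eq_zero.1 h).resolve_left this

theorem sinE_pi_pos_of_lt_one {E : ℝ} (h : E < 1) : 0 < sinE E Real.pi := by
  rcases le_or_gt E 0 with h0 | h0
  · exact sinE_pos_of_nonpos h0 Real.pi_pos
  · have hs : 0 < √E := Real.sqrt_pos.2 h0
    have hs1 : √E < 1 := by rw [Real.sqrt_lt' one_pos]; linarith
    have h2 := sqrt_mul_sinE h0.le Real.pi
    have h3 : 0 < Real.sin (√E * Real.pi) :=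
      Real.sin_pos_of_pos_of_lt_pi (by positivity) (by nlinarith [Real.pi_pos])
    rw [← h2] at h3
    exact (mul_pos_iff_of_pos_left hs).1 h3

theorem neg_one_pow_mul_sinE_pos {n : ℕ} {E : ℝ} (h : (n : ℝ) ^ 2 < E)
    (h' : E < ((n : ℝ) + 1) ^ 2) : 0 < (-1) ^ n * sinE E Real.pi := by
  have h0 : 0 < E := lt_of_le_of_lt (by positivity) h
  have hs : 0 < √E := Real.sqrt_pos.2 h0
  have hs1 : √E < n + 1 := by rw [Real.sqrt_lt' (by positivity)]; exact h'
  have hs2 : (n : ℝ) < √E := Real.lt_sqrt_of_sq_lt h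
  have h2 := sqrt_mul_sinE h0.le Real.pi
  have h3 : 0 < Real.sin (√E * Real.pi - n * Real.pi) :=
    Real.sin_pos_of_pos_of_lt_pi (by nlinarith [Real.pi_pos]) (by nlinarith [Real.pi_pos])
  rw [Real.sin_sub_nat_mul_pi, ← h2] at h3
  have : 0 < √E * ((-1) ^ n * sinE E Real.pi) := by linarith
  exact (mul_pos_iff_of_pos_left hs).1 this

end MagneticChain

end

/-! ### Square integrable functions and the operator on a single edge. -/

section

open MeasureTheory Set Filter Topology

namespace MagneticChain

/-- Lebesgue measure on the interval `(0, π)`. -/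
noncomputable abbrev edgeMeasure : Measure ℝ := volume.restrict (Ioo (0 : ℝ) Real.pi)

/-! ### Primitives of concrete functions -/

theorem IsPrimitive.ofReal {p p' : ℝ → ℝ} (h : ∀ x, HasDerivAt p (p' x) x) (hp : Continuous p') :
    IsPrimitive (fun x => (p x : ℂ)) (fun x => (p' x : ℂ)) :=
  IsPrimitive.of_hasDerivAt (fun x => (h x).ofReal_comp) (Complex.continuous_ofReal.comp hp)

theorem IsPrimitive.conj {u v : ℝ → ℂ} (h : IsPrimitive u v) :
    IsPrimitive (fun x => starRingEnd ℂ (u x)) (fun x => starRingEnd ℂ (v x)) where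
  integrable := by
    have := intervalIntegrable_iff_Ioo.1 h.integrable
    rw [intervalIntegrable_iff_Ioo]
    exact (ContinuousLinearEquiv.integrable_comp_iff
      (Complex.conjCLE : ℂ ≃L[ℝ] ℂ)).2 this
  eq x hx := by
    rw [h.eq x hx, map_add, intervalIntegral.intervalIntegral_eq_integral_uIoc,
      intervalIntegral.intervalIntegral_eq_integral_uIoc]
    simp only [hx.1, if_true, one_smul]
    rw [integral_conj]

/-- The gauge factor `e^{iax}`. -/
noncomputable def phase (a x : ℝ) : ℂ := Complex.exp (Complex.I * a * x)

theorem phase_zero (a : ℝ) : phase a 0 = 1 := by simp [phase]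

theorem phase_mul_phase_neg (a x : ℝ) : phase a x * phase (-a) x = 1 := by
  rw [phase, phase, ← Complex.exp_add]; simp

theorem conj_phase (a x : ℝ) : starRingEnd ℂ (phase a x) = phase (-a) x := by
  rw [phase, phase, ← Complex.exp_conj]; simp

theorem norm_phase (a x : ℝ) : ‖phase a x‖ = 1 := by
  rw [phase, show Complex.I * a * x = ((a * x : ℝ) : ℂ) * Complex.I by push_cast; ring]
  exact Complex.norm_exp_ofReal_mul_I _

theorem continuous_phase (a : ℝ) : Continuous (phase a) := by unfold phase; fun_prop

theorem isPrimitive_phase (a : ℝ) : IsPrimitive (phase a) (fun x => Complex.I * a * phase a x) := by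
  refine IsPrimitive.of_hasDerivAt (fun x => ?_) (continuous_const.mul (continuous_phase a))
  have h1 : HasDerivAt (fun x : ℝ => Complex.I * a * (x : ℂ)) (Complex.I * a) x := by
    simpa using (Complex.ofRealCLM.hasDerivAt (x := x)).const_mul (Complex.I * (a : ℂ))
  exact h1.cexp.congr_deriv (by rw [phase]; ring)

theorem isPrimitive_cosE (E : ℝ) :
    IsPrimitive (fun x => (cosE E x : ℂ)) (fun x => ((-E * sinE E x : ℝ) : ℂ)) :=
  IsPrimitive.ofReal (hasDerivAt_cosE E) ((continuous_sinE_right E).const_mul _)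

theorem isPrimitive_sinE (E : ℝ) :
    IsPrimitive (fun x => (sinE E x : ℂ)) (fun x => (cosE E x : ℂ)) :=
  IsPrimitive.ofReal (hasDerivAt_sinE E) (continuous_cosE_right E)

theorem hasDerivAt_pi_sub (x : ℝ) : HasDerivAt (fun x => Real.pi - x) (-1) x := by
  simpa using (hasDerivAt_id x).const_sub Real.pi

theorem isPrimitive_cosE_pi_sub (E : ℝ) : IsPrimitive (fun x => (cosE E (Real.pi - x) : ℂ))
    (fun x => ((E * sinE E (Real.pi - x) : ℝ) : ℂ)) :=
  IsPrimitive.ofReal (p := fun x => cosE E (Real.pi - x))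
    (fun x => ((hasDerivAt_cosE E _).comp x (hasDerivAt_pi_sub x)).congr_deriv (by ring))
    (((continuous_sinE_right E).comp (by fun_prop)).const_mul _)

theorem isPrimitive_sinE_pi_sub (E : ℝ) : IsPrimitive (fun x => (sinE E (Real.pi - x) : ℂ))
    (fun x => ((-cosE E (Real.pi - x) : ℝ) : ℂ)) :=
  IsPrimitive.ofReal (p := fun x => sinE E (Real.pi - x))
    (fun x => ((hasDerivAt_sinE E _).comp x (hasDerivAt_pi_sub x)).congr_deriv (by ring))
    (((continuous_cosE_right E).comp (by fun_prop)).neg)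

/-! ### Elements of `L²(0, π)` -/

theorem EdgeL2.exists_ae_eq {φ : ℝ → ℂ} (h : ContinuousOn φ (Icc 0 Real.pi)) :
    ∃ f : EdgeL2, (f : ℝ → ℂ) =ᵐ[edgeMeasure] φ := by
  obtain ⟨M, hM⟩ := isCompact_Icc.exists_bound_of_continuousOn h
  have hm : MemLp φ 2 edgeMeasure := MemLp.of_bound
    ((h.mono Ioo_subset_Icc_self).aestronglyMeasurable measurableSet_Ioo) M (ae_Ioo_of_forall hM)
  exact ⟨hm.toLp φ, hm.coeFn_toLp⟩

theorem EdgeL2.norm_le_of_ae_eq :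
    ∃ K : ℝ, 0 ≤ K ∧ ∀ (f : EdgeL2) (φ : ℝ → ℂ) (B : ℝ), 0 ≤ B → (f : ℝ → ℂ) =ᵐ[edgeMeasure] φ →
      (∀ x ∈ Icc (0 : ℝ) Real.pi, ‖φ x‖ ≤ B) → ‖f‖ ≤ K * B := by
  refine ⟨_, by positivity, fun f φ B hB hf hφ => Lp.norm_le_of_ae_bound hB ?_⟩
  filter_upwards [hf, ae_Ioo_of_forall hφ] with x h1 h2
  rwa [h1]

theorem EdgeL2.integral_norm_le :
    ∃ K : ℝ, 0 ≤ K ∧ ∀ r : EdgeL2, ∫ x in (0 : ℝ)..Real.pi, ‖r x‖ ≤ K * ‖r‖ := by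
  refine ⟨((edgeMeasure univ) ^ (1 / (1 : ENNReal).toReal - 1 / (2 : ENNReal).toReal)).toReal,
    ENNReal.toReal_nonneg, fun r => ?_⟩
  have h := eLpNorm_le_eLpNorm_mul_rpow_measure_univ (μ := edgeMeasure) (f := r)
    (p := 1) (q := 2) (by norm_num) (Lp.aestronglyMeasurable r)
  rw [intervalIntegral.integral_of_le Real.pi_pos.le, integral_Ioc_eq_integral_Ioo,
    integral_norm_eq_lintegral_enorm (Lp.aestronglyMeasurable r), ← eLpNorm_one_eq_lintegral_enorm,
    Lp.norm_def, mul_comm, ← ENNReal.toReal_mul]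
  refine ENNReal.toReal_mono (ENNReal.mul_ne_top (Lp.eLpNorm_ne_top r) ?_) h
  exact ENNReal.rpow_ne_top_of_nonneg (by norm_num) (measure_ne_top _ _)

theorem EdgeL2.intervalIntegrable_mul {φ : ℝ → ℂ} (hφ : ContinuousOn φ (Icc 0 Real.pi))
    (r : EdgeL2) : IntervalIntegrable (fun x => φ x * r x) volume 0 Real.pi :=
  (r.intervalIntegrable zero_mem_Icc_pi pi_mem_Icc_pi).continuousOn_mul
    (by rwa [uIcc_of_le Real.pi_pos.le])

theorem EdgeL2.norm_integral_mul_le {φ : ℝ → ℂ} (hφ : ContinuousOn φ (Icc 0 Real.pi)) :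
    ∃ K : ℝ, 0 ≤ K ∧ ∀ r : EdgeL2, ∀ x ∈ Icc (0 : ℝ) Real.pi,
      ‖∫ t in (0 : ℝ)..x, φ t * r t‖ ≤ K * ‖r‖ := by
  obtain ⟨M, hM⟩ := isCompact_Icc.exists_bound_of_continuousOn hφ
  obtain ⟨K, hK, H⟩ := EdgeL2.integral_norm_le
  have hM0 : 0 ≤ M := (norm_nonneg _).trans (hM 0 zero_mem_Icc_pi)
  refine ⟨M * K, by positivity, fun r x hx => ?_⟩
  have hi := EdgeL2.intervalIntegrable_mul hφ r
  have hr := r.intervalIntegrable zero_mem_Icc_pi pi_mem_Icc_pi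
  calc ‖∫ t in (0 : ℝ)..x, φ t * r t‖ ≤ ∫ t in (0 : ℝ)..x, ‖φ t * r t‖ :=
        intervalIntegral.norm_integral_le_integral_norm hx.1
    _ ≤ ∫ t in (0 : ℝ)..Real.pi, ‖φ t * r t‖ :=
        intervalIntegral.integral_mono_interval le_rfl hx.1 hx.2
          (Eventually.of_forall fun _ => norm_nonneg _) hi.norm
    _ ≤ ∫ t in (0 : ℝ)..Real.pi, M * ‖r t‖ := by
        refine intervalIntegral.integral_mono_on Real.pi_pos.le hi.norm (hr.norm.const_mul M)
          fun t ht => ?_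
        rw [norm_mul]
        exact mul_le_mul_of_nonneg_right (hM t ht) (norm_nonneg _)
    _ = M * ∫ t in (0 : ℝ)..Real.pi, ‖r t‖ := intervalIntegral.integral_const_mul _ _
    _ ≤ M * K * ‖r‖ := by rw [mul_assoc]; exact mul_le_mul_of_nonneg_left (H r) hM0

theorem EdgeL2.coeFn_smul_add (E : ℂ) (f r : EdgeL2) :
    ((E • f + r : EdgeL2) : ℝ → ℂ) =ᵐ[edgeMeasure] fun x => E * f x + r x := by
  filter_upwards [Lp.coeFn_add (E • f) r, Lp.coeFn_smul E f] with x h1 h2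
  rw [h1, Pi.add_apply, h2, Pi.smul_apply, smul_eq_mul]

/-! ### The operator on a single edge -/

/-- `h = -D² f` on a single edge with `D = d/dx + i a`. -/
structure IsEdgeAction (a : ℝ) (f h : EdgeL2) (u v : ℝ → ℂ) (g : EdgeL2) : Prop where
  sobolev : IsH2 u v g
  repr : (f : ℝ → ℂ) =ᵐ[edgeMeasure] u
  action : (h : ℝ → ℂ) =ᵐ[edgeMeasure] fun x =>
    -(g x + 2 * Complex.I * (a : ℂ) * v x - (a : ℂ) ^ 2 * u x)

theorem IsAction.edge {A : ℝ} {α : ℤ → ℝ} {f h : ChainL2} {u v : Edge → ℝ → ℂ} {g : Edge → EdgeL2}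
    (H : IsAction A α f h u v g) (e : Edge) :
    IsEdgeAction (pot A e) (f e) (h e) (u e) (v e) (g e) :=
  ⟨H.sobolev e, H.repr e, H.action e⟩

theorem IsH2.isPrimitive₂ {u v : ℝ → ℂ} {g : EdgeL2} (h : IsH2 u v g) : IsPrimitive v g :=
  ⟨g.intervalIntegrable zero_mem_Icc_pi pi_mem_Icc_pi, h.deriv₂⟩

theorem IsH2.isPrimitive {u v : ℝ → ℂ} {g : EdgeL2} (h : IsH2 u v g) : IsPrimitive u v :=
  IsPrimitive.of_hasDerivWithinAt h.deriv h.isPrimitive₂.continuousOn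

namespace IsEdgeAction

variable {a : ℝ} {f h g f' h' g' : EdgeL2} {u v u' v' : ℝ → ℂ}

/-- Multiplication by the gauge factor intertwines `D` with `d/dx`. Together with
`isPrimitive_gauge₂` this reduces the edge equation to `-w'' = e^{iax} h` for `w = e^{iax} u`. -/
theorem isPrimitive_gauge (H : IsEdgeAction a f h u v g) :
    IsPrimitive (fun x => phase a x * u x)
      (fun x => phase a x * (v x + Complex.I * a * u x)) := by
  refine ((isPrimitive_phase a).mul H.sobolev.isPrimitive).congr (fun _ _ => rfl)
    (Eventually.of_forall fun x => ?_)
  ring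

theorem isPrimitive_gauge₂ (H : IsEdgeAction a f h u v g) :
    IsPrimitive (fun x => phase a x * (v x + Complex.I * a * u x))
      (fun x => -(phase a x * h x)) := by
  refine ((isPrimitive_phase a).mul (H.sobolev.isPrimitive₂.add
    (H.sobolev.isPrimitive.const_mul (Complex.I * a)))).congr (fun _ _ => rfl) ?_
  filter_upwards [H.action] with x hx
  rw [hx]
  linear_combination (-(phase a x) * a ^ 2 * u x) * Complex.I_sq

/-- Transfer of the value across an edge. -/
theorem transfer (H : IsEdgeAction a f h u v g) {E : ℝ} {r : EdgeL2} (hr : h = (E : ℂ) • f + r) :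
    phase a Real.pi * u Real.pi = cosE E Real.pi * u 0 +
      sinE E Real.pi * (v 0 + Complex.I * a * u 0) -
      ∫ x in (0 : ℝ)..Real.pi, (sinE E (Real.pi - x) * phase a x) * r x := by
  -- The test function `S(π - x)` has value `0` and derivative `-1` at `π`, so only the value of `u`
  -- survives there.
  have h1 := H.isPrimitive_gauge.green_integral H.isPrimitive_gauge₂ (isPrimitive_sinE_pi_sub E)
    ((isPrimitive_cosE_pi_sub E).const_mul (-1) |>.congr (fun x _ => by push_cast; ring)
      (EventuallyEq.refl _ _))
  have h2 : ∫ x in (0 : ℝ)..Real.pi, (sinE E (Real.pi - x) * phase a x) * r x =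
      -∫ x in (0 : ℝ)..Real.pi, (-(phase a x * h x) * (sinE E (Real.pi - x) : ℂ) -
        phase a x * u x * (-1 * ((E * sinE E (Real.pi - x) : ℝ) : ℂ))) := by
    rw [← intervalIntegral.integral_neg]
    refine integral_congr_Ioo ?_ pi_mem_Icc_pi
    subst hr
    filter_upwards [EdgeL2.coeFn_smul_add E f r, H.repr] with x e1 e2
    rw [e1, e2]; push_cast; ring
  rw [h2, h1]
  simp only [sub_self, sub_zero, sinE_zero_right, cosE_zero_right, phase_zero]
  push_cast
  ring

/-- Transfer of the quasiderivative across an edge. -/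
theorem transfer_deriv (H : IsEdgeAction a f h u v g) {E : ℝ} {r : EdgeL2}
    (hr : h = (E : ℂ) • f + r) :
    phase a Real.pi * (v Real.pi + Complex.I * a * u Real.pi) = -E * sinE E Real.pi * u 0 +
      cosE E Real.pi * (v 0 + Complex.I * a * u 0) -
      ∫ x in (0 : ℝ)..Real.pi, (cosE E (Real.pi - x) * phase a x) * r x := by
  -- The test function `C(π - x)` has value `1` and derivative `0` at `π`, so only the
  -- quasiderivative survives there.
  have h1 := H.isPrimitive_gauge.green_integral H.isPrimitive_gauge₂ (isPrimitive_cosE_pi_sub E)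
    ((isPrimitive_sinE_pi_sub E).const_mul E |>.congr (fun x _ => by push_cast; ring)
      (EventuallyEq.refl _ _))
  have h2 : ∫ x in (0 : ℝ)..Real.pi, (cosE E (Real.pi - x) * phase a x) * r x =
      -∫ x in (0 : ℝ)..Real.pi, (-(phase a x * h x) * (cosE E (Real.pi - x) : ℂ) -
        phase a x * u x * (E * ((-cosE E (Real.pi - x) : ℝ) : ℂ))) := by
    rw [← intervalIntegral.integral_neg]
    refine integral_congr_Ioo ?_ pi_mem_Icc_pi
    subst hr
    filter_upwards [EdgeL2.coeFn_smul_add E f r, H.repr] with x e1 e2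
    rw [e1, e2]; push_cast; ring
  rw [h2, h1]
  simp only [sub_self, sub_zero, sinE_zero_right, cosE_zero_right, phase_zero]
  push_cast
  ring

/-- Green's formula in terms of inner products. -/
theorem inner_sub_inner (H : IsEdgeAction a f h u v g) (H' : IsEdgeAction a f' h' u' v' g') :
    inner ℂ h f' - inner ℂ f h' =
      (starRingEnd ℂ (v 0 + Complex.I * a * u 0) * u' 0 -
        starRingEnd ℂ (u 0) * (v' 0 + Complex.I * a * u' 0)) -
      (starRingEnd ℂ (v Real.pi + Complex.I * a * u Real.pi) * u' Real.pi -
        starRingEnd ℂ (u Real.pi) * (v' Real.pi + Complex.I * a * u' Real.pi)) := by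
  have h1 := H.isPrimitive_gauge.conj.green_integral H.isPrimitive_gauge₂.conj
    H'.isPrimitive_gauge H'.isPrimitive_gauge₂
  have hp (x : ℝ) : phase (-a) x * phase a x = 1 := by rw [mul_comm, phase_mul_phase_neg]
  have h2 : (inner ℂ h f' - inner ℂ f h' : ℂ) = -∫ x in (0 : ℝ)..Real.pi,
      (starRingEnd ℂ (-(phase a x * h x)) * (phase a x * u' x) -
        starRingEnd ℂ (phase a x * u x) * -(phase a x * h' x)) := by
    rw [L2.inner_def, L2.inner_def, ← integral_sub (L2.integrable_inner h f')
      (L2.integrable_inner f h'), ← intervalIntegral.integral_neg,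
      intervalIntegral.integral_of_le Real.pi_pos.le, integral_Ioc_eq_integral_Ioo]
    refine integral_congr_ae ?_
    filter_upwards [H.repr, H'.repr] with x e1 e2
    rw [e1, e2]
    simp only [RCLike.inner_apply, map_neg, map_mul, conj_phase]
    linear_combination (starRingEnd ℂ (u x) * h' x - starRingEnd ℂ (h x) * u' x) * hp x
  rw [h2, h1]
  simp only [map_mul, conj_phase, phase_zero, map_one]
  linear_combination (-starRingEnd ℂ (v Real.pi + Complex.I * a * u Real.pi) * u' Real.pi +
        starRingEnd ℂ (u Real.pi) * (v' Real.pi + Complex.I * a * u' Real.pi)) * hp Real.pi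

end IsEdgeAction

end MagneticChain

end

/-! ### Trace estimates and the initial value problem on an edge. -/

section

open MeasureTheory Set Filter Topology

namespace MagneticChain

/-- Boundedness of the traces at the left end of an edge. -/
theorem IsEdgeAction.exists_trace_bound (a : ℝ) : ∃ K : ℝ, 0 ≤ K ∧
    ∀ (f h : EdgeL2) (u v : ℝ → ℂ) (g : EdgeL2), IsEdgeAction a f h u v g →
      ‖u 0‖ ≤ K * (‖f‖ + ‖h‖) ∧ ‖v 0 + Complex.I * a * u 0‖ ≤ K * (‖f‖ + ‖h‖) := by
  -- A test function with vanishing value and derivative at `π` leaves in Green's formula only the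
  -- boundary terms at `0`.
  have key (p p₁ p₂ : ℝ → ℝ) (d : ∀ x, HasDerivAt p (p₁ x) x) (d₁ : ∀ x, HasDerivAt p₁ (p₂ x) x)
      (c₂ : Continuous p₂) (e : p Real.pi = 0) (e₁ : p₁ Real.pi = 0) : ∃ K : ℝ, 0 ≤ K ∧
      ∀ (f h : EdgeL2) (u v : ℝ → ℂ) (g : EdgeL2), IsEdgeAction a f h u v g →
      ‖(v 0 + Complex.I * a * u 0) * p 0 - u 0 * p₁ 0‖ ≤ K * (‖f‖ + ‖h‖) := by
    have c₁ : Continuous p₁ := continuous_iff_continuousAt.2 fun x => (d₁ x).continuousAt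
    have c : Continuous p := continuous_iff_continuousAt.2 fun x => (d x).continuousAt
    have q₀ : Continuous fun x : ℝ => (p x : ℂ) * phase a x :=
      (Complex.continuous_ofReal.comp c).mul (continuous_phase a)
    have q₂ : Continuous fun x : ℝ => (p₂ x : ℂ) * phase a x :=
      (Complex.continuous_ofReal.comp c₂).mul (continuous_phase a)
    obtain ⟨K, hK, HK⟩ := EdgeL2.norm_integral_mul_le q₀.continuousOn
    obtain ⟨K', hK', HK'⟩ := EdgeL2.norm_integral_mul_le q₂.continuousOn
    refine ⟨K + K', by positivity, fun f h u v g H => ?_⟩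
    have h1 := H.isPrimitive_gauge.green_integral H.isPrimitive_gauge₂ (.ofReal d c₁) (.ofReal d₁ c₂)
    have h2 : ∫ x in (0 : ℝ)..Real.pi, (-(phase a x * h x) * (p x : ℂ) -
        phase a x * u x * (p₂ x : ℂ)) = -(∫ x in (0 : ℝ)..Real.pi, ((p x : ℂ) * phase a x) * h x) -
        ∫ x in (0 : ℝ)..Real.pi, ((p₂ x : ℂ) * phase a x) * f x := by
      have hi : IntervalIntegrable (fun x => -(((p x : ℂ) * phase a x) * h x)) volume 0 Real.pi :=
        (EdgeL2.intervalIntegrable_mul q₀.continuousOn h).neg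
      rw [← intervalIntegral.integral_neg, ← intervalIntegral.integral_sub hi
        (EdgeL2.intervalIntegrable_mul q₂.continuousOn f)]
      refine integral_congr_Ioo ?_ pi_mem_Icc_pi
      filter_upwards [H.repr] with x e1
      rw [e1]; ring
    rw [h2] at h1
    simp only [e, e₁, phase_zero, Complex.ofReal_zero, mul_zero, sub_zero, one_mul, zero_sub] at h1
    have h3 : (v 0 + Complex.I * a * u 0) * p 0 - u 0 * p₁ 0 =
        (∫ x in (0 : ℝ)..Real.pi, ((p x : ℂ) * phase a x) * h x) +
        ∫ x in (0 : ℝ)..Real.pi, ((p₂ x : ℂ) * phase a x) * f x := by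
      linear_combination h1
    rw [h3]
    have b1 := HK h _ pi_mem_Icc_pi
    have b2 := HK' f _ pi_mem_Icc_pi
    refine (norm_add_le _ _).trans ?_
    nlinarith [norm_nonneg f, norm_nonneg h]
  have hs (x : ℝ) : HasDerivAt (fun x : ℝ => Real.pi - x) (-1) x := hasDerivAt_pi_sub x
  have hpi := Real.pi_pos
  -- Value `0` and derivative `π²` at `0`: this isolates `u 0`.
  obtain ⟨K₁, hK₁, H₁⟩ := key (fun x => x * (Real.pi - x) ^ 2)
    (fun x => (Real.pi - x) ^ 2 - x * (2 * (Real.pi - x))) (fun x => 6 * x - 4 * Real.pi)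
    (fun x => ((hasDerivAt_id x).mul ((hs x).pow 2)).congr_deriv (by simp; ring))
    (fun x => (((hs x).pow 2).sub ((hasDerivAt_id x).mul ((hs x).const_mul 2))).congr_deriv
      (by simp; ring)) (by fun_prop) (by simp) (by simp)
  -- Value `π²` and derivative `-2π` at `0`: this controls the quasiderivative once `u 0` is
  -- bounded.
  obtain ⟨K₂, hK₂, H₂⟩ := key (fun x => (Real.pi - x) ^ 2)
    (fun x => -(2 * (Real.pi - x))) (fun x => 2)
    (fun x => ((hs x).pow 2).congr_deriv (by simp))
    (fun x => ((hs x).const_mul 2).neg.congr_deriv (by simp)) (by fun_prop) (by simp) (by simp)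
  simp only [sub_zero, zero_mul, Complex.ofReal_zero, mul_zero, zero_sub, norm_neg] at H₁ H₂
  have hp2 : (0 : ℝ) < Real.pi ^ 2 := by positivity
  have b₁ (f h : EdgeL2) (u v : ℝ → ℂ) (g : EdgeL2) (H : IsEdgeAction a f h u v g) :
      ‖u 0‖ ≤ K₁ / Real.pi ^ 2 * (‖f‖ + ‖h‖) := by
    have := H₁ f h u v g H
    rw [norm_mul, Complex.norm_real, Real.norm_of_nonneg hp2.le] at this
    rw [div_mul_eq_mul_div, le_div_iff₀ hp2]
    exact this
  refine ⟨K₁ / Real.pi ^ 2 + (K₂ + 2 * Real.pi * (K₁ / Real.pi ^ 2)) / Real.pi ^ 2, by positivity,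
    fun f h u v g H => ⟨(b₁ f h u v g H).trans ?_, ?_⟩⟩
  · gcongr
    have : 0 ≤ (K₂ + 2 * Real.pi * (K₁ / Real.pi ^ 2)) / Real.pi ^ 2 := by positivity
    linarith
  · have h1 := b₁ f h u v g H
    have h2 := H₂ f h u v g H
    set D := v 0 + Complex.I * a * u 0
    have h3 : ‖D‖ * Real.pi ^ 2 ≤ (K₂ + 2 * Real.pi * (K₁ / Real.pi ^ 2)) * (‖f‖ + ‖h‖) := by
      have e1 : ‖D * ((Real.pi ^ 2 : ℝ) : ℂ)‖ ≤ ‖D * ((Real.pi ^ 2 : ℝ) : ℂ) -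
          u 0 * ((-(2 * Real.pi) : ℝ) : ℂ)‖ + ‖u 0 * ((-(2 * Real.pi) : ℝ) : ℂ)‖ := by
        have := norm_add_le (D * ((Real.pi ^ 2 : ℝ) : ℂ) -
          u 0 * ((-(2 * Real.pi) : ℝ) : ℂ)) (u 0 * ((-(2 * Real.pi) : ℝ) : ℂ))
        rwa [sub_add_cancel] at this
      rw [norm_mul, norm_mul (u 0), Complex.norm_real, Complex.norm_real, norm_neg,
        Real.norm_of_nonneg hp2.le, Real.norm_of_nonneg (by positivity : 0 ≤ 2 * Real.pi)] at e1
      nlinarith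
    have h4 : ‖D‖ ≤ (K₂ + 2 * Real.pi * (K₁ / Real.pi ^ 2)) / Real.pi ^ 2 * (‖f‖ + ‖h‖) := by
      rw [div_mul_eq_mul_div, le_div_iff₀ hp2]
      exact h3
    have : 0 ≤ K₁ / Real.pi ^ 2 * (‖f‖ + ‖h‖) := by positivity
    linarith

/-- The solution of the initial value problem `-D² u = E u + r` on an edge. -/
theorem IsEdgeAction.exists_initial (a E : ℝ) : ∃ K : ℝ, 0 ≤ K ∧ ∀ (y b : ℂ) (r : EdgeL2),
    ∃ (f : EdgeL2) (u v : ℝ → ℂ) (g : EdgeL2), IsEdgeAction a f ((E : ℂ) • f + r) u v g ∧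
      u 0 = y ∧ v 0 + Complex.I * a * u 0 = b ∧ ‖f‖ ≤ K * (‖y‖ + ‖b‖ + ‖r‖) := by
  have cc : Continuous fun x : ℝ => (cosE E x : ℂ) :=
    Complex.continuous_ofReal.comp (continuous_cosE_right E)
  have cs : Continuous fun x : ℝ => (sinE E x : ℂ) :=
    Complex.continuous_ofReal.comp (continuous_sinE_right E)
  have ccp := (cc.mul (continuous_phase a)).continuousOn (s := Icc 0 Real.pi)
  have csp := (cs.mul (continuous_phase a)).continuousOn (s := Icc 0 Real.pi)
  obtain ⟨K₁, hK₁, H₁⟩ := EdgeL2.norm_integral_mul_le ccp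
  obtain ⟨K₂, hK₂, H₂⟩ := EdgeL2.norm_integral_mul_le csp
  obtain ⟨M₁, hM₁⟩ := isCompact_Icc.exists_bound_of_continuousOn cc.continuousOn (s := Icc 0 Real.pi)
  obtain ⟨M₂, hM₂⟩ := isCompact_Icc.exists_bound_of_continuousOn cs.continuousOn (s := Icc 0 Real.pi)
  have hM₁0 : 0 ≤ M₁ := (norm_nonneg _).trans (hM₁ 0 zero_mem_Icc_pi)
  have hM₂0 : 0 ≤ M₂ := (norm_nonneg _).trans (hM₂ 0 zero_mem_Icc_pi)
  obtain ⟨K₀, hK₀, H₀⟩ := EdgeL2.norm_le_of_ae_eq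
  refine ⟨K₀ * (M₁ + M₂ + M₂ * K₁ + M₁ * K₂), by positivity, fun y b r => ?_⟩
  set I₁ : ℝ → ℂ := fun x => ∫ t in (0 : ℝ)..x, (cosE E t * phase a t) * r t with hI₁
  set I₂ : ℝ → ℂ := fun x => ∫ t in (0 : ℝ)..x, (sinE E t * phase a t) * r t with hI₂
  have P₁ : IsPrimitive I₁ _ := IsPrimitive.of_integral (EdgeL2.intervalIntegrable_mul ccp r)
  have P₂ : IsPrimitive I₂ _ := IsPrimitive.of_integral (EdgeL2.intervalIntegrable_mul csp r)
  have Pc := isPrimitive_cosE E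
  have Ps := isPrimitive_sinE E
  -- Variation of constants: the kernel `S(x - t)` is split as `S(x)C(t) - C(x)S(t)`, so that the
  -- integrands do not depend on `x`.
  set w : ℝ → ℂ := fun x => y * cosE E x + b * sinE E x - (sinE E x * I₁ x - cosE E x * I₂ x)
    with hw
  set w₁ : ℝ → ℂ := fun x => -E * y * sinE E x + b * cosE E x -
    (cosE E x * I₁ x + E * (sinE E x * I₂ x)) with hw₁
  have Pw : IsPrimitive w w₁ := by
    refine (((Pc.const_mul y).add (Ps.const_mul b)).sub ((Ps.mul P₁).sub (Pc.mul P₂))).congr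
      (fun _ _ => rfl) (Eventually.of_forall fun x => ?_)
    simp only [hw₁]
    push_cast
    ring
  have Pw₁ : IsPrimitive w₁ (fun x => -E * w x - phase a x * r x) := by
    refine (((Ps.const_mul (-E * y)).add (Pc.const_mul b)).sub ((Pc.mul P₁).add
      ((Ps.mul P₂).const_mul E))).congr (fun _ _ => rfl) (Eventually.of_forall fun x => ?_)
    have h1 : ((cosE E x : ℂ)) ^ 2 + E * (sinE E x : ℂ) ^ 2 = 1 := by
      exact_mod_cast cosE_sq_add E x
    simp only [hw]
    push_cast
    linear_combination (phase a x * r x) * h1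
  have hp (x : ℝ) : phase (-a) x * phase a x = 1 := by rw [mul_comm, phase_mul_phase_neg]
  -- Undo the gauge transformation.
  set u : ℝ → ℂ := fun x => phase (-a) x * w x with hu
  set v : ℝ → ℂ := fun x => phase (-a) x * (w₁ x - Complex.I * a * w x) with hv
  have Pe := isPrimitive_phase (-a)
  have Pu : IsPrimitive u v := by
    refine (Pe.mul Pw).congr (fun _ _ => rfl) (Eventually.of_forall fun x => ?_)
    simp only [hv]
    push_cast
    ring
  have Pv : IsPrimitive v (fun x => phase (-a) x * (-E * w x - 2 * Complex.I * a * w₁ x - a ^ 2 * w x)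
      - r x) := by
    refine (Pe.mul (Pw₁.sub (Pw.const_mul (Complex.I * a)))).congr (fun _ _ => rfl)
      (Eventually.of_forall fun x => ?_)
    simp only
    push_cast
    linear_combination (r x) * hp x + (-a ^ 2 * phase (-a) x * w x) * Complex.I_sq
  have cphase := (continuous_phase (-a)).continuousOn (s := Icc 0 Real.pi)
  obtain ⟨g₀, hg₀⟩ := EdgeL2.exists_ae_eq (φ := fun x => phase (-a) x *
    (-E * w x - 2 * Complex.I * a * w₁ x - a ^ 2 * w x)) (cphase.mul
      (((continuousOn_const.mul Pw.continuousOn).sub (continuousOn_const.mul Pw₁.continuousOn)).sub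
        (continuousOn_const.mul Pw.continuousOn)))
  obtain ⟨f, hf⟩ := EdgeL2.exists_ae_eq Pu.continuousOn
  have hg : ((g₀ - r : EdgeL2) : ℝ → ℂ) =ᵐ[edgeMeasure] fun x => phase (-a) x *
    (-E * w x - 2 * Complex.I * a * w₁ x - a ^ 2 * w x) - r x := by
    filter_upwards [Lp.coeFn_sub g₀ r, hg₀] with x e1 e2
    rw [e1, Pi.sub_apply, e2]
  refine ⟨f, u, v, g₀ - r, ⟨⟨fun x hx => Pu.hasDerivWithinAt Pv.continuousOn hx,
    fun x hx => ?_⟩, hf, ?_⟩, ?_, ?_, ?_⟩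
  · rw [integral_congr_Ioo hg hx]
    exact Pv.eq x hx
  · filter_upwards [EdgeL2.coeFn_smul_add E f r, hf, hg] with x e1 e2 e3
    rw [e1, e2, e3]
    simp only [hu, hv]
    linear_combination (-2 * a ^ 2 * phase (-a) x * w x) * Complex.I_sq
  · simp [hu, hw, hI₂, phase_zero]
  · simp [hu, hv, hw, hw₁, hI₁, hI₂, phase_zero]
  · have hb : ∀ x ∈ Icc (0 : ℝ) Real.pi,
        ‖u x‖ ≤ (M₁ + M₂ + M₂ * K₁ + M₁ * K₂) * (‖y‖ + ‖b‖ + ‖r‖) := fun x hx => by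
      have n1 : ‖I₁ x‖ ≤ K₁ * ‖r‖ := H₁ r x hx
      have n2 : ‖I₂ x‖ ≤ K₂ * ‖r‖ := H₂ r x hx
      have n3 := hM₁ x hx
      have n4 := hM₂ x hx
      calc ‖u x‖ = ‖w x‖ := by simp only [hu, norm_mul, norm_phase, one_mul]
        _ ≤ ‖y * cosE E x‖ + ‖b * sinE E x‖ + (‖sinE E x * I₁ x‖ + ‖cosE E x * I₂ x‖) :=
            (norm_sub_le _ _).trans (add_le_add (norm_add_le _ _) (norm_sub_le _ _))
        _ ≤ ‖y‖ * M₁ + ‖b‖ * M₂ + (M₂ * (K₁ * ‖r‖) + M₁ * (K₂ * ‖r‖)) := by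
            simp only [norm_mul]
            gcongr
        _ ≤ (M₁ + M₂ + M₂ * K₁ + M₁ * K₂) * (‖y‖ + ‖b‖ + ‖r‖) := by
            have p1 : 0 ≤ (M₂ + M₂ * K₁ + M₁ * K₂) * ‖y‖ := by positivity
            have p2 : 0 ≤ (M₁ + M₂ * K₁ + M₁ * K₂) * ‖b‖ := by positivity
            have p3 : 0 ≤ (M₁ + M₂) * ‖r‖ := by positivity
            linarith
    have := H₀ f u _ (by positivity) hf hb
    linarith

end MagneticChain

end

/-! ### From the vertex conditions to a Jacobi equation. -/

section

open MeasureTheory Set Filter Topology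

namespace MagneticChain

/-! ### Square summable families -/

section SquareSummable

variable {ι : Type*} {X : ι → Type*} [∀ i, NormedAddCommGroup (X i)]

theorem memℓp_two_iff {F : ∀ i, X i} : Memℓp F 2 ↔ Summable fun i => ‖F i‖ ^ 2 := by
  rw [memℓp_gen_iff (by norm_num)]
  norm_num

theorem memℓp_two_of_le {F : ∀ i, X i} {G : ι → ℝ} (hG : Memℓp (E := fun _ => ℝ) G 2)
    (h : ∀ i, ‖F i‖ ≤ G i) : Memℓp F 2 := by
  rw [memℓp_two_iff] at hG ⊢
  refine hG.of_nonneg_of_le (fun i => by positivity) fun i => ?_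
  exact pow_le_pow_left₀ (norm_nonneg _) ((h i).trans (le_abs_self _)) 2

theorem memℓp_norm {F : ∀ i, X i} (hF : Memℓp F 2) :
    Memℓp (E := fun _ => ℝ) (fun i => ‖F i‖) 2 := by
  rw [memℓp_two_iff] at hF ⊢
  simpa using hF

theorem memℓp_comp_injective {κ : Type*} {G : ι → ℝ} (hG : Memℓp (E := fun _ => ℝ) G 2)
    {φ : κ → ι} (hφ : Function.Injective φ) : Memℓp (E := fun _ : κ => ℝ) (fun k => G (φ k)) 2 := by
  rw [memℓp_two_iff] at hG ⊢
  exact hG.comp_injective hφ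

theorem memℓp_comp_fst {G : ι → ℝ} (hG : Memℓp (E := fun _ => ℝ) G 2) :
    Memℓp (E := fun _ : ι × Bool => ℝ) (fun e => G e.1) 2 := by
  rw [memℓp_two_iff] at hG ⊢
  refine (summable_prod_of_nonneg fun _ => by positivity).2
    ⟨fun _ => (hasSum_fintype _).summable, ?_⟩
  simp only [tsum_fintype, Fintype.sum_bool]
  exact hG.add hG

theorem memℓp_const_mul {G : ι → ℝ} (hG : Memℓp (E := fun _ => ℝ) G 2) (K : ℝ) :
    Memℓp (E := fun _ => ℝ) (fun i => K * G i) 2 := hG.const_smul K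

theorem memℓp_add {G G' : ι → ℝ} (hG : Memℓp (E := fun _ => ℝ) G 2)
    (hG' : Memℓp (E := fun _ => ℝ) G' 2) : Memℓp (E := fun _ => ℝ) (fun i => G i + G' i) 2 :=
  hG.add hG'

theorem summable_mul_of_memℓp {G G' : ι → ℝ} (hG : Memℓp (E := fun _ => ℝ) G 2)
    (hG' : Memℓp (E := fun _ => ℝ) G' 2) : Summable fun i => G i * G' i := by
  rw [memℓp_two_iff] at hG hG'
  refine Summable.of_norm_bounded (hG.add hG') fun i => ?_
  rw [norm_mul]
  nlinarith [sq_nonneg (‖G i‖ - ‖G' i‖), sq_nonneg (‖G i‖), sq_nonneg (‖G' i‖)]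

end SquareSummable

/-! ### The vertex conditions -/

/-- The value at `π` produced by the source `r` on an edge. -/
noncomputable def sourceValue (E a : ℝ) (r : EdgeL2) : ℂ :=
  ∫ x in (0 : ℝ)..Real.pi, (sinE E (Real.pi - x) * phase a x) * r x

/-- The quasiderivative at `π` produced by the source `r` on an edge. -/
noncomputable def sourceDeriv (E a : ℝ) (r : EdgeL2) : ℂ :=
  ∫ x in (0 : ℝ)..Real.pi, (cosE E (Real.pi - x) * phase a x) * r x

theorem exists_norm_source_le (E a : ℝ) : ∃ K : ℝ, 0 ≤ K ∧ ∀ r : EdgeL2,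
    ‖sourceValue E a r‖ ≤ K * ‖r‖ ∧ ‖sourceDeriv E a r‖ ≤ K * ‖r‖ := by
  have c1 : Continuous fun x : ℝ => (sinE E (Real.pi - x) : ℂ) * phase a x :=
    (Complex.continuous_ofReal.comp ((continuous_sinE_right E).comp (by fun_prop))).mul
      (continuous_phase a)
  have c2 : Continuous fun x : ℝ => (cosE E (Real.pi - x) : ℂ) * phase a x :=
    (Complex.continuous_ofReal.comp ((continuous_cosE_right E).comp (by fun_prop))).mul
      (continuous_phase a)
  obtain ⟨K₁, hK₁, H₁⟩ := EdgeL2.norm_integral_mul_le c1.continuousOn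
  obtain ⟨K₂, hK₂, H₂⟩ := EdgeL2.norm_integral_mul_le c2.continuousOn
  refine ⟨max K₁ K₂, hK₁.trans (le_max_left _ _), fun r => ⟨?_, ?_⟩⟩
  · exact (H₁ r _ pi_mem_Icc_pi).trans (mul_le_mul_of_nonneg_right (le_max_left _ _) (norm_nonneg _))
  · exact (H₂ r _ pi_mem_Icc_pi).trans
      (mul_le_mul_of_nonneg_right (le_max_right _ _) (norm_nonneg _))

/-- A constant that is bounded on the upper and on the lower semicircles is uniformly bounded. -/
theorem exists_uniform_bound {P : ℝ → ℝ → Prop} (hP : ∀ a, ∃ K, 0 ≤ K ∧ P a K)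
    (mono : ∀ a K K', K ≤ K' → P a K → P a K') (A : ℝ) :
    ∃ K, 0 ≤ K ∧ ∀ e : Edge, P (pot A e) K := by
  obtain ⟨K₁, h₁, H₁⟩ := hP A
  obtain ⟨K₂, h₂, H₂⟩ := hP (-A)
  refine ⟨max K₁ K₂, h₁.trans (le_max_left _ _), fun e => ?_⟩
  rcases e with ⟨j, b⟩
  cases b
  · exact mono _ _ _ (le_max_right _ _) H₂
  · exact mono _ _ _ (le_max_left _ _) H₁

/-- The Jacobi operator on vertex values. -/
noncomputable def jacobi (A : ℝ) (β : ℤ → ℝ) (E : ℝ) (y : ℤ → ℂ) (j : ℤ) : ℂ :=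
  2 * (Real.cos (A * Real.pi) : ℂ) * (y (j + 1) + y (j - 1)) -
    (4 * cosE E Real.pi + β j * sinE E Real.pi : ℝ) * y j

/-- The source term of the Jacobi equation. -/
noncomputable def source (A E : ℝ) (r : ChainL2) (j : ℤ) : ℂ :=
  sourceValue E A (r (j, true)) + sourceValue E (-A) (r (j, false)) -
    phase (-A) Real.pi * (cosE E Real.pi * sourceValue E A (r (j - 1, true)) -
      sinE E Real.pi * sourceDeriv E A (r (j - 1, true))) -
    phase A Real.pi * (cosE E Real.pi * sourceValue E (-A) (r (j - 1, false)) -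
      sinE E Real.pi * sourceDeriv E (-A) (r (j - 1, false)))

theorem phase_add_phase_neg (A : ℝ) :
    phase A Real.pi + phase (-A) Real.pi = 2 * (Real.cos (A * Real.pi) : ℂ) := by
  rw [phase, phase, Complex.ofReal_cos, Complex.cos]
  push_cast
  ring_nf

@[simp] theorem pot_true (A : ℝ) (j : ℤ) : pot A (j, true) = A := rfl

@[simp] theorem pot_false (A : ℝ) (j : ℤ) : pot A (j, false) = -A := rfl

namespace IsAction

variable {A : ℝ} {β : ℤ → ℝ} {f h f' h' : ChainL2} {u v u' v' : Edge → ℝ → ℂ} {g g' : Edge → EdgeL2}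

theorem left_value (H : IsAction A β f h u v g) (e : Edge) : u e 0 = u (e.1, true) 0 := by
  rcases e with ⟨j, b⟩
  cases b
  · exact (H.continuity j).1.symm
  · rfl

theorem right_value (H : IsAction A β f h u v g) (e : Edge) :
    u e Real.pi = u (e.1 + 1, true) 0 := by
  rcases e with ⟨j, b⟩
  have := H.continuity (j + 1)
  rw [add_sub_cancel_right] at this
  cases b
  · exact this.2.2.symm
  · exact this.2.1.symm

/-- The vertex values satisfy a Jacobi equation. -/
theorem jacobi_eq (H : IsAction A β f h u v g) {E : ℝ} {r : ChainL2} (hr : h = (E : ℂ) • f + r)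
    (j : ℤ) : jacobi A β E (fun j => u (j, true) 0) j = -source A E r j := by
  have hr' (e : Edge) : h e = (E : ℂ) • f e + r e := by rw [hr]; rfl
  have a1 := (H.edge (j, true)).transfer (hr' _)
  have a2 := (H.edge (j, false)).transfer (hr' _)
  have b1 := (H.edge (j - 1, true)).transfer (hr' _)
  have b2 := (H.edge (j - 1, false)).transfer (hr' _)
  have c1 := (H.edge (j - 1, true)).transfer_deriv (hr' _)
  have c2 := (H.edge (j - 1, false)).transfer_deriv (hr' _)
  have hc := H.coupling j
  simp only [quasiDeriv] at hc
  rw [H.right_value] at a1 a2 b1 b2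
  rw [H.left_value (_, false)] at a2 b2 c2
  rw [H.left_value (_, false)] at hc
  simp only [sub_add_cancel, pot_true, pot_false] at a1 a2 b1 b2 c1 c2 hc
  have hp := phase_add_phase_neg A
  have hq := phase_mul_phase_neg A Real.pi
  have hcs : ((cosE E Real.pi : ℂ)) ^ 2 + E * (sinE E Real.pi : ℂ) ^ 2 = 1 := by
    exact_mod_cast cosE_sq_add E Real.pi
  have hjac : jacobi A β E (fun j => u (j, true) 0) j =
      (phase A Real.pi + phase (-A) Real.pi) * (u (j + 1, true) 0 + u (j - 1, true) 0) -
        (4 * cosE E Real.pi + β j * sinE E Real.pi) * u (j, true) 0 := by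
    rw [hp, jacobi]; push_cast; ring
  rw [hjac]
  simp only [source, sourceValue, sourceDeriv]
  set S : ℂ := (sinE E Real.pi : ℂ)
  set C : ℂ := (cosE E Real.pi : ℂ)
  set p := phase A Real.pi
  set q := phase (-A) Real.pi
  set y₀ := u (j - 1, true) 0
  set y₁ := u (j, true) 0
  set D₁ := v (j - 1, true) Real.pi + Complex.I * A * u (j - 1, true) Real.pi
  set D₂ := v (j - 1, false) Real.pi + Complex.I * (-A : ℝ) * u (j - 1, false) Real.pi
  -- The coupling condition times `S` is evaluated with the transfer across ring `j` for the
  -- quasiderivatives on its right, and with the inverse transfer across ring `j - 1` for those on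
  -- its left. The transfer matrix has determinant `1` by `hcs`, and `hq` cancels opposite phases.
  linear_combination a1 + a2 + S * hc - q * C * b1 - p * C * b2 + q * S * c1 + p * S * c2 +
    (-(p + q) * y₀) * hcs + (2 * C * y₁ - S * (D₁ + D₂)) * hq

end IsAction

end MagneticChain

end

/-! ### Symmetry of the Hamiltonian and assembly of edge solutions. -/

section

open MeasureTheory Set Filter Topology

namespace MagneticChain

theorem exists_trace_bound_edge (A : ℝ) : ∃ K : ℝ, 0 ≤ K ∧ ∀ (e : Edge),
    ∀ (f h : EdgeL2) (u v : ℝ → ℂ) (g : EdgeL2), IsEdgeAction (pot A e) f h u v g →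
      ‖u 0‖ ≤ K * (‖f‖ + ‖h‖) ∧ ‖v 0 + Complex.I * pot A e * u 0‖ ≤ K * (‖f‖ + ‖h‖) :=
  exists_uniform_bound (P := fun a K => ∀ (f h : EdgeL2) (u v : ℝ → ℂ) (g : EdgeL2),
    IsEdgeAction a f h u v g →
      ‖u 0‖ ≤ K * (‖f‖ + ‖h‖) ∧ ‖v 0 + Complex.I * a * u 0‖ ≤ K * (‖f‖ + ‖h‖))
    IsEdgeAction.exists_trace_bound
    (fun a K K' hK H f h u v g hE => ⟨(H f h u v g hE).1.trans (by gcongr),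
      (H f h u v g hE).2.trans (by gcongr)⟩) A

theorem memℓp_norm_add_norm (f h : ChainL2) :
    Memℓp (E := fun _ => ℝ) (fun e => ‖f e‖ + ‖h e‖) 2 :=
  memℓp_add (memℓp_norm (lp.memℓp f)) (memℓp_norm (lp.memℓp h))

/-- Summation over edges, ring by ring. -/
theorem tsum_edge {F : Edge → ℂ} (hF : Summable F) :
    ∑' e, F e = ∑' j : ℤ, (F (j, true) + F (j, false)) := by
  rw [hF.tsum_prod]
  simp only [tsum_fintype, Fintype.sum_bool]

namespace IsAction

variable {A : ℝ} {β : ℤ → ℝ} {f h f' h' : ChainL2} {u v u' v' : Edge → ℝ → ℂ} {g g' : Edge → EdgeL2}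

theorem memℓp_vertex (H : IsAction A β f h u v g) :
    Memℓp (E := fun _ : ℤ => ℂ) (fun j => u (j, true) 0) 2 := by
  obtain ⟨K, hK, HK⟩ := exists_trace_bound_edge A
  refine memℓp_two_of_le (memℓp_const_mul (memℓp_comp_injective (memℓp_norm_add_norm f h)
    (φ := fun j : ℤ => ((j, true) : Edge)) (fun i j hij => by simpa using hij)) K) fun j => ?_
  exact (HK _ _ _ _ _ _ (H.edge (j, true))).1

/-- The Hamiltonian is symmetric. -/
theorem inner_comm (H : IsAction A β f h u v g) (H' : IsAction A β f' h' u' v' g') :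
    inner ℂ h f' = inner ℂ f h' := by
  obtain ⟨K, hK, HK⟩ := exists_trace_bound_edge A
  set D : Edge → ℝ → ℂ := fun e x => quasiDeriv A e (u e) (v e) x with hD
  set D' : Edge → ℝ → ℂ := fun e x => quasiDeriv A e (u' e) (v' e) x with hD'
  set τ : Edge → ℂ := fun e => starRingEnd ℂ (D e 0) * u' e 0 - starRingEnd ℂ (u e 0) * D' e 0
    with hτ
  set σ : Edge → ℂ := fun e => starRingEnd ℂ (D e Real.pi) * u' e Real.pi -
    starRingEnd ℂ (u e Real.pi) * D' e Real.pi with hσ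
  have hin := lp.hasSum_inner (𝕜 := ℂ) h f' |>.sub (lp.hasSum_inner (𝕜 := ℂ) f h')
  have hgreen (e : Edge) : inner ℂ (h e) (f' e) - inner ℂ (f e) (h' e) = τ e - σ e :=
    (H.edge e).inner_sub_inner (H'.edge e)
  simp only [hgreen] at hin
  have sτ : Summable τ := by
    have := (summable_mul_of_memℓp (memℓp_norm_add_norm f h)
      (memℓp_norm_add_norm f' h')).mul_left (2 * K ^ 2)
    refine Summable.of_norm_bounded this fun e => ?_
    obtain ⟨b1, b2⟩ := HK _ _ _ _ _ _ (H.edge e)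
    obtain ⟨b3, b4⟩ := HK _ _ _ _ _ _ (H'.edge e)
    refine (norm_sub_le _ _).trans ?_
    rw [norm_mul, norm_mul, RCLike.norm_conj, RCLike.norm_conj]
    have m1 := mul_le_mul b2 b3 (norm_nonneg _) (by positivity)
    have m2 := mul_le_mul b1 b4 (norm_nonneg _) (by positivity)
    refine (add_le_add m1 m2).trans (le_of_eq ?_)
    ring
  -- Traces were estimated only at the left ends; the terms at `π` are summable because `τ - σ` is,
  -- being a difference of inner products.
  have sσ : Summable σ := by
    have := sτ.sub hin.summable
    simpa using this
  -- All four boundary terms at a vertex share one value of `u` and one of `u'`. What is left is the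
  -- coupling, which cancels because `β` is real.
  have key (j : ℤ) : σ (j, true) + σ (j, false) = τ (j + 1, true) + τ (j + 1, false) := by
    have c := H.coupling (j + 1)
    have c' := H'.coupling (j + 1)
    rw [add_sub_cancel_right] at c c'
    simp only [hτ, hσ, hD, hD']
    rw [H.right_value, H.right_value, H'.right_value, H'.right_value, H.left_value (_, false),
      H'.left_value (_, false)]
    simp only
    have cc := congrArg (starRingEnd ℂ) c
    simp only [map_add, map_sub, map_mul, Complex.conj_ofReal] at cc
    linear_combination starRingEnd ℂ (u (j + 1, true) 0) * c' - u' (j + 1, true) 0 * cc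
  have hsum : ∑' e, σ e = ∑' e, τ e := by
    rw [tsum_edge sσ, tsum_edge sτ]
    simp only [key]
    exact (Equiv.addRight (1 : ℤ)).tsum_eq (fun j => τ (j, true) + τ (j, false))
  have h0 : (inner ℂ h f' - inner ℂ f h' : ℂ) = 0 := by
    rw [← hin.tsum_eq, sτ.tsum_sub sσ, hsum, sub_self]
  exact sub_eq_zero.1 h0

end IsAction

/-- Assembling edge solutions with matching boundary data. -/
theorem exists_isAction (A : ℝ) (β : ℤ → ℝ) (E : ℝ) (y : ℤ → ℂ) (b : Edge → ℂ) (r : ChainL2)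
    (hy : Memℓp (E := fun _ : ℤ => ℂ) y 2) (hb : Memℓp (E := fun _ : Edge => ℂ) b 2)
    (hcont : ∀ e : Edge, phase (pot A e) Real.pi * y (e.1 + 1) =
      cosE E Real.pi * y e.1 + sinE E Real.pi * b e - sourceValue E (pot A e) (r e))
    (hcoup : ∀ j : ℤ, b (j + 1, true) + b (j + 1, false) -
      phase (-A) Real.pi * (-E * sinE E Real.pi * y j + cosE E Real.pi * b (j, true) -
        sourceDeriv E A (r (j, true))) -
      phase A Real.pi * (-E * sinE E Real.pi * y j + cosE E Real.pi * b (j, false) -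
        sourceDeriv E (-A) (r (j, false))) = β (j + 1) * y (j + 1)) :
    ∃ f u v g, IsAction A β f ((E : ℂ) • f + r) u v g ∧ (∀ e, u e 0 = y e.1) ∧
      ∀ e, quasiDeriv A e (u e) (v e) 0 = b e := by
  obtain ⟨K, hK, HK⟩ := exists_uniform_bound (P := fun a K => ∀ (y b : ℂ) (r : EdgeL2),
    ∃ (f : EdgeL2) (u v : ℝ → ℂ) (g : EdgeL2), IsEdgeAction a f ((E : ℂ) • f + r) u v g ∧
      u 0 = y ∧ v 0 + Complex.I * a * u 0 = b ∧ ‖f‖ ≤ K * (‖y‖ + ‖b‖ + ‖r‖))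
    (fun a => IsEdgeAction.exists_initial a E)
    (fun a K K' hK H y b r => by
      obtain ⟨f, u, v, g, h1, h2, h3, h4⟩ := H y b r
      exact ⟨f, u, v, g, h1, h2, h3, h4.trans (by gcongr)⟩) A
  choose F u v g hE hu hv hF using fun e : Edge => HK e (y e.1) (b e) (r e)
  have hmem : Memℓp F 2 := memℓp_two_of_le (memℓp_const_mul (memℓp_add (memℓp_add
    (memℓp_comp_fst (memℓp_norm hy)) (memℓp_norm hb)) (memℓp_norm (lp.memℓp r))) K) hF
  set f : ChainL2 := ⟨F, hmem⟩ with hf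
  have hq (e : Edge) : phase (-pot A e) Real.pi * phase (pot A e) Real.pi = 1 := by
    rw [mul_comm, phase_mul_phase_neg]
  have hright (e : Edge) : u e Real.pi = y (e.1 + 1) := by
    have h1 := (hE e).transfer rfl
    rw [hv, hu, ← sourceValue, ← hcont e] at h1
    linear_combination phase (-pot A e) Real.pi * h1 - (u e Real.pi - y (e.1 + 1)) * hq e
  refine ⟨f, u, v, g, ⟨fun e => (hE e).sobolev, fun e => (hE e).repr, fun e => (hE e).action,
    fun j => ⟨?_, ?_, ?_⟩, fun j => ?_⟩, hu, hv⟩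
  · rw [hu, hu]
  · rw [hu, hright]; simp
  · rw [hu, hright]; simp
  · have h1 := (hE (j - 1, true)).transfer_deriv rfl
    have h2 := (hE (j - 1, false)).transfer_deriv rfl
    have h3 := hcoup (j - 1)
    rw [hv, hu, ← sourceDeriv] at h1 h2
    have q1 := hq (j - 1, true)
    have q2 := hq (j - 1, false)
    have v1 := hv (j, true)
    have v2 := hv (j, false)
    simp only [pot_true, pot_false, sub_add_cancel, neg_neg] at h1 h2 h3 q1 q2 v1 v2
    simp only [quasiDeriv, pot_true, pot_false]
    rw [v1, v2, hu]
    set D₁ := v (j - 1, true) Real.pi + Complex.I * A * u (j - 1, true) Real.pi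
    set D₂ := v (j - 1, false) Real.pi + Complex.I * (-A : ℝ) * u (j - 1, false) Real.pi
    linear_combination h3 + D₁ * q1 + D₂ * q2 - phase (-A) Real.pi * h1 - phase A Real.pi * h2

/-- The data of an edge function are determined by the function. -/
theorem IsEdgeAction.eqOn {a : ℝ} {f h g h' g' : EdgeL2} {u v u' v' : ℝ → ℂ}
    (H : IsEdgeAction a f h u v g) (H' : IsEdgeAction a f h' u' v' g') :
    EqOn u u' (Icc 0 Real.pi) := by
  have hae : u =ᵐ[edgeMeasure] u' := by
    filter_upwards [H.repr, H'.repr] with x h1 h2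
    rw [← h1, h2]
  have hae' : u =ᵐ[volume.restrict (Icc (0 : ℝ) Real.pi)] u' := by
    rw [← restrict_Ioo_eq_restrict_Icc]
    exact hae
  exact Measure.eqOn_Icc_of_ae_eq volume Real.pi_pos.ne hae' H.sobolev.isPrimitive.continuousOn
    H'.sobolev.isPrimitive.continuousOn

end MagneticChain

end

/-! ### Symmetric unbounded operators: resolvents, distance to the spectrum, counting of
eigenvalues. -/

section

open Set

namespace UnboundedOperator

section Banach

variable {H : Type*} [NormedAddCommGroup H] [NormedSpace ℂ H]

theorem mem_eigenspace_iff {T : H →ₗ.[ℂ] H} {z : ℂ} {f : H} :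
    f ∈ eigenspace T z ↔ ∃ u : T.domain, (u : H) = f ∧ T u = z • f := by
  simp only [eigenspace, Submodule.mem_map, LinearMap.mem_ker]
  constructor
  · rintro ⟨u, hu, rfl⟩
    exact ⟨u, rfl, sub_eq_zero.1 hu⟩
  · rintro ⟨u, rfl, hu⟩
    exact ⟨u, sub_eq_zero.2 hu, rfl⟩

theorem mem_eigenspace_iff_graph {T : H →ₗ.[ℂ] H} {z : ℂ} {f : H} :
    f ∈ eigenspace T z ↔ (f, z • f) ∈ T.graph := by
  rw [mem_eigenspace_iff, LinearPMap.mem_graph_iff]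

theorem eigenspace_eq_bot_of_mem_resolventSet {T : H →ₗ.[ℂ] H} {z : ℂ} (hz : z ∈ resolventSet T) :
    eigenspace T z = ⊥ := by
  obtain ⟨R, -, h2⟩ := hz
  refine (Submodule.eq_bot_iff _).2 fun f hf => ?_
  obtain ⟨u, rfl, hu⟩ := mem_eigenspace_iff.1 hf
  have := h2 u
  rwa [hu, sub_self, map_zero, eq_comm] at this

/-- Spectral mapping for resolvents: from the resolvent at `z₀` to the one at `z`. -/
theorem mem_resolventSet_of_isUnit {T : H →ₗ.[ℂ] H} {z₀ z : ℂ} {R : H →L[ℂ] H}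
    (h1 : ∀ f : H, ∃ h : R f ∈ T.domain, T ⟨R f, h⟩ - z₀ • R f = f)
    (h2 : ∀ u : T.domain, R (T u - z₀ • (u : H)) = u)
    (hu : IsUnit (1 - (z - z₀) • R)) : z ∈ resolventSet T := by
  obtain ⟨W, hW⟩ := hu
  have hW1 (f : H) : (W⁻¹ : (H →L[ℂ] H)ˣ).val f -
      (z - z₀) • R ((W⁻¹ : (H →L[ℂ] H)ˣ).val f) = f := by
    have := congrArg (fun L : H →L[ℂ] H => L f) W.mul_inv
    rw [hW] at this
    simpa using this
  have hW2 (f : H) : (W⁻¹ : (H →L[ℂ] H)ˣ).val (f - (z - z₀) • R f) = f := by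
    have := congrArg (fun L : H →L[ℂ] H => L f) W.inv_mul
    rw [hW] at this
    simpa using this
  -- As `T - z = (1 - (z - z₀)R)(T - z₀)` on the domain, the resolvent at `z` is `R(1 - (z -
  -- z₀)R)⁻¹`.
  refine ⟨R * (W⁻¹ : (H →L[ℂ] H)ˣ).val, fun f => ?_, fun u => ?_⟩
  · obtain ⟨h, e⟩ := h1 ((W⁻¹ : (H →L[ℂ] H)ˣ).val f)
    refine ⟨h, ?_⟩
    have e' := hW1 f
    simp only [mul_apply_eq_comp]
    linear_combination (norm := module) e + e'
  · simp only [mul_apply_eq_comp]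
    have e : T u - z • (u : H) = (T u - z₀ • (u : H)) - (z - z₀) • R (T u - z₀ • (u : H)) := by
      rw [h2, sub_smul]; abel
    rw [e, hW2, h2]

/-- By the resolvent identity, `1 + (z - z₀)Q` is the inverse, where `Q` is the resolvent at `z`. -/
theorem isUnit_of_mem_resolventSet {T : H →ₗ.[ℂ] H} {z₀ z : ℂ} {R : H →L[ℂ] H}
    (h1 : ∀ f : H, ∃ h : R f ∈ T.domain, T ⟨R f, h⟩ - z₀ • R f = f)
    (h2 : ∀ u : T.domain, R (T u - z₀ • (u : H)) = u)
    (hz : z ∈ resolventSet T) : IsUnit (1 - (z - z₀) • R) := by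
  obtain ⟨Q, q1, q2⟩ := hz
  have e1 (f : H) : Q f - (z - z₀) • R (Q f) = R f := by
    obtain ⟨h, e⟩ := q1 f
    have := h2 ⟨Q f, h⟩
    have e' : T ⟨Q f, h⟩ - z₀ • Q f = f + (z - z₀) • Q f := by
      linear_combination (norm := module) e
    rw [e', map_add, map_smul] at this
    exact (eq_sub_of_add_eq this).symm
  have e2 (f : H) : R f + (z - z₀) • Q (R f) = Q f := by
    obtain ⟨h, e⟩ := h1 f
    have := q2 ⟨R f, h⟩
    have e' : T ⟨R f, h⟩ - z • R f = f - (z - z₀) • R f := by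
      linear_combination (norm := module) e
    rw [e', map_sub, map_smul] at this
    exact (sub_eq_iff_eq_add.1 this).symm
  refine ⟨⟨1 - (z - z₀) • R, 1 + (z - z₀) • Q, ?_, ?_⟩, rfl⟩
  · ext f
    simp only [mul_apply_eq_comp, sub_apply,
      add_apply, one_apply_eq_self, smul_apply,
      map_add, map_smul]
    rw [← e1 f, smul_sub]
    abel
  · ext f
    simp only [mul_apply_eq_comp, sub_apply,
      add_apply, one_apply_eq_self, smul_apply,
      map_sub, map_smul]
    rw [← e2 f, smul_add]
    abel

end Banach

section Hilbert

variable {H : Type*} [NormedAddCommGroup H] [InnerProductSpace ℂ H]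

/-- Symmetry of an unbounded operator. -/
def IsSymmetric (T : H →ₗ.[ℂ] H) : Prop :=
  ∀ u v : T.domain, inner ℂ (T u) (v : H) = inner ℂ (u : H) (T v)

variable {T : H →ₗ.[ℂ] H}

theorem IsSymmetric.inner_eigenvectors (hT : IsSymmetric T) {E E' : ℝ} (hE : E ≠ E') {f f' : H}
    (hf : f ∈ eigenspace T (E : ℂ)) (hf' : f' ∈ eigenspace T (E' : ℂ)) : inner ℂ f f' = 0 := by
  obtain ⟨u, rfl, hu⟩ := mem_eigenspace_iff.1 hf
  obtain ⟨u', rfl, hu'⟩ := mem_eigenspace_iff.1 hf'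
  have h := hT u u'
  rw [hu, hu', inner_smul_left, inner_smul_right, Complex.conj_ofReal] at h
  have h1 : ((E : ℂ) - E') * inner ℂ (u : H) (u' : H) = 0 := by linear_combination h
  refine (mul_eq_zero.1 h1).resolve_left (sub_ne_zero.2 ?_)
  exact_mod_cast hE

/-- An injective and surjective `T - E` has a bounded inverse (Hellinger–Toeplitz). -/
theorem IsSymmetric.mem_resolventSet [CompleteSpace H] (hT : IsSymmetric T) {E : ℝ}
    (inj : ∀ u : T.domain, T u = (E : ℂ) • (u : H) → u = 0)
    (surj : ∀ f : H, ∃ u : T.domain, T u - (E : ℂ) • (u : H) = f) :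
    (E : ℂ) ∈ resolventSet T := by
  set L : T.domain →ₗ[ℂ] H := T.toFun - (E : ℂ) • T.domain.subtype with hL
  have hbij : Function.Bijective L := by
    refine ⟨?_, surj⟩
    rw [← LinearMap.ker_eq_bot, Submodule.eq_bot_iff]
    exact fun u hu => inj u (sub_eq_zero.1 hu)
  set e := LinearEquiv.ofBijective L hbij with he
  set R₀ : H →ₗ[ℂ] H := T.domain.subtype ∘ₗ e.symm.toLinearMap with hR₀
  have hTe (f : H) : T (e.symm f) - (E : ℂ) • (e.symm f : H) = f := e.apply_symm_apply f
  have hsym : R₀.IsSymmetric := fun f g => by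
    change inner ℂ (e.symm f : H) g = inner ℂ f (e.symm g : H)
    conv_lhs => rw [← hTe g]
    conv_rhs => rw [← hTe f]
    rw [inner_sub_left, inner_sub_right, hT, inner_smul_left, inner_smul_right, Complex.conj_ofReal]
  refine ⟨⟨R₀, hsym.continuous⟩, fun f => ⟨(e.symm f).2, hTe f⟩, fun u => ?_⟩
  exact congrArg Subtype.val (e.symm_apply_apply u)

theorem IsSymmetric.isSelfAdjoint_resolvent [CompleteSpace H] (hT : IsSymmetric T) {E : ℝ}
    {R : H →L[ℂ] H} (h1 : ∀ f : H, ∃ h : R f ∈ T.domain, T ⟨R f, h⟩ - (E : ℂ) • R f = f) :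
    IsSelfAdjoint R := by
  rw [ContinuousLinearMap.isSelfAdjoint_iff_isSymmetric]
  intro f g
  obtain ⟨hf, ef⟩ := h1 f
  obtain ⟨hg, eg⟩ := h1 g
  change inner ℂ (R f) g = inner ℂ f (R g)
  conv_lhs => rw [← eg]
  conv_rhs => rw [← ef]
  rw [inner_sub_left, inner_sub_right, hT ⟨R f, hf⟩ ⟨R g, hg⟩, inner_smul_left, inner_smul_right,
    Complex.conj_ofReal]

theorem isUnit_one_sub_smul_iff {R : H →L[ℂ] H} {w : ℂ} (hw : w ≠ 0) :
    IsUnit (1 - w • R) ↔ w⁻¹ ∉ _root_.spectrum ℂ R := by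
  have e : 1 - w • R = Units.mk0 w hw • (algebraMap ℂ (H →L[ℂ] H) w⁻¹ - R) := by
    rw [Units.smul_mk0, smul_sub, Algebra.algebraMap_eq_smul_one, smul_smul, mul_inv_cancel₀ hw,
      one_smul]
  rw [spectrum.notMem_iff, e, isUnit_smul_iff]

/-- With one real point in the resolvent set, all non-real points are there, too. -/
theorem IsSymmetric.mem_resolventSet_of_im_ne_zero [CompleteSpace H] (hT : IsSymmetric T) {E : ℝ}
    (hE : (E : ℂ) ∈ resolventSet T) {z : ℂ} (hz : z.im ≠ 0) : z ∈ resolventSet T := by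
  obtain ⟨R, h1, h2⟩ := hE
  have hR := hT.isSelfAdjoint_resolvent h1
  refine mem_resolventSet_of_isUnit h1 h2 ?_
  have hw : z - E ≠ 0 := fun h => hz (by simpa using congrArg Complex.im h)
  rw [isUnit_one_sub_smul_iff hw]
  intro hmem
  have him := congrArg Complex.im (hR.mem_spectrum_eq_re hmem)
  rw [Complex.ofReal_im, Complex.inv_im, div_eq_zero_iff] at him
  rcases him with h | h
  · apply hz; simpa using h
  · exact hw (Complex.normSq_eq_zero.1 h)

/-- The distance of a real point to the spectrum bounds `T - E` from below. -/
theorem IsSymmetric.le_norm_sub [CompleteSpace H] (hT : IsSymmetric T) {E r : ℝ} (hr : 0 < r)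
    (hI : ∀ x ∈ Ioo (E - r) (E + r), (x : ℂ) ∈ resolventSet T) (u : T.domain) :
    r * ‖(u : H)‖ ≤ ‖T u - (E : ℂ) • (u : H)‖ := by
  obtain ⟨R, h1, h2⟩ := hI E ⟨by linarith, by linarith⟩
  have hR := hT.isSelfAdjoint_resolvent h1
  -- A nonzero spectral value `k` of the resolvent at `E` is real and belongs to the spectral point
  -- `E + 1/k` of `T`, which is at distance at least `r` from `E`.
  have hspec : ∀ k ∈ _root_.spectrum ℂ R, ‖k‖ ≤ r⁻¹ := by
    intro k hk
    by_contra! hlt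
    have hk0 : k ≠ 0 := by
      rintro rfl
      rw [norm_zero] at hlt
      exact lt_asymm hlt (inv_pos.2 hr)
    have hre : k = ((k.re : ℝ) : ℂ) := hR.mem_spectrum_eq_re hk
    have habs : |k.re⁻¹| < r := by
      rw [hre, Complex.norm_real, Real.norm_eq_abs] at hlt
      rw [abs_inv]
      exact inv_lt_of_inv_lt₀ hr hlt
    have hx := hI (E + k.re⁻¹) ⟨by linarith [(abs_lt.1 habs).1], by linarith [(abs_lt.1 habs).2]⟩
    have hunit := isUnit_of_mem_resolventSet h1 h2 hx
    have e : ((E + k.re⁻¹ : ℝ) : ℂ) - E = k⁻¹ := by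
      rw [hre]; push_cast; simp
    rw [e, isUnit_one_sub_smul_iff (inv_ne_zero hk0), inv_inv] at hunit
    exact hunit hk
  -- The norm of a self-adjoint operator is its spectral radius.
  have hnorm : ‖R‖ ≤ r⁻¹ := by
    have h := hR.spectralRadius_eq_nnnorm
    have h' : spectralRadius ℂ R ≤ (Real.toNNReal r⁻¹ : ENNReal) :=
      iSup₂_le fun k hk => ENNReal.coe_le_coe.2 (NNReal.le_toNNReal_of_coe_le (hspec k hk))
    rw [h] at h'
    have h'' := NNReal.coe_le_coe.2 (ENNReal.coe_le_coe.1 h')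
    rwa [Real.coe_toNNReal _ (inv_pos.2 hr).le] at h''
  have h3 := R.le_opNorm (T u - (E : ℂ) • (u : H))
  rw [h2] at h3
  have h4 := h3.trans (mul_le_mul_of_nonneg_right hnorm (norm_nonneg _))
  rwa [inv_mul_eq_div, le_div_iff₀ hr, mul_comm] at h4

theorem norm_sum_sq_of_orthogonal {ι : Type*} (s : Finset ι) (x : ι → H)
    (h : ∀ i ∈ s, ∀ j ∈ s, i ≠ j → inner ℂ (x i) (x j) = 0) :
    ‖∑ i ∈ s, x i‖ ^ 2 = ∑ i ∈ s, ‖x i‖ ^ 2 := by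
  classical
  induction s using Finset.induction_on with
  | empty => simp
  | insert a s ha ih =>
    rw [Finset.sum_insert ha, Finset.sum_insert ha, ← ih fun i hi j hj =>
      h i (Finset.mem_insert_of_mem hi) j (Finset.mem_insert_of_mem hj)]
    have h0 : inner ℂ (x a) (∑ i ∈ s, x i) = 0 := by
      rw [inner_sum]
      refine Finset.sum_eq_zero fun i hi => h a (Finset.mem_insert_self _ _) i
        (Finset.mem_insert_of_mem hi) fun hai => ha (hai ▸ hi)
    have := norm_add_sq_eq_norm_sq_add_norm_sq_of_inner_eq_zero (x a) (∑ i ∈ s, x i) h0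
    rw [pow_two, pow_two, pow_two]
    exact this

theorem eigenfunctionsIn_le_domain (T : H →ₗ.[ℂ] H) (I : Set ℝ) :
    eigenfunctionsIn T I ≤ T.domain := by
  refine iSup₂_le fun E _ f hf => ?_
  obtain ⟨u, rfl, -⟩ := mem_eigenspace_iff.1 hf
  exact u.2

/-- On eigenfunctions with eigenvalues in an interval `I` of regular points of `T₀`, the operator
`T` cannot agree with `T₀`. -/
theorem IsSymmetric.eq_zero_of_agree [CompleteSpace H] {T₀ : H →ₗ.[ℂ] H} (hT : IsSymmetric T)
    (hT₀ : IsSymmetric T₀) {I : Set ℝ} (hI : IsOpen I) (hIc : I.OrdConnected)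
    (hres : ∀ x ∈ I, (x : ℂ) ∈ resolventSet T₀) {u : T.domain} (hu : (u : H) ∈ eigenfunctionsIn T I)
    (h₀ : ∃ u₀ : T₀.domain, (u₀ : H) = u ∧ T₀ u₀ = T u) : u = 0 := by
  classical
  rw [eigenfunctionsIn, iSup_subtype'] at hu
  obtain ⟨g, hg, hsum⟩ := (Submodule.mem_iSup_iff_exists_finsupp _ _).1 hu
  by_contra hne
  have hs : g.support.Nonempty := by
    rw [Finset.nonempty_iff_ne_empty]
    intro h
    apply hne
    rw [Finsupp.support_eq_empty] at h
    subst h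
    exact Subtype.ext (by simpa using hsum.symm)
  -- Only finitely many eigenvalues enter `u`. They lie in a compact `[a, b] ⊆ I`, also for
  -- unbounded `I`, with a margin `ε` inside `I`.
  obtain ⟨a, ha, hmin⟩ := Finset.exists_min_image g.support (fun x : I => (x : ℝ)) hs
  obtain ⟨b, hb, hmax⟩ := Finset.exists_max_image g.support (fun x : I => (x : ℝ)) hs
  have hab : (a : ℝ) ≤ b := hmin b hb
  obtain ⟨ε₁, hε₁, H₁⟩ := Metric.isOpen_iff.1 hI a a.2
  obtain ⟨ε₂, hε₂, H₂⟩ := Metric.isOpen_iff.1 hI b b.2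
  set ε := min ε₁ ε₂ with hε
  have hεp : 0 < ε := lt_min hε₁ hε₂
  have hsub : Ioo ((a : ℝ) - ε) (b + ε) ⊆ I := fun x hx => by
    rcases lt_or_ge x a with h | h
    · refine H₁ ?_
      rw [Metric.mem_ball, Real.dist_eq, abs_lt]
      constructor <;> linarith [hx.1, min_le_left ε₁ ε₂]
    · rcases le_or_gt x b with h' | h'
      · exact hIc.out a.2 b.2 ⟨h, h'⟩
      · refine H₂ ?_
        rw [Metric.mem_ball, Real.dist_eq, abs_lt]
        constructor <;> linarith [hx.2, min_le_right ε₁ ε₂]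
  set m : ℝ := (a + b) / 2 with hm
  set ρ : ℝ := (b - a) / 2 with hρ
  have hρ0 : 0 ≤ ρ := by rw [hρ]; linarith
  obtain ⟨u₀, hu₀, hTu₀⟩ := h₀
  -- At the midpoint `m` of `[a, b]`, `T₀ - m` is bounded below by `ρ + ε`, whereas orthogonality of
  -- the eigenvectors bounds `T - m` on `u` by `ρ`.
  have hlow := hT₀.le_norm_sub (E := m) (r := ρ + ε) (by linarith)
    (fun x hx => hres x (hsub ⟨by linarith [hx.1], by linarith [hx.2]⟩)) u₀
  rw [hu₀, hTu₀] at hlow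
  have horth : ∀ i ∈ g.support, ∀ j ∈ g.support, i ≠ j → inner ℂ (g i) (g j) = 0 :=
    fun i _ j _ hij => hT.inner_eigenvectors (fun h => hij (Subtype.ext h)) (hg i) (hg j)
  choose w hw hTw using fun i => mem_eigenspace_iff.1 (hg i)
  have huw : u = ∑ i ∈ g.support, w i := by
    apply Subtype.ext
    rw [← hsum, Finsupp.sum, Submodule.coe_sum]
    exact Finset.sum_congr rfl fun i _ => (hw i).symm
  have hTu : T u - (m : ℂ) • (u : H) = ∑ i ∈ g.support, (((i : ℝ) - m : ℝ) : ℂ) • g i := by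
    rw [huw, ← LinearPMap.toFun_eq_coe, map_sum, Submodule.coe_sum, Finset.smul_sum,
      ← Finset.sum_sub_distrib]
    refine Finset.sum_congr rfl fun i _ => ?_
    rw [LinearPMap.toFun_eq_coe, hTw, hw, Complex.ofReal_sub, sub_smul]
  have hN1 : ‖(u : H)‖ ^ 2 = ∑ i ∈ g.support, ‖g i‖ ^ 2 := by
    rw [← hsum, Finsupp.sum]
    exact norm_sum_sq_of_orthogonal _ _ horth
  have hN2 : ‖T u - (m : ℂ) • (u : H)‖ ^ 2 ≤ ρ ^ 2 * ‖(u : H)‖ ^ 2 := by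
    rw [hTu, norm_sum_sq_of_orthogonal, hN1, Finset.mul_sum]
    · refine Finset.sum_le_sum fun i hi => ?_
      rw [norm_smul, mul_pow, Complex.norm_real, Real.norm_eq_abs, sq_abs]
      refine mul_le_mul_of_nonneg_right ?_ (by positivity)
      have h1 := hmin i hi
      have h2 := hmax i hi
      exact sq_le_sq' (by linarith) (by linarith)
    · intro i hi j hj hij
      rw [inner_smul_left, inner_smul_right, horth i hi j hj hij, mul_zero, mul_zero]
  have hup : 0 < ‖(u : H)‖ := norm_pos_iff.2 fun h => hne (Subtype.ext h)
  have h5 : ((ρ + ε) * ‖(u : H)‖) ^ 2 ≤ ρ ^ 2 * ‖(u : H)‖ ^ 2 :=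
    (pow_le_pow_left₀ (by positivity) hlow 2).trans hN2
  rw [mul_pow] at h5
  have h6 := le_of_mul_le_mul_right h5 (by positivity)
  nlinarith

/-- A perturbation that is invisible on the kernel of two functionals produces at most two
eigenvalues in an interval of regular points. -/
theorem IsSymmetric.rank_eigenfunctionsIn_le [CompleteSpace H] {T₀ : H →ₗ.[ℂ] H}
    (hT : IsSymmetric T) (hT₀ : IsSymmetric T₀) {I : Set ℝ} (hI : IsOpen I) (hIc : I.OrdConnected)
    (hres : ∀ x ∈ I, (x : ℂ) ∈ resolventSet T₀) (ℓ : T.domain →ₗ[ℂ] (Fin 2 → ℂ))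
    (hℓ : ∀ u : T.domain, ℓ u = 0 → ∃ u₀ : T₀.domain, (u₀ : H) = u ∧ T₀ u₀ = T u) :
    Module.rank ℂ (eigenfunctionsIn T I) ≤ 2 := by
  set Φ := ℓ ∘ₗ Submodule.inclusion (eigenfunctionsIn_le_domain T I) with hΦ
  have hinj : Function.Injective Φ := by
    rw [← LinearMap.ker_eq_bot, Submodule.eq_bot_iff]
    intro f hf
    have := hT.eq_zero_of_agree hT₀ hI hIc hres
      (u := Submodule.inclusion (eigenfunctionsIn_le_domain T I) f) f.2 (hℓ _ hf)
    exact Subtype.ext (congrArg (fun x : T.domain => (x : H)) this)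
  have := LinearMap.lift_rank_le_of_injective Φ hinj
  simpa using this

/-- Eigenvectors for distinct eigenvalues are orthogonal, hence independent. -/
theorem IsSymmetric.encard_eigenvaluesIn_le (hT : IsSymmetric T) {I : Set ℝ} {n : ℕ}
    (h : Module.rank ℂ (eigenfunctionsIn T I) ≤ n) : (eigenvaluesIn T I).encard ≤ n := by
  have hex (E : eigenvaluesIn T I) : ∃ f ∈ eigenspace T ((E : ℝ) : ℂ), f ≠ 0 :=
    Submodule.exists_mem_ne_zero_of_ne_bot E.2.2
  choose v hv hv0 using hex
  have hli : LinearIndependent ℂ v := linearIndependent_of_ne_zero_of_inner_eq_zero hv0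
    fun i j hij => hT.inner_eigenvectors (fun h => hij (Subtype.ext h)) (hv i) (hv j)
  have hmem (E : eigenvaluesIn T I) : v E ∈ eigenfunctionsIn T I :=
    (le_iSup₂ (f := fun (E : ℝ) (_ : E ∈ I) => eigenspace T (E : ℂ)) (E : ℝ) E.2.1) (hv E)
  have hli' : LinearIndependent ℂ (fun E => (⟨v E, hmem E⟩ : eigenfunctionsIn T I)) :=
    LinearIndependent.of_comp (eigenfunctionsIn T I).subtype hli
  have hc := hli'.cardinal_lift_le_rank
  have hc2 : Cardinal.mk (eigenvaluesIn T I) ≤ n := by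
    have := hc.trans (Cardinal.lift_le.2 h)
    simpa using this
  rw [← Set.toENat_cardinalMk]
  simpa using Cardinal.toENat.monotone' hc2

end Hilbert

end UnboundedOperator

end

section

open MeasureTheory Set Filter Topology UnboundedOperator

namespace MagneticChain

/-! ### The Hamiltonian in terms of the Jacobi equation -/

theorem mem_graph_iff {A : ℝ} {β : ℤ → ℝ} {f h : ChainL2} :
    (f, h) ∈ (hamiltonian A β).graph ↔ ∃ u v g, IsAction A β f h u v g := by
  rw [hamiltonian_graph]; rfl

theorem exists_isAction_domain {A : ℝ} {β : ℤ → ℝ} (f : (hamiltonian A β).domain) :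
    ∃ u v g, IsAction A β (f : ChainL2) (hamiltonian A β f) u v g :=
  mem_graph_iff.1 ((hamiltonian A β).mem_graph f)

theorem IsAction.exists_domain {A : ℝ} {β : ℤ → ℝ} {f h : ChainL2} {u v : Edge → ℝ → ℂ}
    {g : Edge → EdgeL2} (H : IsAction A β f h u v g) :
    ∃ f' : (hamiltonian A β).domain, (f' : ChainL2) = f ∧ hamiltonian A β f' = h :=
  (LinearPMap.mem_graph_iff _).1 (mem_graph_iff.2 ⟨u, v, g, H⟩)

theorem mem_eigenspace_hamiltonian_iff {A : ℝ} {β : ℤ → ℝ} {z : ℂ} {f : ChainL2} :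
    f ∈ eigenspace (hamiltonian A β) z ↔ ∃ u v g, IsAction A β f (z • f) u v g := by
  rw [mem_eigenspace_iff_graph, mem_graph_iff]

theorem isSymmetric_hamiltonian (A : ℝ) (β : ℤ → ℝ) : IsSymmetric (hamiltonian A β) := by
  intro f f'
  obtain ⟨u, v, g, H⟩ := exists_isAction_domain f
  obtain ⟨u', v', g', H'⟩ := exists_isAction_domain f'
  exact H.inner_comm H'

/-- Uniqueness for the initial value problem on an edge. -/
theorem IsEdgeAction.eq_zero {a E : ℝ} {f g : EdgeL2} {u v : ℝ → ℂ}
    (H : IsEdgeAction a f ((E : ℂ) • f) u v g) (h0 : u 0 = 0)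
    (h1 : v 0 + Complex.I * a * u 0 = 0) : f = 0 := by
  have hh : (((E : ℂ) • f : EdgeL2) : ℝ → ℂ) =ᵐ[edgeMeasure] fun x => E * u x := by
    filter_upwards [Lp.coeFn_smul (E : ℂ) f, H.repr] with x e1 e2
    rw [e1, Pi.smul_apply, e2, smul_eq_mul]
  have Pc₁ : IsPrimitive (fun x => ((-E * sinE E x : ℝ) : ℂ)) fun x => -E * (cosE E x : ℂ) :=
    ((isPrimitive_sinE E).const_mul (-E)).congr (fun x _ => by push_cast; ring)
      (EventuallyEq.refl _ _)
  -- The Wronskians of `e^{iax} u` with `S` and with `C` are constant and vanish at `0`; since `C² +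
  -- E S² = 1`, they determine `u`.
  have G₁ := H.isPrimitive_gauge.green H.isPrimitive_gauge₂ (isPrimitive_sinE E)
    (isPrimitive_cosE E)
  have G₂ := H.isPrimitive_gauge.green H.isPrimitive_gauge₂ (isPrimitive_cosE E) Pc₁
  have hu : ∀ x ∈ Icc (0 : ℝ) Real.pi, u x = 0 := fun x hx => by
    have e1 := G₁.eq x hx
    have e2 := G₂.eq x hx
    rw [integral_congr_Ioo (l := fun _ => 0) (by
      filter_upwards [hh] with y hy
      rw [hy]; push_cast; ring) hx] at e1 e2
    simp only [h1, intervalIntegral.integral_zero] at e1 e2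
    simp only [h0] at e1 e2
    have h1 : ((cosE E x : ℂ)) ^ 2 + E * (sinE E x : ℂ) ^ 2 = 1 := by
      exact_mod_cast cosE_sq_add E x
    have h2 := phase_mul_phase_neg a x
    push_cast at e1 e2
    linear_combination phase (-a) x * (sinE E x * e2 - cosE E x * e1) - u x * h2 -
      phase (-a) x * phase a x * u x * h1
  refine Lp.ext ?_
  filter_upwards [H.repr, ae_restrict_mem measurableSet_Ioo,
    Lp.coeFn_zero ℂ 2 edgeMeasure] with x e1 hx e2
  rw [e1, hu x (Ioo_subset_Icc_self hx)]
  exact e2.symm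

/-- If `S(π) ≠ 0`, then `E` is not a Dirichlet eigenvalue of an edge, so an eigenfunction is
determined by its vertex values. -/
theorem IsAction.eq_zero {A E : ℝ} {β : ℤ → ℝ} {f : ChainL2} {u v : Edge → ℝ → ℂ}
    {g : Edge → EdgeL2} (H : IsAction A β f ((E : ℂ) • f) u v g) (hS : sinE E Real.pi ≠ 0)
    (h0 : ∀ j, u (j, true) 0 = 0) : f = 0 := by
  refine lp.ext (funext fun e => ?_)
  have hl : u e 0 = 0 := by rw [H.left_value, h0]
  have hr : u e Real.pi = 0 := by rw [H.right_value, h0]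
  have he := H.edge e
  have h1 := he.transfer (E := E) (r := 0) (by rw [add_zero]; rfl)
  rw [integral_congr_Ioo (l := fun _ => 0) (by
    filter_upwards [Lp.coeFn_zero ℂ 2 edgeMeasure] with x hx
    rw [show ((0 : EdgeL2) : ℝ → ℂ) x = 0 from hx, mul_zero]) pi_mem_Icc_pi, hl, hr] at h1
  simp only [mul_zero, intervalIntegral.integral_zero, sub_zero, zero_add, add_zero] at h1
  have hS' : (sinE E Real.pi : ℂ) ≠ 0 := by exact_mod_cast hS
  refine he.eq_zero hl ?_
  rw [hl, mul_zero, add_zero]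
  exact (mul_eq_zero.1 h1.symm).resolve_left hS'

theorem IsAction.vertex_eq_zero {A : ℝ} {β : ℤ → ℝ} {h : ChainL2} {u v : Edge → ℝ → ℂ}
    {g : Edge → EdgeL2} (H : IsAction A β 0 h u v g) (e : Edge) : u e 0 = 0 := by
  have hE := H.edge e
  have h0 : IsEdgeAction (pot A e) 0 (h e) (u e) (v e) (g e) := hE
  have hc := h0.sobolev.isPrimitive.continuousOn
  have hae : u e =ᵐ[volume.restrict (Icc (0 : ℝ) Real.pi)] fun _ => (0 : ℂ) := by
    rw [← restrict_Ioo_eq_restrict_Icc]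
    filter_upwards [h0.repr, Lp.coeFn_zero ℂ 2 edgeMeasure] with x h1 h2
    rw [← h1]
    exact h2
  exact Measure.eqOn_Icc_of_ae_eq volume Real.pi_pos.ne hae hc continuousOn_const zero_mem_Icc_pi

theorem sourceValue_zero (E a : ℝ) : sourceValue E a 0 = 0 := by
  obtain ⟨K, -, HK⟩ := exists_norm_source_le E a
  simpa using (HK 0).1

theorem sourceDeriv_zero (E a : ℝ) : sourceDeriv E a 0 = 0 := by
  obtain ⟨K, -, HK⟩ := exists_norm_source_le E a
  simpa using (HK 0).2

theorem source_zero (A E : ℝ) (j : ℤ) : source A E 0 j = 0 := by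
  have hz (e : Edge) : (0 : ChainL2) e = 0 := rfl
  simp only [source, hz, sourceValue_zero, sourceDeriv_zero, mul_zero, sub_zero, add_zero]

theorem memℓp_source_value (A E : ℝ) (r : ChainL2) :
    Memℓp (E := fun _ : Edge => ℂ) (fun e => sourceValue E (pot A e) (r e)) 2 ∧
    Memℓp (E := fun _ : Edge => ℂ) (fun e => sourceDeriv E (pot A e) (r e)) 2 := by
  obtain ⟨K, hK, HK⟩ := exists_uniform_bound (P := fun a K => ∀ r : EdgeL2,
    ‖sourceValue E a r‖ ≤ K * ‖r‖ ∧ ‖sourceDeriv E a r‖ ≤ K * ‖r‖) (exists_norm_source_le E)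
    (fun a K K' hK H r => ⟨(H r).1.trans (by gcongr), (H r).2.trans (by gcongr)⟩) A
  have := memℓp_const_mul (memℓp_norm (lp.memℓp r)) K
  exact ⟨memℓp_two_of_le this fun e => (HK e _).1, memℓp_two_of_le this fun e => (HK e _).2⟩

theorem memℓp_comp {ι κ : Type*} {G : ι → ℂ} (hG : Memℓp (E := fun _ => ℂ) G 2) {φ : κ → ι}
    (hφ : Function.Injective φ) : Memℓp (E := fun _ : κ => ℂ) (fun k => G (φ k)) 2 := by
  rw [memℓp_two_iff] at hG ⊢
  exact hG.comp_injective hφ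

theorem memℓp_source (A E : ℝ) (r : ChainL2) :
    Memℓp (E := fun _ : ℤ => ℂ) (source A E r) 2 := by
  obtain ⟨h1, h2⟩ := memℓp_source_value A E r
  have i1 (b : Bool) : Function.Injective fun j : ℤ => ((j, b) : Edge) := fun i j h => by
    simpa using h
  have i2 (b : Bool) : Function.Injective fun j : ℤ => ((j - 1, b) : Edge) := fun i j h => by
    simpa using h
  have a1 := memℓp_comp h1 (i1 true)
  have a2 := memℓp_comp h1 (i1 false)
  have a3 := memℓp_comp h1 (i2 true)
  have a4 := memℓp_comp h1 (i2 false)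
  have b3 := memℓp_comp h2 (i2 true)
  have b4 := memℓp_comp h2 (i2 false)
  exact ((a1.add a2).sub (((a3.const_smul (cosE E Real.pi : ℂ)).sub
    (b3.const_smul (sinE E Real.pi : ℂ))).const_smul (phase (-A) Real.pi))).sub
    (((a4.const_smul (cosE E Real.pi : ℂ)).sub
    (b4.const_smul (sinE E Real.pi : ℂ))).const_smul (phase A Real.pi))

/-- Solutions of the Jacobi equation give solutions of `(H - E) f = r`. -/
theorem exists_isAction_of_jacobi {A E : ℝ} {β : ℤ → ℝ} (hS : sinE E Real.pi ≠ 0) {y : ℤ → ℂ}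
    (hy : Memℓp (E := fun _ : ℤ => ℂ) y 2) (r : ChainL2)
    (hJ : ∀ j, jacobi A β E y j = -source A E r j) :
    ∃ f u v g, IsAction A β f ((E : ℂ) • f + r) u v g ∧ ∀ e, u e 0 = y e.1 := by
  have hS' : (sinE E Real.pi : ℂ) ≠ 0 := by exact_mod_cast hS
  -- The initial quasiderivative for which the edge solution reaches the prescribed value at the
  -- next vertex.
  set b : Edge → ℂ := fun e => (sinE E Real.pi : ℂ)⁻¹ * (phase (pot A e) Real.pi * y (e.1 + 1) -
    cosE E Real.pi * y e.1 + sourceValue E (pot A e) (r e)) with hb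
  have hSb (e : Edge) : sinE E Real.pi * b e = phase (pot A e) Real.pi * y (e.1 + 1) -
    cosE E Real.pi * y e.1 + sourceValue E (pot A e) (r e) := mul_inv_cancel_left₀ hS' _
  have hbm : Memℓp (E := fun _ : Edge => ℂ) b 2 := by
    refine memℓp_two_of_le (memℓp_const_mul (memℓp_add (memℓp_add (memℓp_norm (memℓp_comp hy
      (add_left_injective (1 : ℤ))) |> memℓp_comp_fst) (memℓp_const_mul (memℓp_comp_fst
      (memℓp_norm hy)) ‖(cosE E Real.pi : ℂ)‖)) (memℓp_norm (memℓp_source_value A E r).1))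
      ‖(sinE E Real.pi : ℂ)⁻¹‖) fun e => ?_
    rw [hb, norm_mul]
    refine mul_le_mul_of_nonneg_left ?_ (norm_nonneg _)
    refine (norm_add_le _ _).trans (add_le_add ((norm_sub_le _ _).trans (le_of_eq ?_)) le_rfl)
    rw [norm_mul, norm_mul, norm_phase, one_mul]
  obtain ⟨f, u, v, g, H, hu, -⟩ := exists_isAction A β E y b r hy hbm
    (fun e => by rw [hSb]; ring) (fun j => by
      have hj := hJ (j + 1)
      have e1 := hSb (j, true)
      have e2 := hSb (j, false)
      have e3 := hSb (j + 1, true)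
      have e4 := hSb (j + 1, false)
      have hjac : jacobi A β E y (j + 1) =
          (phase A Real.pi + phase (-A) Real.pi) * (y (j + 1 + 1) + y j) -
          (4 * cosE E Real.pi + β (j + 1) * sinE E Real.pi) * y (j + 1) := by
        rw [phase_add_phase_neg, jacobi, add_sub_cancel_right]; push_cast; ring
      rw [hjac, source] at hj
      simp only [add_sub_cancel_right, pot_true, pot_false] at hj e1 e2 e3 e4
      have hq := phase_mul_phase_neg A Real.pi
      have hcs : ((cosE E Real.pi : ℂ)) ^ 2 + E * (sinE E Real.pi : ℂ) ^ 2 = 1 := by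
        exact_mod_cast cosE_sq_add E Real.pi
      apply mul_left_cancel₀ hS'
      linear_combination hj + e3 + e4 - phase (-A) Real.pi * cosE E Real.pi * e1 -
        phase A Real.pi * cosE E Real.pi * e2 +
        (phase A Real.pi + phase (-A) Real.pi) * y j * hcs - 2 * cosE E Real.pi * y (j + 1) * hq)
  exact ⟨f, u, v, g, H, hu⟩

/-- If the Jacobi operator is bijective on `ℓ²`, then `E` is a regular point. -/
theorem mem_resolventSet_of_jacobi {A E : ℝ} {β : ℤ → ℝ} (hS : sinE E Real.pi ≠ 0)
    (inj : ∀ y : ℤ → ℂ, Memℓp (E := fun _ : ℤ => ℂ) y 2 → (∀ j, jacobi A β E y j = 0) → y = 0)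
    (surj : ∀ d : ℤ → ℂ, Memℓp (E := fun _ : ℤ => ℂ) d 2 →
      ∃ y : ℤ → ℂ, Memℓp (E := fun _ : ℤ => ℂ) y 2 ∧ ∀ j, jacobi A β E y j = d j) :
    (E : ℂ) ∈ resolventSet (hamiltonian A β) := by
  refine (isSymmetric_hamiltonian A β).mem_resolventSet (fun f hf => ?_) fun r => ?_
  · obtain ⟨u, v, g, H⟩ := exists_isAction_domain f
    rw [hf] at H
    have hy := inj _ H.memℓp_vertex fun j => by
      rw [H.jacobi_eq (r := 0) (by rw [add_zero]), source_zero, neg_zero]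
    exact Subtype.ext (H.eq_zero hS fun j => congrFun hy j)
  · obtain ⟨y, hy, hJ⟩ := surj _ (memℓp_source A E r).neg
    obtain ⟨f, u, v, g, H, -⟩ := exists_isAction_of_jacobi hS hy r hJ
    obtain ⟨f', e1, e2⟩ := H.exists_domain
    exact ⟨f', by rw [e1, e2, add_sub_cancel_left]⟩

end MagneticChain

end

section

open MeasureTheory Set Filter Topology UnboundedOperator

namespace MagneticChain

/-! ### The Jacobi operator on `ℓ²(ℤ)` -/

/-- Half the trace of the transfer matrix of a ring with vertex coupling `α`, up to the
factor `cos (A π)`. -/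
noncomputable def xi (α E : ℝ) : ℝ := cosE E Real.pi + α / 4 * sinE E Real.pi

/-- The space of vertex values. -/
abbrev VertexL2 : Type := lp (fun _ : ℤ => ℂ) 2

/-- Translation of sequences. -/
noncomputable def shift (k : ℤ) : VertexL2 →L[ℂ] VertexL2 :=
  LinearMap.mkContinuous
    { toFun := fun y => ⟨fun j => y (j + k), memℓp_comp (lp.memℓp y) (add_left_injective k)⟩
      map_add' := fun _ _ => rfl
      map_smul' := fun _ _ => rfl } 1 fun y => by
    rw [one_mul, lp.norm_eq_tsum_rpow (by norm_num), lp.norm_eq_tsum_rpow (by norm_num)]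
    exact le_of_eq (congrArg (· ^ (1 / (2 : ENNReal).toReal))
      ((Equiv.addRight k).tsum_eq (fun j => ‖y j‖ ^ (2 : ENNReal).toReal)))

theorem norm_shift_le (k : ℤ) : ‖shift k‖ ≤ 1 := LinearMap.mkContinuous_norm_le _ zero_le_one _

/-- The operator is `-4ξ(1 - K)`, where `K` is `c/(2ξ)` times the sum of the two unit shifts. Its
norm is at most `|c|/|ξ| < 1`, so the Neumann series converges. -/
theorem exists_inverse_jacobi {A α E : ℝ} (h : |Real.cos (A * Real.pi)| < |xi α E|) :
    ∃ G : VertexL2 →L[ℂ] VertexL2, (∀ d j, jacobi A (fun _ => α) E (G d) j = d j) ∧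
      ∀ y : VertexL2, (∀ j, jacobi A (fun _ => α) E y j = 0) → y = 0 := by
  set c := Real.cos (A * Real.pi) with hc
  set ξ := xi α E with hξ
  have hξ0 : 0 < |ξ| := (abs_nonneg _).trans_lt h
  have hξ1 : (ξ : ℂ) ≠ 0 := by
    have := abs_pos.1 hξ0
    exact_mod_cast this
  set k : ℂ := ((c / (2 * ξ) : ℝ) : ℂ) with hk
  set K : VertexL2 →L[ℂ] VertexL2 := k • (shift 1 + shift (-1)) with hK
  have hKn : ‖K‖ < 1 := by
    have h2 : ‖shift 1 + shift (-1)‖ ≤ 2 :=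
      (norm_add_le _ _).trans (by linarith [norm_shift_le 1, norm_shift_le (-1)])
    have hkn : ‖k‖ = |c| / (2 * |ξ|) := by
      rw [hk, Complex.norm_real, Real.norm_eq_abs, abs_div, abs_mul, abs_two]
    calc ‖K‖ ≤ ‖k‖ * ‖shift 1 + shift (-1)‖ := ContinuousLinearMap.opNorm_smul_le _ _
      _ ≤ |c| / (2 * |ξ|) * 2 := by rw [hkn]; gcongr
      _ = |c| / |ξ| := by field_simp
      _ < 1 := (div_lt_one hξ0).2 h
  obtain ⟨W, hW⟩ := isUnit_one_sub_of_norm_lt_one hKn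
  have hJ (y : VertexL2) (j : ℤ) : jacobi A (fun _ => α) E y j = -4 * ξ * (W.val y) j := by
    have e : (W.val y) j = y j - k * (y (j + 1) + y (j + -1)) := by rw [hW]; rfl
    rw [e, jacobi, hk, ← sub_eq_add_neg, ← hc]
    have e4 : (4 * cosE E Real.pi + α * sinE E Real.pi : ℝ) = 4 * ξ := by rw [hξ, xi]; ring
    rw [e4]
    push_cast
    field_simp
    ring
  refine ⟨(-4 * ξ : ℂ)⁻¹ • (W⁻¹).val, fun d j => ?_, fun y hy => ?_⟩
  · rw [hJ]
    have e1 : W.val (((-4 * ξ : ℂ)⁻¹ • (W⁻¹).val) d) = (-4 * ξ : ℂ)⁻¹ • d := by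
      have := congrArg (fun L : VertexL2 →L[ℂ] VertexL2 => L d) W.mul_inv
      change W.val ((-4 * ξ : ℂ)⁻¹ • (W⁻¹).val d) = _
      rw [map_smul]
      exact congrArg _ this
    rw [e1]
    change -4 * (ξ : ℂ) * ((-4 * ξ : ℂ)⁻¹ * d j) = d j
    exact mul_inv_cancel_left₀ (by simpa using hξ1) _
  · have h0 : W.val y = 0 := lp.ext (funext fun j => by
      have := hJ y j
      rw [hy j] at this
      exact (mul_eq_zero.1 this.symm).resolve_left (by simpa using hξ1))
    have := congrArg (fun L : VertexL2 →L[ℂ] VertexL2 => L y) W.inv_mul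
    change (W⁻¹).val (W.val y) = y at this
    rw [← this, h0, map_zero]

theorem twoImpurities_zero (α : ℝ) : twoImpurities α 0 0 = fun _ => α := by
  funext j
  simp [twoImpurities]

theorem twoImpurities_of_ne {α γ₁ γ₂ : ℝ} {j : ℤ} (h1 : j ≠ 1) (h2 : j ≠ 2) :
    twoImpurities α γ₁ γ₂ j = α := by
  simp [twoImpurities, h1, h2]

theorem jacobi_twoImpurities (A α γ₁ γ₂ E : ℝ) (y : ℤ → ℂ) (j : ℤ) :
    jacobi A (twoImpurities α γ₁ γ₂) E y j = jacobi A (fun _ => α) E y j -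
      ((twoImpurities α γ₁ γ₂ j - α) * sinE E Real.pi : ℝ) * y j := by
  rw [jacobi, jacobi]
  push_cast
  ring

/-- A finite rank perturbation of an invertible operator is invertible if it is injective. -/
theorem mem_resolventSet_twoImpurities {A α γ₁ γ₂ E : ℝ} (hS : sinE E Real.pi ≠ 0)
    (h : |Real.cos (A * Real.pi)| < |xi α E|)
    (inj : ∀ y : ℤ → ℂ, Memℓp (E := fun _ : ℤ => ℂ) y 2 →
      (∀ j, jacobi A (twoImpurities α γ₁ γ₂) E y j = 0) → y = 0) :
    (E : ℂ) ∈ resolventSet (hamiltonian A (twoImpurities α γ₁ γ₂)) := by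
  obtain ⟨G, hG, -⟩ := exists_inverse_jacobi h
  refine mem_resolventSet_of_jacobi hS inj fun d hd => ?_
  set S := sinE E Real.pi
  let ev (k : ℤ) : VertexL2 →ₗ[ℂ] ℂ :=
    { toFun := fun y => y k, map_add' := fun _ _ => rfl, map_smul' := fun _ _ => rfl }
  -- The perturbation factors as `Q ∘ P` through `ℂ²`.
  let P : VertexL2 →ₗ[ℂ] (Fin 2 → ℂ) := LinearMap.pi ![ev 1, ev 2]
  let Q : (Fin 2 → ℂ) →ₗ[ℂ] VertexL2 :=
    ((γ₁ * S : ℝ) : ℂ) • (lp.lsingle 2 1 ∘ₗ LinearMap.proj 0) +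
      ((γ₂ * S : ℝ) : ℂ) • (lp.lsingle 2 2 ∘ₗ LinearMap.proj 1)
  have hP (y : VertexL2) : P y = ![y 1, y 2] := by
    funext i
    fin_cases i <;> rfl
  have hQ (y : VertexL2) (j : ℤ) :
      Q (P y) j = ((twoImpurities α γ₁ γ₂ j - α) * S : ℝ) * y j := by
    have e : Q (P y) j = ((γ₁ * S : ℝ) : ℂ) * (lp.single 2 1 (y 1) : VertexL2) j +
      ((γ₂ * S : ℝ) : ℂ) * (lp.single 2 2 (y 2) : VertexL2) j := rfl
    rw [e, lp.single_apply, lp.single_apply]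
    by_cases h1 : j = 1
    · subst h1; simp [twoImpurities]
    by_cases h2 : j = 2
    · subst h2; simp [twoImpurities]
    rw [Pi.single_eq_of_ne h1, Pi.single_eq_of_ne h2, twoImpurities_of_ne h1 h2]
    simp
  -- A solution must have the form `y = G(d + Qt)` with `t = Py`, that is, `Mt = P(Gd)`. This is an
  -- equation in `ℂ²`, where injectivity gives surjectivity.
  set M : (Fin 2 → ℂ) →ₗ[ℂ] (Fin 2 → ℂ) := LinearMap.id - P ∘ₗ G.toLinearMap ∘ₗ Q with hM
  have hMinj : Function.Injective M := by
    rw [← LinearMap.ker_eq_bot, Submodule.eq_bot_iff]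
    intro t ht
    have ht' : t = P (G (Q t)) := sub_eq_zero.1 ht
    have hy := inj (G (Q t)) (lp.memℓp _) fun j => by
      rw [jacobi_twoImpurities, hG, ← hQ, ← ht', sub_self]
    rw [ht', hP, congrFun hy 1, congrFun hy 2]
    funext i
    fin_cases i <;> rfl
  obtain ⟨t, ht⟩ := LinearMap.injective_iff_surjective.1 hMinj (P (G ⟨d, hd⟩))
  have ht' : P (G (⟨d, hd⟩ + Q t)) = t := by
    rw [map_add, map_add, ← ht]
    exact sub_add_cancel t (P (G (Q t)))
  refine ⟨G (⟨d, hd⟩ + Q t), lp.memℓp _, fun j => ?_⟩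
  rw [jacobi_twoImpurities, hG, ← hQ, ht']
  exact add_sub_cancel_right (d j) (Q t j)

theorem jacobi_injective_of_eigenspace {A E : ℝ} {β : ℤ → ℝ} (hS : sinE E Real.pi ≠ 0)
    (h : eigenspace (hamiltonian A β) (E : ℂ) = ⊥) (y : ℤ → ℂ)
    (hy : Memℓp (E := fun _ : ℤ => ℂ) y 2) (hJ : ∀ j, jacobi A β E y j = 0) : y = 0 := by
  obtain ⟨f, u, v, g, H, hu⟩ := exists_isAction_of_jacobi hS hy 0 fun j => by
    rw [hJ, source_zero, neg_zero]
  rw [add_zero] at H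
  have hf : f ∈ eigenspace (hamiltonian A β) (E : ℂ) :=
    mem_eigenspace_hamiltonian_iff.2 ⟨u, v, g, H⟩
  rw [h, Submodule.mem_bot] at hf
  subst hf
  funext j
  rw [← hu (j, true)]
  exact H.vertex_eq_zero _

/-- Outside the essential spectrum, a point is regular unless it is an eigenvalue. -/
theorem mem_resolventSet_of_eigenspace {A α γ₁ γ₂ E : ℝ} (hS : sinE E Real.pi ≠ 0)
    (h : |Real.cos (A * Real.pi)| < |xi α E|)
    (he : eigenspace (hamiltonian A (twoImpurities α γ₁ γ₂)) (E : ℂ) = ⊥) :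
    (E : ℂ) ∈ resolventSet (hamiltonian A (twoImpurities α γ₁ γ₂)) :=
  mem_resolventSet_twoImpurities hS h (jacobi_injective_of_eigenspace hS he)

theorem mem_resolventSet_const {A α E : ℝ} (hS : sinE E Real.pi ≠ 0)
    (h : |Real.cos (A * Real.pi)| < |xi α E|) :
    (E : ℂ) ∈ resolventSet (hamiltonian A fun _ => α) := by
  rw [← twoImpurities_zero]
  refine mem_resolventSet_twoImpurities hS h fun y hy hJ => ?_
  rw [twoImpurities_zero] at hJ
  obtain ⟨G, -, hG⟩ := exists_inverse_jacobi h
  have := hG ⟨y, hy⟩ hJ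
  exact congrArg (fun x : VertexL2 => (x : ℤ → ℂ)) this

/-! ### Decaying solutions of the difference equation -/

/-- The quadratic form `Q` is conserved by the recurrence, so decay forces `Q = 0`. For `|t| ≤ 1` it
dominates `(‖z (n + 1)‖ - ‖z n‖)²`; hence `‖z n‖` is constant, and zero. The band edges `|t| = 1`
are covered. -/
theorem eq_zero_of_recurrence {t : ℝ} (ht : |t| ≤ 1) {z : ℕ → ℂ}
    (hz : ∀ n, z (n + 2) + z n = 2 * t * z (n + 1)) (h0 : Tendsto z atTop (𝓝 0)) (n : ℕ) :
    z n = 0 := by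
  set Q : ℕ → ℝ := fun n => Complex.normSq (z (n + 1)) + Complex.normSq (z n) -
    2 * t * ((z (n + 1)).re * (z n).re + (z (n + 1)).im * (z n).im) with hQ
  have hstep (n : ℕ) : Q (n + 1) = Q n := by
    have hre := congrArg Complex.re (hz n)
    have him := congrArg Complex.im (hz n)
    have e : (2 * (t : ℂ) * z (n + 1)) = ((2 * t : ℝ) : ℂ) * z (n + 1) := by push_cast; ring
    rw [e, Complex.re_ofReal_mul, Complex.add_re] at hre
    rw [e, Complex.im_ofReal_mul, Complex.add_im] at him
    simp only [hQ, Complex.normSq_apply]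
    rw [show n + 1 + 1 = n + 2 from rfl]
    linear_combination ((z (n + 2)).re - (z n).re) * hre + ((z (n + 2)).im - (z n).im) * him
  have hconst (n : ℕ) : Q n = Q 0 := by
    induction n with
    | zero => rfl
    | succ n ih => rw [hstep, ih]
  have h1 : Tendsto (fun n => z (n + 1)) atTop (𝓝 0) := h0.comp (tendsto_add_atTop_nat 1)
  have hlim : Tendsto Q atTop (𝓝 0) := by
    have a1 := (Complex.continuous_normSq.tendsto 0).comp h1
    have a2 := (Complex.continuous_normSq.tendsto 0).comp h0
    have a3 := (Complex.continuous_re.tendsto 0).comp h1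
    have a4 := (Complex.continuous_re.tendsto 0).comp h0
    have a5 := (Complex.continuous_im.tendsto 0).comp h1
    have a6 := (Complex.continuous_im.tendsto 0).comp h0
    have := (a1.add a2).sub (((a3.mul a4).add (a5.mul a6)).const_mul (2 * t))
    simpa using this
  have hQ0 (n : ℕ) : Q n = 0 := by
    have : Tendsto Q atTop (𝓝 (Q n)) := by
      rw [hconst n, show Q = fun _ => Q 0 from funext hconst]
      exact tendsto_const_nhds
    exact tendsto_nhds_unique this hlim
  have hnorm (n : ℕ) : ‖z (n + 1)‖ = ‖z n‖ := by
    have hq := hQ0 n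
    simp only [hQ, Complex.normSq_eq_norm_sq] at hq
    have hcs : |(z (n + 1)).re * (z n).re + (z (n + 1)).im * (z n).im| ≤ ‖z (n + 1)‖ * ‖z n‖ := by
      have := Complex.abs_re_le_norm (z (n + 1) * starRingEnd ℂ (z n))
      rw [norm_mul, RCLike.norm_conj, Complex.mul_re, Complex.conj_re, Complex.conj_im] at this
      simpa using this
    have h2 : t * ((z (n + 1)).re * (z n).re + (z (n + 1)).im * (z n).im) ≤
        ‖z (n + 1)‖ * ‖z n‖ := by
      refine (le_abs_self _).trans ?_
      rw [abs_mul]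
      calc |t| * _ ≤ 1 * (‖z (n + 1)‖ * ‖z n‖) :=
            mul_le_mul ht hcs (abs_nonneg _) zero_le_one
        _ = _ := one_mul _
    have h3 : (‖z (n + 1)‖ - ‖z n‖) ^ 2 ≤ 0 := by nlinarith
    have h4 := pow_eq_zero_iff (two_ne_zero) |>.1 (le_antisymm h3 (sq_nonneg _))
    linarith
  have hn (n : ℕ) : ‖z n‖ = ‖z 0‖ := by
    induction n with
    | zero => rfl
    | succ n ih => rw [hnorm, ih]
  have hl : Tendsto (fun n => ‖z n‖) atTop (𝓝 ‖z n‖) := by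
    rw [hn n, show (fun n => ‖z n‖) = fun _ => ‖z 0‖ from funext hn]
    exact tendsto_const_nhds
  have := tendsto_nhds_unique hl (by simpa using h0.norm)
  exact norm_eq_zero.1 this

theorem tendsto_zero_of_memℓp {y : ℤ → ℂ} (hy : Memℓp (E := fun _ : ℤ => ℂ) y 2) {φ : ℕ → ℤ}
    (hφ : Function.Injective φ) : Tendsto (fun n => y (φ n)) atTop (𝓝 0) := by
  rw [memℓp_two_iff] at hy
  have h1 := (hy.comp_injective hφ).tendsto_atTop_zero
  have h2 : Tendsto (fun n => ‖y (φ n)‖) atTop (𝓝 0) := by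
    have := h1.sqrt
    simpa using this
  exact tendsto_zero_iff_norm_tendsto_zero.2 h2

/-- Inside the bands, the Jacobi equation has no square summable solutions with sources at
`-5` and `-4` only. -/
theorem eq_zero_of_mem_band {A α γ₁ γ₂ E : ℝ} (hc : Real.cos (A * Real.pi) ≠ 0)
    (h : |xi α E| ≤ |Real.cos (A * Real.pi)|) {y : ℤ → ℂ}
    (hy : Memℓp (E := fun _ : ℤ => ℂ) y 2)
    (hJ : ∀ j, j ≠ -5 → j ≠ -4 → jacobi A (twoImpurities α γ₁ γ₂) E y j = 0) : y = 0 := by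
  set c := Real.cos (A * Real.pi) with hcd
  have hc' : (c : ℂ) ≠ 0 := by exact_mod_cast hc
  set t := xi α E / c with ht
  have ht1 : |t| ≤ 1 := by
    rw [ht, abs_div]
    exact div_le_one_of_le₀ h (abs_nonneg _)
  have hrec (j : ℤ) (h1 : j ≠ 1) (h2 : j ≠ 2) (h3 : j ≠ -5) (h4 : j ≠ -4) :
      y (j + 1) + y (j - 1) = 2 * t * y j := by
    have := hJ j h3 h4
    rw [jacobi, twoImpurities_of_ne h1 h2] at this
    have e4 : (4 * cosE E Real.pi + α * sinE E Real.pi : ℝ) = 4 * (t * c) := by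
      rw [ht, div_mul_cancel₀ _ hc, xi]; ring
    rw [e4, ← hcd] at this
    push_cast at this
    apply mul_left_cancel₀ hc'
    linear_combination this / 2
  have hright (n : ℕ) : y (2 + n) = 0 := by
    refine eq_zero_of_recurrence ht1 (z := fun n : ℕ => y (2 + n)) (fun n => ?_)
      (tendsto_zero_of_memℓp hy fun a b hab => by simpa using hab) n
    have := hrec (2 + (n + 1 : ℕ)) (by push_cast; omega) (by push_cast; omega)
      (by push_cast; omega) (by push_cast; omega)
    rw [show (2 : ℤ) + (n + 1 : ℕ) + 1 = 2 + (n + 2 : ℕ) by push_cast; ring,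
      show (2 : ℤ) + (n + 1 : ℕ) - 1 = 2 + n by push_cast; ring] at this
    exact this
  have hleft (n : ℕ) : y (-5 - n) = 0 := by
    refine eq_zero_of_recurrence ht1 (z := fun n : ℕ => y (-5 - n)) (fun n => ?_)
      (tendsto_zero_of_memℓp hy fun a b hab => by simpa using hab) n
    have := hrec (-5 - (n + 1 : ℕ)) (by push_cast; omega) (by push_cast; omega)
      (by push_cast; omega) (by push_cast; omega)
    rw [show (-5 : ℤ) - (n + 1 : ℕ) + 1 = -5 - n by push_cast; ring,
      show (-5 : ℤ) - (n + 1 : ℕ) - 1 = -5 - (n + 2 : ℕ) by push_cast; ring, add_comm] at this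
    exact this
  -- As `c ≠ 0`, two consecutive zeros propagate to the left, across the impurities and down to the
  -- vertex `-4`. From `-5` on, the decay to the left takes over.
  have hdown (j : ℤ) (h3 : j ≠ -5) (h4 : j ≠ -4) (h1 : y (j + 1) = 0) (h0 : y j = 0) :
      y (j - 1) = 0 := by
    have := hJ j h3 h4
    rw [jacobi, h1, h0, mul_zero, sub_zero, zero_add, ← hcd] at this
    exact (mul_eq_zero.1 this).resolve_left (mul_ne_zero two_ne_zero hc')
  have y3 : y 3 = 0 := hright 1
  have y2 : y 2 = 0 := hright 0
  have y1 : y 1 = 0 := hdown 2 (by norm_num) (by norm_num) y3 y2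
  have y0 : y 0 = 0 := hdown 1 (by norm_num) (by norm_num) y2 y1
  have ym1 : y (-1) = 0 := hdown 0 (by norm_num) (by norm_num) y1 y0
  have ym2 : y (-2) = 0 := hdown (-1) (by norm_num) (by norm_num) (by simpa using y0) ym1
  have ym3 : y (-3) = 0 := hdown (-2) (by norm_num) (by norm_num) (by simpa using ym1) ym2
  have ym4 : y (-4) = 0 := hdown (-3) (by norm_num) (by norm_num) (by simpa using ym2) ym3
  funext j
  by_cases hj : 2 ≤ j
  · have := hright (j - 2).toNat
    rwa [Int.toNat_of_nonneg (by omega), add_sub_cancel] at this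
  by_cases hj' : j ≤ -5
  · have := hleft (-5 - j).toNat
    rwa [Int.toNat_of_nonneg (by omega), sub_sub_cancel] at this
  have : j = 1 ∨ j = 0 ∨ j = -1 ∨ j = -2 ∨ j = -3 ∨ j = -4 := by omega
  rcases this with rfl | rfl | rfl | rfl | rfl | rfl <;> assumption

end MagneticChain

end

section

open MeasureTheory Set Filter Topology UnboundedOperator

namespace MagneticChain

/-! ### Counting eigenvalues outside the essential spectrum -/

theorem IsAction.left_value_unique {A : ℝ} {β : ℤ → ℝ} {f h : ChainL2} {u v u' v' : Edge → ℝ → ℂ}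
    {g g' : Edge → EdgeL2} (H : IsAction A β f h u v g) (H' : IsAction A β f h u' v' g')
    (e : Edge) : u e 0 = u' e 0 :=
  (H.edge e).eqOn (H'.edge e) zero_mem_Icc_pi

/-- The value at the `j`-th vertex, as a functional on the domain. -/
noncomputable def vertexValue (A : ℝ) (β : ℤ → ℝ) (j : ℤ) : (hamiltonian A β).domain →ₗ[ℂ] ℂ where
  toFun f := (exists_isAction_domain f).choose (j, true) 0
  map_add' f f' := by
    obtain ⟨v, g, H⟩ := (exists_isAction_domain f).choose_spec
    obtain ⟨v', g', H'⟩ := (exists_isAction_domain f').choose_spec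
    obtain ⟨v'', g'', H''⟩ := (exists_isAction_domain (f + f')).choose_spec
    obtain ⟨u₁, v₁, g₁, H₁, e₁⟩ : ∃ u₁ v₁ g₁, IsAction A β ((f + f' : (hamiltonian A β).domain) :
        ChainL2) (hamiltonian A β (f + f')) u₁ v₁ g₁ ∧
        u₁ (j, true) 0 = (exists_isAction_domain f).choose (j, true) 0 +
          (exists_isAction_domain f').choose (j, true) 0 := by
      have hs := (graph A β).add_mem (x := ((f : ChainL2), hamiltonian A β f))
        (y := ((f' : ChainL2), hamiltonian A β f')) ⟨_, v, g, H⟩ ⟨_, v', g', H'⟩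
      obtain ⟨u₁, v₁, g₁, H₁⟩ := hs
      have hmap : hamiltonian A β (f + f') = hamiltonian A β f + hamiltonian A β f' :=
        (hamiltonian A β).map_add f f'
      refine ⟨u₁, v₁, g₁, by rw [hmap]; exact H₁, ?_⟩
      have hsum := ((H.sobolev (j, true)).add (H'.sobolev (j, true))).isPrimitive.continuousOn
      have hae : u₁ (j, true) =ᵐ[volume.restrict (Icc (0 : ℝ) Real.pi)]
          (exists_isAction_domain f).choose (j, true) +
          (exists_isAction_domain f').choose (j, true) := by
        rw [← restrict_Ioo_eq_restrict_Icc]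
        filter_upwards [H₁.repr (j, true), H.repr (j, true), H'.repr (j, true),
          Lp.coeFn_add ((f : ChainL2) (j, true)) ((f' : ChainL2) (j, true))] with x h1 h2 h3 h4
        rw [← h1, Pi.add_apply, ← h2, ← h3, ← Pi.add_apply, ← h4]
        rfl
      exact Measure.eqOn_Icc_of_ae_eq volume Real.pi_pos.ne hae
        (H₁.sobolev _).isPrimitive.continuousOn hsum zero_mem_Icc_pi
    rw [← e₁]
    exact H''.left_value_unique H₁ (j, true)
  map_smul' c f := by
    obtain ⟨v, g, H⟩ := (exists_isAction_domain f).choose_spec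
    obtain ⟨v'', g'', H''⟩ := (exists_isAction_domain (c • f)).choose_spec
    have hc := ((H.sobolev (j, true)).smul c).isPrimitive.continuousOn
    have hae : (exists_isAction_domain (c • f)).choose (j, true)
        =ᵐ[volume.restrict (Icc (0 : ℝ) Real.pi)]
        c • (exists_isAction_domain f).choose (j, true) := by
      rw [← restrict_Ioo_eq_restrict_Icc]
      filter_upwards [H''.repr (j, true), H.repr (j, true),
        Lp.coeFn_smul c ((f : ChainL2) (j, true))] with x h1 h2 h4
      rw [← h1, Pi.smul_apply, ← h2, ← Pi.smul_apply, ← h4]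
      rfl
    exact Measure.eqOn_Icc_of_ae_eq volume Real.pi_pos.ne hae
      (H''.sobolev _).isPrimitive.continuousOn hc zero_mem_Icc_pi

theorem IsAction.vertexValue_eq {A : ℝ} {β : ℤ → ℝ} {f : (hamiltonian A β).domain}
    {u v : Edge → ℝ → ℂ} {g : Edge → EdgeL2}
    (H : IsAction A β f (hamiltonian A β f) u v g) (j : ℤ) :
    vertexValue A β j f = u (j, true) 0 := by
  obtain ⟨v', g', H'⟩ := (exists_isAction_domain f).choose_spec
  exact H'.left_value_unique H (j, true)

/-- A coupling constant enters only multiplied by the value at its vertex. Therefore functions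
vanishing at the vertices `1` and `2` do not see the impurities. -/
theorem IsAction.congr_coupling {A : ℝ} {β β' : ℤ → ℝ} {f h : ChainL2} {u v : Edge → ℝ → ℂ}
    {g : Edge → EdgeL2} (H : IsAction A β f h u v g)
    (hβ : ∀ j, β j = β' j ∨ u (j, true) 0 = 0) : IsAction A β' f h u v g where
  sobolev := H.sobolev
  repr := H.repr
  action := H.action
  continuity := H.continuity
  coupling j := by
    rw [H.coupling]
    rcases hβ j with h | h
    · rw [h]
    · rw [h, mul_zero, mul_zero]

/-- The essential spectrum: bands and infinitely degenerate eigenvalues. -/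
def essSet (A α : ℝ) : Set ℝ :=
  {E | |xi α E| ≤ |Real.cos (A * Real.pi)|} ∪ {E | ∃ n : ℕ, 1 ≤ n ∧ E = (n : ℝ) ^ 2}

theorem exists_nat_sq_le {E : ℝ} (hE : 1 ≤ E) :
    ∃ n : ℕ, 1 ≤ n ∧ (n : ℝ) ^ 2 ≤ E ∧ E < ((n : ℝ) + 1) ^ 2 := by
  have hs : 1 ≤ √E := Real.one_le_sqrt.2 hE
  refine ⟨⌊√E⌋₊, Nat.le_floor (by simpa using hs), ?_, ?_⟩
  · have := Nat.floor_le (Real.sqrt_nonneg E)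
    exact (Real.le_sqrt (by positivity) (by linarith)).1 this
  · have := Nat.lt_floor_add_one (√E)
    exact (Real.sqrt_lt' (by positivity)).1 this

theorem sinE_pi_ne_zero {E : ℝ} (h : ∀ n : ℕ, 1 ≤ n → E ≠ (n : ℝ) ^ 2) : sinE E Real.pi ≠ 0 := by
  rcases lt_or_ge E 1 with h1 | h1
  · exact (sinE_pi_pos_of_lt_one h1).ne'
  · obtain ⟨n, hn, h2, h3⟩ := exists_nat_sq_le h1
    intro h0
    have := neg_one_pow_mul_sinE_pos (lt_of_le_of_ne h2 (h n hn).symm) h3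
    rw [h0, mul_zero] at this
    exact lt_irrefl _ this

theorem notMem_essSet {A α E : ℝ} (h : E ∉ essSet A α) :
    sinE E Real.pi ≠ 0 ∧ |Real.cos (A * Real.pi)| < |xi α E| := by
  simp only [essSet, mem_union, mem_ofPred_eq, not_or, not_le, not_exists, not_and] at h
  exact ⟨sinE_pi_ne_zero h.2, h.1⟩

theorem continuous_xi (α : ℝ) : Continuous (xi α) :=
  (continuous_cosE_left _).add ((continuous_sinE_left _).const_mul _)

theorem isClosed_essSet (A α : ℝ) : IsClosed (essSet A α) := by
  refine (isClosed_le (continuous_xi α).abs continuous_const).union ?_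
  have h1 : {E : ℝ | ∃ n : ℕ, 1 ≤ n ∧ E = (n : ℝ) ^ 2} =
      Real.sqrt ⁻¹' range ((↑) : ℕ → ℝ) ∩ Ici 1 := by
    ext E
    constructor
    · rintro ⟨n, hn, rfl⟩
      have : (1 : ℝ) ≤ n := by exact_mod_cast hn
      exact ⟨⟨n, (Real.sqrt_sq (by positivity)).symm⟩, one_le_pow₀ this⟩
    · rintro ⟨⟨n, hn⟩, hE : 1 ≤ E⟩
      have hs : 1 ≤ √E := Real.one_le_sqrt.2 hE
      rw [← hn] at hs
      exact ⟨n, by exact_mod_cast hs, by rw [hn, Real.sq_sqrt (by linarith)]⟩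
  rw [h1]
  exact (Nat.isClosedEmbedding_coe_real.isClosed_range.preimage Real.continuous_sqrt).inter
    isClosed_Ici

theorem rank_eigenfunctionsIn_le (A α γ₁ γ₂ : ℝ) {I : Set ℝ} (hI : IsOpen I)
    (hIc : I.OrdConnected) (hd : Disjoint I (essSet A α)) :
    Module.rank ℂ (eigenfunctionsIn (hamiltonian A (twoImpurities α γ₁ γ₂)) I) ≤ 2 := by
  set β := twoImpurities α γ₁ γ₂ with hβ
  refine (isSymmetric_hamiltonian A β).rank_eigenfunctionsIn_le
    (isSymmetric_hamiltonian A fun _ => α) hI hIc (fun x hx => ?_)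
    (LinearMap.pi ![vertexValue A β 1, vertexValue A β 2]) fun f hf => ?_
  · obtain ⟨h1, h2⟩ := notMem_essSet (disjoint_left.1 hd hx)
    exact mem_resolventSet_const h1 h2
  · obtain ⟨u, v, g, H⟩ := exists_isAction_domain f
    have h1 : u (1, true) 0 = 0 := by
      rw [← H.vertexValue_eq]
      exact congrFun hf 0
    have h2 : u (2, true) 0 = 0 := by
      rw [← H.vertexValue_eq]
      exact congrFun hf 1
    refine (H.congr_coupling (β' := fun _ => α) fun j => ?_).exists_domain
    by_cases j1 : j = 1
    · subst j1; exact Or.inr h1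
    by_cases j2 : j = 2
    · subst j2; exact Or.inr h2
    exact Or.inl (twoImpurities_of_ne j1 j2)

theorem encard_eigenvaluesIn_le (A α γ₁ γ₂ : ℝ) {I : Set ℝ} (hI : IsOpen I)
    (hIc : I.OrdConnected) (hd : Disjoint I (essSet A α)) :
    (eigenvaluesIn (hamiltonian A (twoImpurities α γ₁ γ₂)) I).encard ≤ 2 :=
  (isSymmetric_hamiltonian A _).encard_eigenvaluesIn_le (n := 2)
    (rank_eigenfunctionsIn_le A α γ₁ γ₂ hI hIc hd)

/-- Far to the left, `C` dominates `S`. -/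
theorem exists_cosE_dominates {K : ℝ} (hK : 0 ≤ K) :
    ∃ E₀ : ℝ, E₀ < 0 ∧ ∀ E ≤ E₀, 1 < cosE E Real.pi - K * sinE E Real.pi := by
  -- Here `√(-E) ≥ 2K + 1`, so `C ≥ (2K + 1)S`, and `S ≥ π`; thus `C - KS ≥ (K + 1)S > 1`.
  refine ⟨-(2 * K + 1) ^ 2, by nlinarith, fun E hE => ?_⟩
  have hE0 : E ≤ 0 := by nlinarith
  set κ := √(-E) with hκ
  have hκ1 : 2 * K + 1 ≤ κ := Real.le_sqrt_of_sq_le (by linarith)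
  have h1 := sqrt_neg_mul_sinE_le hE0 Real.pi
  have hS : Real.pi ≤ sinE E Real.pi := by
    have := intervalIntegral.integral_mono_on (a := 0) (b := Real.pi) (μ := volume)
      Real.pi_pos.le intervalIntegrable_const ((continuous_cosE_right E).intervalIntegrable _ _)
      (fun x _ => one_le_cosE hE0 x)
    simpa [sinE] using this
  rw [← hκ] at h1
  have hpi := Real.pi_gt_three
  nlinarith

theorem notMem_essSet_of_le {A α : ℝ} : ∃ E₀ : ℝ, ∀ E ≤ E₀, E ∉ essSet A α := by
  obtain ⟨E₀, h0, H⟩ := exists_cosE_dominates (K := |α| / 4) (by positivity)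
  refine ⟨E₀, fun E hE => ?_⟩
  have h1 := H E hE
  have hS := sinE_pi_pos_of_lt_one (E := E) (by linarith)
  have hx : 1 < xi α E := by
    have := mul_le_mul_of_nonneg_right (neg_abs_le α) hS.le
    rw [xi]
    linarith
  rintro (h | ⟨n, hn, h⟩)
  · have : |xi α E| ≤ 1 := h.trans (Real.abs_cos_le_one _)
    exact absurd (le_abs_self (xi α E)) (by linarith)
  · have : (0 : ℝ) ≤ (n : ℝ) ^ 2 := by positivity
    linarith

/-- There is a real regular point. -/
theorem exists_mem_resolventSet (A α γ₁ γ₂ : ℝ) :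
    ∃ E : ℝ, (E : ℂ) ∈ resolventSet (hamiltonian A (twoImpurities α γ₁ γ₂)) := by
  obtain ⟨E₀, H⟩ := notMem_essSet_of_le (A := A) (α := α)
  have hfin : (eigenvaluesIn (hamiltonian A (twoImpurities α γ₁ γ₂)) (Iio E₀)).Finite := by
    refine finite_of_encard_le_coe (k := 2) (encard_eigenvaluesIn_le A α γ₁ γ₂ isOpen_Iio
      ordConnected_Iio (disjoint_left.2 fun x hx => H x (le_of_lt hx)))
  obtain ⟨E, hE, hne⟩ := (Iio_infinite E₀).exists_notMem_finite hfin
  obtain ⟨h1, h2⟩ := notMem_essSet (H E (le_of_lt hE))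
  refine ⟨E, mem_resolventSet_of_eigenspace h1 h2 ?_⟩
  by_contra h
  exact hne ⟨hE, h⟩

/-- A small interval around a real point outside `essSet` carries at most two eigenvalues with
multiplicity, and its other points are regular. So a spectral point there is an isolated eigenvalue
of finite multiplicity. -/
theorem essentialSpectrum_subset (A α γ₁ γ₂ : ℝ) :
    essentialSpectrum (hamiltonian A (twoImpurities α γ₁ γ₂)) ⊆ Complex.ofReal '' essSet A α := by
  rintro z ⟨hz, hnd⟩
  obtain ⟨E₁, hE₁⟩ := exists_mem_resolventSet A α γ₁ γ₂
  have him : z.im = 0 := by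
    by_contra h
    exact hz ((isSymmetric_hamiltonian A _).mem_resolventSet_of_im_ne_zero hE₁ h)
  obtain ⟨E, rfl⟩ : ∃ E : ℝ, (E : ℂ) = z := ⟨z.re, Complex.ext rfl him.symm⟩
  refine ⟨E, by_contra fun hE => hnd ?_, rfl⟩
  obtain ⟨ε, hε, hball⟩ := Metric.isOpen_iff.1 (isClosed_essSet A α).isOpen_compl E hE
  have hd : Disjoint (Metric.ball E ε) (essSet A α) := disjoint_left.2 fun x hx => hball hx
  have hoc : (Metric.ball E ε).OrdConnected := by rw [Real.ball_eq_Ioo]; exact ordConnected_Ioo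
  have hrank := rank_eigenfunctionsIn_le A α γ₁ γ₂ Metric.isOpen_ball hoc hd
  have hfin := finite_of_encard_le_coe (k := 2)
    (encard_eigenvaluesIn_le A α γ₁ γ₂ Metric.isOpen_ball hoc hd)
  refine ⟨hz, ?_, fun h => ?_, ?_⟩
  · intro hacc
    have hmem : Metric.ball (E : ℂ) ε ∈ 𝓝 (E : ℂ) := Metric.ball_mem_nhds _ hε
    have hinf := (accPt_iff_frequently.1 hacc)
    have hsub : ∀ w ∈ Metric.ball (E : ℂ) ε,
        w ∈ spectrum (hamiltonian A (twoImpurities α γ₁ γ₂)) →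
        w ∈ Complex.ofReal '' eigenvaluesIn (hamiltonian A (twoImpurities α γ₁ γ₂))
          (Metric.ball E ε) := by
      intro w hw hws
      have hwim : w.im = 0 := by
        by_contra h
        exact hws ((isSymmetric_hamiltonian A _).mem_resolventSet_of_im_ne_zero hE₁ h)
      obtain ⟨x, rfl⟩ : ∃ x : ℝ, (x : ℂ) = w := ⟨w.re, Complex.ext rfl hwim.symm⟩
      have hx : x ∈ Metric.ball E ε := by
        rw [Metric.mem_ball, Complex.dist_eq, ← Complex.ofReal_sub, Complex.norm_real] at hw
        exact hw
      refine ⟨x, ⟨hx, fun h => hws ?_⟩, rfl⟩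
      obtain ⟨h1, h2⟩ := notMem_essSet (hball hx)
      exact mem_resolventSet_of_eigenspace h1 h2 h
    have hcl : IsClosed (Complex.ofReal '' eigenvaluesIn (hamiltonian A (twoImpurities α γ₁ γ₂))
          (Metric.ball E ε) \ {(E : ℂ)}) := ((hfin.image _).subset sdiff_subset).isClosed
    have hn : (Complex.ofReal '' eigenvaluesIn (hamiltonian A (twoImpurities α γ₁ γ₂))
          (Metric.ball E ε) \ {(E : ℂ)})ᶜ ∈ 𝓝 (E : ℂ) :=
      hcl.isOpen_compl.mem_nhds (by simp)
    obtain ⟨w, ⟨hw1, hw2⟩, hw3, hw4⟩ := (hinf.and_eventually (inter_mem hmem hn)).exists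
    exact hw4 ⟨hsub w hw3 hw2, hw1⟩
  · obtain ⟨h1, h2⟩ := notMem_essSet hE
    exact hz (mem_resolventSet_of_eigenspace h1 h2 h)
  · have hle : eigenspace (hamiltonian A (twoImpurities α γ₁ γ₂)) (E : ℂ) ≤
        eigenfunctionsIn (hamiltonian A (twoImpurities α γ₁ γ₂)) (Metric.ball E ε) :=
      le_iSup₂ (f := fun (E : ℝ) (_ : E ∈ Metric.ball _ ε) =>
        eigenspace (hamiltonian A (twoImpurities α γ₁ γ₂)) (E : ℂ)) E (Metric.mem_ball_self hε)
    have : FiniteDimensional ℂ (eigenfunctionsIn (hamiltonian A (twoImpurities α γ₁ γ₂))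
        (Metric.ball E ε)) :=
      Module.rank_lt_aleph0_iff.1 (hrank.trans_lt (Cardinal.natCast_lt_aleph0 (n := 2)))
    exact Submodule.finiteDimensional_of_le hle

end MagneticChain

end

section

open MeasureTheory Set Filter Topology UnboundedOperator

namespace MagneticChain

/-! ### Points of the essential spectrum -/

theorem inner_eq_zero_of_disjoint {f f' : ChainL2} (h : ∀ e, f e = 0 ∨ f' e = 0) :
    inner ℂ f f' = 0 := by
  rw [lp.inner_eq_tsum]
  refine (tsum_congr fun e => ?_).trans tsum_zero
  rcases h e with h | h
  · rw [h, inner_zero_left]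
  · rw [h, inner_zero_right]

theorem mem_essentialSpectrum_of_eigenspace {H : Type*} [NormedAddCommGroup H] [NormedSpace ℂ H]
    {T : H →ₗ.[ℂ] H} {z : ℂ} (h : ¬ FiniteDimensional ℂ (eigenspace T z)) :
    z ∈ essentialSpectrum T := by
  refine ⟨fun hz => h ?_, fun hd => h hd.2.2.2⟩
  rw [eigenspace_eq_bot_of_mem_resolventSet hz]
  infer_instance

/-- Infinitely many eigenfunctions supported on disjoint pairs of rings. -/
theorem not_finiteDimensional_of_pairs {V : Submodule ℂ ChainL2} (k : ℤ) (F : ℕ → ChainL2)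
    (hV : ∀ n, F n ∈ V) (h0 : ∀ n, F n ≠ 0)
    (hs : ∀ (n : ℕ) (e : Edge), e.1 ≠ k + 2 * n → e.1 ≠ k + 2 * n + 1 → F n e = 0) :
    ¬ FiniteDimensional ℂ V := by
  intro hfin
  have hli : LinearIndependent ℂ F := linearIndependent_of_ne_zero_of_inner_eq_zero h0
    fun i j hij => inner_eq_zero_of_disjoint fun e => by
      by_contra! hne
      have hi : e.1 = k + 2 * i ∨ e.1 = k + 2 * i + 1 := by
        by_contra! h
        exact hne.1 (hs i e h.1 h.2)
      have hj : e.1 = k + 2 * j ∨ e.1 = k + 2 * j + 1 := by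
        by_contra! h
        exact hne.2 (hs j e h.1 h.2)
      omega
  have hli' : LinearIndependent ℂ (fun n => (⟨F n, hV n⟩ : V)) :=
    LinearIndependent.of_comp V.subtype hli
  have := hli'.finite
  exact not_finite ℕ

theorem IsAction.edge_eq_zero {A E : ℝ} {β : ℤ → ℝ} {f : ChainL2} {u v : Edge → ℝ → ℂ}
    {g : Edge → EdgeL2} (H : IsAction A β f ((E : ℂ) • f) u v g) (hS : sinE E Real.pi ≠ 0)
    (e : Edge) (h0 : u (e.1, true) 0 = 0) (h1 : u (e.1 + 1, true) 0 = 0) : f e = 0 := by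
  have hl : u e 0 = 0 := by rw [H.left_value, h0]
  have hr : u e Real.pi = 0 := by rw [H.right_value, h1]
  have he := H.edge e
  have h1 := he.transfer (E := E) (r := 0) (by rw [add_zero]; rfl)
  rw [← sourceValue, sourceValue_zero, hl, hr] at h1
  simp only [mul_zero, sub_zero, zero_add, add_zero] at h1
  have hS' : (sinE E Real.pi : ℂ) ≠ 0 := by exact_mod_cast hS
  refine he.eq_zero hl ?_
  rw [hl, mul_zero, add_zero]
  exact (mul_eq_zero.1 h1.symm).resolve_left hS'

/-- Degenerate bands. -/
theorem mem_essentialSpectrum_of_cos_eq_zero {A α γ₁ γ₂ E : ℝ} (hS : sinE E Real.pi ≠ 0)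
    (hc : Real.cos (A * Real.pi) = 0) (hx : xi α E = 0) :
    (E : ℂ) ∈ essentialSpectrum (hamiltonian A (twoImpurities α γ₁ γ₂)) := by
  set β := twoImpurities α γ₁ γ₂ with hβ
  have hx' : 4 * cosE E Real.pi + α * sinE E Real.pi = 0 := by
    rw [xi] at hx; linarith
  -- With `c = 0` and `ξ = 0` the Jacobi operator annihilates every sequence supported away from the
  -- impurities. The vertices `4 + 2n` have disjoint pairs of adjacent rings.
  have hmem (n : ℕ) : Memℓp (E := fun _ : ℤ => ℂ) (Pi.single (4 + 2 * n : ℤ) (1 : ℂ)) 2 := by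
    simpa only [lp.coeFn_single] using lp.memℓp (lp.single 2 (4 + 2 * n : ℤ) (1 : ℂ) : VertexL2)
  have hsol (n : ℕ) := exists_isAction_of_jacobi (A := A) (β := β) hS (hmem n) 0 fun j => by
    rw [source_zero, neg_zero, jacobi, hc]
    by_cases hj : j = 4 + 2 * n
    · rw [hβ, twoImpurities_of_ne (by omega) (by omega), hx']
      simp
    · rw [Pi.single_eq_of_ne hj]
      simp
  choose F u v g H hu using hsol
  simp only [add_zero] at H
  refine mem_essentialSpectrum_of_eigenspace (not_finiteDimensional_of_pairs 3 F
    (fun n => mem_eigenspace_hamiltonian_iff.2 ⟨u n, v n, g n, H n⟩) (fun n h0 => ?_)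
    fun n e h1 h2 => ?_)
  · have hH := H n
    rw [h0] at hH
    have h2 := hH.vertex_eq_zero (4 + 2 * n, true)
    rw [hu, Pi.single_eq_same] at h2
    exact one_ne_zero h2
  · refine (H n).edge_eq_zero hS e ?_ ?_
    · rw [hu, Pi.single_eq_of_ne (by simp only; omega)]
    · rw [hu, Pi.single_eq_of_ne (by simp only; omega)]

/-- Nondegenerate bands. -/
theorem mem_essentialSpectrum_of_cos_ne_zero {A α γ₁ γ₂ E : ℝ} (hS : sinE E Real.pi ≠ 0)
    (hc : Real.cos (A * Real.pi) ≠ 0) (hx : |xi α E| ≤ |Real.cos (A * Real.pi)|) :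
    (E : ℂ) ∈ essentialSpectrum (hamiltonian A (twoImpurities α γ₁ γ₂)) := by
  set β := twoImpurities α γ₁ γ₂ with hβ
  refine ⟨fun hres => ?_, fun hd => hd.2.2.1 ((Submodule.eq_bot_iff _).2 fun f hf => ?_)⟩
  · have ccont : Continuous fun x : ℝ => (sinE E (Real.pi - x) : ℂ) * phase (-A) x :=
      (Complex.continuous_ofReal.comp ((continuous_sinE_right E).comp (by fun_prop))).mul
        (continuous_phase (-A))
    -- A source outside the range of `H - E`: on the upper edge of ring `-5` it is chosen to make
    -- the source value the positive number `∫ S(π - x)²`. It acts at the vertices `-5` and `-4`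
    -- only.
    obtain ⟨r₀, hr₀⟩ := EdgeL2.exists_ae_eq ccont.continuousOn
    have hval : sourceValue E A r₀ =
        ((∫ x in (0 : ℝ)..Real.pi, sinE E (Real.pi - x) ^ 2 : ℝ) : ℂ) := by
      rw [sourceValue, ← intervalIntegral.integral_ofReal]
      refine integral_congr_Ioo ?_ pi_mem_Icc_pi
      filter_upwards [hr₀] with x hx
      rw [hx]
      push_cast
      linear_combination (sinE E (Real.pi - x) : ℂ) ^ 2 * phase_mul_phase_neg A x
    have hpos : 0 < ∫ x in (0 : ℝ)..Real.pi, sinE E (Real.pi - x) ^ 2 := by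
      refine intervalIntegral.integral_pos Real.pi_pos
        (((continuous_sinE_right E).comp (by fun_prop)).pow 2).continuousOn
        (fun x _ => sq_nonneg _) ⟨0, zero_mem_Icc_pi, ?_⟩
      rw [sub_zero]
      positivity
    set r : ChainL2 := lp.single 2 ((-5, true) : Edge) r₀ with hr
    have hr_ne (e : Edge) (he : e ≠ (-5, true)) : r e = 0 := by
      rw [hr, lp.single_apply, Pi.single_eq_of_ne he]
    have hr_self : r ((-5, true) : Edge) = r₀ := by rw [hr, lp.single_apply, Pi.single_eq_same]
    have hsrc (j : ℤ) (h5 : j ≠ -5) (h4 : j ≠ -4) : source A E r j = 0 := by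
      rw [source, hr_ne (j, true) (by simpa using h5), hr_ne (j, false) (by simp),
        hr_ne (j - 1, true) (by simp only [ne_eq, Prod.mk.injEq, and_true]; omega),
        hr_ne (j - 1, false) (by simp)]
      simp only [sourceValue_zero, sourceDeriv_zero, mul_zero, sub_zero, add_zero]
    have hsrc5 : source A E r (-5) = sourceValue E A r₀ := by
      rw [source, hr_self, hr_ne (-5, false) (by simp), hr_ne (-5 - 1, true) (by simp),
        hr_ne (-5 - 1, false) (by simp)]
      simp only [sourceValue_zero, sourceDeriv_zero, mul_zero, sub_zero, add_zero]
    obtain ⟨R, h1, -⟩ := hres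
    obtain ⟨hdom, hR⟩ := h1 r
    obtain ⟨u, v, g, H⟩ := exists_isAction_domain (⟨R r, hdom⟩ : (hamiltonian A β).domain)
    have hjac := H.jacobi_eq (E := E) (r := r) (sub_eq_iff_eq_add'.1 hR)
    have hy := eq_zero_of_mem_band (γ₁ := γ₁) (γ₂ := γ₂) hc hx H.memℓp_vertex fun j h5 h4 => by
      rw [hjac, hsrc j h5 h4, neg_zero]
    -- All vertex values vanish, so the equation at `-5` would make the source value zero.
    have h5 := hjac (-5)
    rw [hy, hsrc5, hval] at h5
    simp only [jacobi, Pi.zero_apply, mul_zero, add_zero, sub_zero] at h5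
    have h6 := neg_eq_zero.1 h5.symm
    exact hpos.ne' (by exact_mod_cast h6)
  · obtain ⟨u, v, g, H⟩ := mem_eigenspace_hamiltonian_iff.1 hf
    have hy := eq_zero_of_mem_band (γ₁ := γ₁) (γ₂ := γ₂) hc hx H.memℓp_vertex fun j _ _ => by
      rw [H.jacobi_eq (r := 0) (by rw [add_zero]), source_zero, neg_zero]
    exact H.eq_zero hS fun j => congrFun hy j

/-- Coefficients of an eigenfunction supported on the rings `m` and `m + 1`. -/
noncomputable def flatCoeff (A : ℝ) (s : ℂ) (m : ℤ) (e : Edge) : ℂ :=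
  if e.1 = m then (if e.2 then 1 else -1)
  else if e.1 = m + 1 then (if e.2 then -s * phase A Real.pi else s * phase (-A) Real.pi) else 0

/-- Infinitely degenerate eigenvalues `n²`. -/
theorem mem_essentialSpectrum_sq (A α γ₁ γ₂ : ℝ) {n : ℕ} (hn : 1 ≤ n) :
    (((n : ℝ) ^ 2 : ℝ) : ℂ) ∈ essentialSpectrum (hamiltonian A (twoImpurities α γ₁ γ₂)) := by
  set β := twoImpurities α γ₁ γ₂ with hβ
  have hz (e : Edge) : (0 : ChainL2) e = 0 := rfl
  have hmem (m : ℤ) : Memℓp (E := fun _ : Edge => ℂ) (flatCoeff A ((-1) ^ n) m) 2 := by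
    refine (memℓp_zero ?_).of_exponent_ge (zero_le : (0 : ENNReal) ≤ 2)
    refine (((finite_singleton m).insert (m + 1)).prod finite_univ).subset fun e he => ?_
    simp only [mem_prod, mem_insert_iff, mem_singleton_iff, mem_univ, and_true]
    by_contra! h
    apply he
    rw [flatCoeff, if_neg h.2, if_neg h.1]
  -- At `E = n²`, `S(π) = 0`, so edge solutions vanishing at `0` vanish at `π` for any slope, and
  -- only the balance of slopes remains. The slopes `1, -1` balance at the vertex `2k`, and those on
  -- ring `2k + 1` balance both at `2k + 1` and at `2k + 2`. Two rings are used because the phases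
  -- of the two semicircles differ for noninteger `A`.
  have hsol (k : ℕ) := exists_isAction A β ((n : ℝ) ^ 2) 0 (flatCoeff A ((-1) ^ n) (2 * k)) 0
    zero_memℓp (hmem _) (fun e => by
      rw [sinE_sq_nat hn, hz, sourceValue_zero]
      simp) (fun j => by
      simp only [sinE_sq_nat hn, cosE_sq_nat, hz, sourceDeriv_zero, Pi.zero_apply, mul_zero,
        zero_add, sub_zero, flatCoeff]
      simp only [if_true, Bool.false_eq_true, if_false]
      by_cases h1 : j + 1 = 2 * (k : ℤ)
      · have n1 : j ≠ 2 * (k : ℤ) := by omega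
        have n2 : j ≠ 2 * (k : ℤ) + 1 := by omega
        simp only [h1, n1, n2, if_true, if_false]
        ring
      by_cases h2 : j = 2 * (k : ℤ)
      · have n1 : j + 1 = 2 * (k : ℤ) + 1 := by omega
        simp only [if_neg h1, if_pos h2, if_pos n1]
        push_cast
        ring
      have n1 : j + 1 ≠ 2 * (k : ℤ) + 1 := by omega
      by_cases h3 : j = 2 * (k : ℤ) + 1
      · simp only [if_neg h1, if_neg h2, if_neg n1, if_pos h3]
        push_cast
        ring
      · simp only [if_neg h1, if_neg h2, if_neg n1, if_neg h3]
        ring)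
  choose F u v g H hu hb using hsol
  simp only [add_zero] at H
  refine mem_essentialSpectrum_of_eigenspace (not_finiteDimensional_of_pairs 0 F
    (fun k => mem_eigenspace_hamiltonian_iff.2 ⟨u k, v k, g k, H k⟩) (fun k h0 => ?_)
    fun k e h1 h2 => ?_)
  · have hH := H k
    rw [h0] at hH
    have hE := hH.edge (2 * k, true)
    have hzero := hH.vertex_eq_zero (2 * k, true)
    have huz : ∀ x ∈ Icc (0 : ℝ) Real.pi, u k (2 * k, true) x = 0 := by
      refine Measure.eqOn_Icc_of_ae_eq volume Real.pi_pos.ne ?_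
        hE.sobolev.isPrimitive.continuousOn continuousOn_const
      rw [← restrict_Ioo_eq_restrict_Icc]
      filter_upwards [hE.repr, Lp.coeFn_zero ℂ 2 edgeMeasure] with x h1 h2
      rw [← h1]
      exact h2
    have hv : v k (2 * k, true) 0 = 0 := by
      have h1 := (hE.sobolev.deriv 0 zero_mem_Icc_pi).congr (fun y hy => (huz y hy).symm)
        (huz 0 zero_mem_Icc_pi).symm
      exact (uniqueDiffOn_Icc Real.pi_pos 0 zero_mem_Icc_pi).eq_deriv _ h1
        (hasDerivWithinAt_const 0 _ (0 : ℂ))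
    have := hb k (2 * k, true)
    rw [quasiDeriv, hv, hzero] at this
    simp [flatCoeff] at this
  · have hE := (H k).edge e
    refine hE.eq_zero (hu k e) ((hb k e).trans ?_)
    rw [zero_add] at h1 h2
    rw [flatCoeff, if_neg h1, if_neg h2]

/-- The essential spectrum does not depend on the impurities. -/
theorem essentialSpectrum_eq (A α γ₁ γ₂ : ℝ) :
    essentialSpectrum (hamiltonian A (twoImpurities α γ₁ γ₂)) = Complex.ofReal '' essSet A α := by
  refine Subset.antisymm (essentialSpectrum_subset A α γ₁ γ₂) ?_
  rintro _ ⟨E, hE, rfl⟩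
  by_cases h : ∃ n : ℕ, 1 ≤ n ∧ E = (n : ℝ) ^ 2
  · obtain ⟨n, hn, rfl⟩ := h
    exact mem_essentialSpectrum_sq A α γ₁ γ₂ hn
  · have hx := hE.resolve_right h
    have hS := sinE_pi_ne_zero fun n hn hE' => h ⟨n, hn, hE'⟩
    by_cases hc : Real.cos (A * Real.pi) = 0
    · refine mem_essentialSpectrum_of_cos_eq_zero hS hc (abs_nonpos_iff.1 ?_)
      simpa [hc] using hx
    · exact mem_essentialSpectrum_of_cos_ne_zero hS hc hx

theorem realEssentialSpectrum_eq (A α γ₁ γ₂ : ℝ) :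
    realEssentialSpectrum (hamiltonian A (twoImpurities α γ₁ γ₂)) = essSet A α := by
  ext E
  change (E : ℂ) ∈ essentialSpectrum _ ↔ _
  rw [essentialSpectrum_eq]
  exact Complex.ofReal_injective.mem_set_image

end MagneticChain

end

section

open MeasureTheory Set Filter Topology

namespace MagneticChain

/-! ### Monotonicity of the discriminant on the cells between the points `n²` -/

/-- Logarithmic derivatives of solutions of `-w'' = E w` decrease in `E`. -/
theorem strictAntiOn_logDeriv {w p : ℝ → ℝ → ℝ} (hw : Continuous fun q : ℝ × ℝ => w q.1 q.2)
    (hwp : ∀ E x, HasDerivAt (w E) (p E x) x)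
    (hpw : ∀ E x, HasDerivAt (p E) (-E * w E x) x)
    (h0 : ∀ E E', p E 0 * w E' 0 - w E 0 * p E' 0 = 0) {h : ℝ} (hh : 0 < h) {K : Set ℝ}
    (hK : IsOpen K) (hKc : K.OrdConnected) (hne : ∀ E ∈ K, w E h ≠ 0) :
    StrictAntiOn (fun E => p E h / w E h) K := by
  have hwr (E : ℝ) : Continuous (w E) := hw.comp (by fun_prop : Continuous fun x : ℝ => (E, x))
  have hwl (x : ℝ) : Continuous fun E => w E x :=
    hw.comp (by fun_prop : Continuous fun E : ℝ => (E, x))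
  -- Divided by `(E - E') w E h * w E' h`, with `E' → E`, this identity yields the derivative `-∫ w²
  -- / w(h)²`.
  have green (E E' : ℝ) : p E h * w E' h - w E h * p E' h =
      (E' - E) * ∫ x in (0 : ℝ)..h, w E x * w E' x := by
    have := intervalIntegral.integral_eq_sub_of_hasDerivAt (a := 0) (b := h)
      (f := fun x => p E x * w E' x - w E x * p E' x)
      (f' := fun x => (E' - E) * (w E x * w E' x))
      (fun x _ => (((hpw E x).mul (hwp E' x)).sub ((hwp E x).mul (hpw E' x))).congr_deriv
        (by ring)) ((((hwr E).mul (hwr E')).const_mul _).intervalIntegrable _ _)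
    rw [intervalIntegral.integral_const_mul] at this
    rw [this, h0, sub_zero]
  have hd : ∀ E ∈ K, HasDerivAt (fun E => p E h / w E h)
      (-((∫ x in (0 : ℝ)..h, w E x * w E x) / (w E h * w E h))) E := by
    intro E hE
    rw [hasDerivAt_iff_tendsto_slope]
    have hc : ContinuousAt (fun E' => -((∫ x in (0 : ℝ)..h, w E' x * w E x) /
        (w E' h * w E h))) E := by
      refine ContinuousAt.neg (ContinuousAt.div ?_ ?_ (mul_ne_zero (hne E hE) (hne E hE)))
      · refine (intervalIntegral.continuous_parametric_intervalIntegral_of_continuous'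
          (f := fun E' x => w E' x * w E x) ?_ 0 h).continuousAt
        exact hw.mul ((hwr E).comp continuous_snd)
      · exact ((hwl h).mul continuous_const).continuousAt
    refine (hc.tendsto.mono_left nhdsWithin_le_nhds).congr' ?_
    filter_upwards [self_mem_nhdsWithin, nhdsWithin_le_nhds (hK.mem_nhds hE)] with E' h1 h2
    have h3 : E' - E ≠ 0 := sub_ne_zero.2 h1
    have h4 := hne E hE
    have h5 := hne E' h2
    have := green E' E
    rw [slope_def_field]
    field_simp
    linear_combination -this
  refine strictAntiOn_of_deriv_neg hKc.convex
    (fun E hE => (hd E hE).continuousAt.continuousWithinAt) fun E hE => ?_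
  rw [hK.interior_eq] at hE
  rw [(hd E hE).deriv]
  have hpos : 0 < ∫ x in (0 : ℝ)..h, w E x * w E x :=
    intervalIntegral.integral_pos hh ((hwr E).mul (hwr E)).continuousOn
      (fun x _ => mul_self_nonneg _) ⟨h, ⟨hh.le, le_rfl⟩, mul_self_pos.2 (hne E hE)⟩
  exact neg_neg_of_pos (div_pos hpos (mul_self_pos.2 (hne E hE)))

/-- Halve the interval. With `C`, `S` at `π/2`, the numerator is `C² - ES² + t(C² + ES²)` and the
denominator `2SC`. So the quotient is the convex combination, with weights `(1 + t)/2` and `(1 -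
t)/2`, of the logarithmic derivatives `C/S` of `S` and `-ES/C` of `C`. -/
theorem strictAntiOn_cosE_add_div_sinE {t : ℝ} (ht : |t| ≤ 1) {K : Set ℝ} (hK : IsOpen K)
    (hKc : K.OrdConnected) (hS : ∀ E ∈ K, sinE E Real.pi ≠ 0) :
    StrictAntiOn (fun E => (cosE E Real.pi + t) / sinE E Real.pi) K := by
  obtain ⟨t1, t2⟩ := abs_le.1 ht
  set h := Real.pi / 2 with hh
  have hpi : Real.pi = h + h := by rw [hh]; ring
  have hhpos : 0 < h := by positivity
  have hSh (E : ℝ) : sinE E Real.pi = 2 * sinE E h * cosE E h := by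
    rw [hpi, sinE_add]; ring
  have hne : ∀ E ∈ K, sinE E h ≠ 0 ∧ cosE E h ≠ 0 := fun E hE =>
    ⟨fun h0 => hS E hE (by rw [hSh, h0]; ring), fun h0 => hS E hE (by rw [hSh, h0]; ring)⟩
  have m1 : StrictAntiOn (fun E => cosE E h / sinE E h) K :=
    strictAntiOn_logDeriv continuous_sinE hasDerivAt_sinE hasDerivAt_cosE
      (fun _ _ => by simp) hhpos hK hKc fun E hE => (hne E hE).1
  have m2 : StrictAntiOn (fun E => -E * sinE E h / cosE E h) K :=
    strictAntiOn_logDeriv (p := fun E x => -E * sinE E x) continuous_cosE hasDerivAt_cosE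
      (fun E x => (hasDerivAt_sinE E x).const_mul (-E)) (fun _ _ => by simp) hhpos hK hKc
      fun E hE => (hne E hE).2
  have heq : ∀ E ∈ K, (cosE E Real.pi + t) / sinE E Real.pi =
      (1 + t) / 2 * (cosE E h / sinE E h) + (1 - t) / 2 * (-E * sinE E h / cosE E h) := by
    intro E hE
    obtain ⟨h1, h2⟩ := hne E hE
    have h3 := cosE_sq_add E h
    rw [hSh, hpi, cosE_add]
    field_simp
    linear_combination -t * h3
  intro E hE E' hE' hlt
  simp only [heq E hE, heq E' hE']
  have l1 := m1 hE hE' hlt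
  have l2 := m2 hE hE' hlt
  simp only at l1 l2
  rcases lt_or_ge 0 t with h0 | h0
  · have := mul_lt_mul_of_pos_left l1 (show 0 < (1 + t) / 2 by linarith)
    have := mul_le_mul_of_nonneg_left l2.le (show 0 ≤ (1 - t) / 2 by linarith)
    linarith
  · have := mul_le_mul_of_nonneg_left l1.le (show 0 ≤ (1 + t) / 2 by linarith)
    have := mul_lt_mul_of_pos_left l2 (show 0 < (1 - t) / 2 by linarith)
    linarith

/-- The intervals between consecutive points `n²`, `n ≥ 1`. -/
def cell (n : ℕ) : Set ℝ := {E | (1 ≤ n → (n : ℝ) ^ 2 < E) ∧ E < ((n : ℝ) + 1) ^ 2}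

theorem cell_zero : cell 0 = Iio 1 := by
  ext E; simp [cell]

theorem cell_of_one_le {n : ℕ} (hn : 1 ≤ n) : cell n = Ioo ((n : ℝ) ^ 2) (((n : ℝ) + 1) ^ 2) := by
  ext E; simp [cell, hn]

theorem isOpen_cell (n : ℕ) : IsOpen (cell n) := by
  rcases Nat.eq_zero_or_pos n with rfl | hn
  · rw [cell_zero]; exact isOpen_Iio
  · rw [cell_of_one_le hn]; exact isOpen_Ioo

theorem ordConnected_cell (n : ℕ) : (cell n).OrdConnected := by
  rcases Nat.eq_zero_or_pos n with rfl | hn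
  · rw [cell_zero]; exact ordConnected_Iio
  · rw [cell_of_one_le hn]; exact ordConnected_Ioo

theorem neg_one_pow_mul_sinE_pos_of_mem_cell {n : ℕ} {E : ℝ} (hE : E ∈ cell n) :
    0 < (-1) ^ n * sinE E Real.pi := by
  rcases Nat.eq_zero_or_pos n with rfl | hn
  · rw [cell_zero] at hE
    rw [pow_zero, one_mul]
    exact sinE_pi_pos_of_lt_one hE
  · exact neg_one_pow_mul_sinE_pos (hE.1 hn) hE.2

theorem neg_one_pow_mul_self (n : ℕ) : (-1 : ℝ) ^ n * (-1) ^ n = 1 := by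
  rw [← mul_pow]; simp

theorem xi_sq_nat (α : ℝ) {n : ℕ} (hn : 1 ≤ n) : xi α ((n : ℝ) ^ 2) = (-1) ^ n := by
  rw [xi, cosE_sq_nat, sinE_sq_nat hn, mul_zero, add_zero]

theorem xi_add_one_sq_nat (α : ℝ) (n : ℕ) :
    (-1) ^ n * xi α (((n : ℝ) + 1) ^ 2) = -1 := by
  have := xi_sq_nat α (n := n + 1) (by omega)
  push_cast at this
  rw [this, pow_succ]
  linear_combination -neg_one_pow_mul_self n

/-- On each cell, a level of the (signed) discriminant in `[-1, 1]` is crossed downwards. -/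
theorem xi_lt_iff {α t E E' : ℝ} {n : ℕ} (ht : |t| ≤ 1) (hE : E ∈ cell n) (hE' : E' ∈ cell n)
    (hx : (-1) ^ n * xi α E' = t) :
    (E < E' ↔ t < (-1) ^ n * xi α E) ∧ (E' < E ↔ (-1) ^ n * xi α E < t) := by
  set s : ℝ := (-1) ^ n with hs
  have hss : s * s = 1 := neg_one_pow_mul_self n
  have hst : |-(s * t)| ≤ 1 := by
    rw [abs_neg, abs_mul, hs, abs_neg_one_pow, one_mul]; exact ht
  have hpos {E : ℝ} (hE : E ∈ cell n) : 0 < s * sinE E Real.pi :=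
    neg_one_pow_mul_sinE_pos_of_mem_cell hE
  have hanti := strictAntiOn_cosE_add_div_sinE hst (isOpen_cell n) (ordConnected_cell n)
    fun E hE h0 => by simpa [h0] using hpos hE
  -- The first factor is positive and the second strictly decreasing, so the sign changes only once,
  -- although `s * xi α` itself need not be shown monotone.
  have hf {E : ℝ} (hE : E ∈ cell n) : s * xi α E - t =
      (s * sinE E Real.pi) * ((cosE E Real.pi + -(s * t)) / sinE E Real.pi + α / 4) := by
    have h0 : sinE E Real.pi ≠ 0 := fun h0 => by simpa [h0] using hpos hE
    rw [xi]
    field_simp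
    linear_combination 4 * t * hss
  have h0 : (cosE E' Real.pi + -(s * t)) / sinE E' Real.pi = -(α / 4) := by
    have h1 := hf hE'
    rw [hx, sub_self] at h1
    linarith [(mul_eq_zero.1 h1.symm).resolve_left (hpos hE').ne']
  have h1 := hanti.lt_iff_gt hE hE'
  have h2 := hanti.lt_iff_gt hE' hE
  simp only [h0] at h1 h2
  have h3 := hf hE
  have h4 := hpos hE
  constructor
  · rw [← h2, ← sub_pos (b := t), h3, mul_pos_iff_of_pos_left h4]
    constructor <;> intro <;> linarith
  · rw [← h1, ← sub_neg (b := t), h3]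
    refine ⟨fun h => mul_neg_of_pos_of_neg h4 (by linarith), fun h => ?_⟩
    linarith [neg_of_mul_neg_right h h4.le]

theorem exists_mem_cell_lt {n : ℕ} {f : ℝ → ℝ} (hf : Continuous f) {t : ℝ}
    (h : f (((n : ℝ) + 1) ^ 2) < t) : ∃ E ∈ cell n, f E < t := by
  have h1 : ∀ᶠ E in 𝓝[<] (((n : ℝ) + 1) ^ 2), f E < t :=
    nhdsWithin_le_nhds (hf.continuousAt.eventually_lt continuousAt_const h)
  have h2 : ∀ᶠ E in 𝓝[<] (((n : ℝ) + 1) ^ 2), E ∈ cell n := by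
    filter_upwards [self_mem_nhdsWithin, nhdsWithin_le_nhds (lt_mem_nhds (a := (n : ℝ) ^ 2)
      (by nlinarith [(Nat.cast_nonneg n : (0 : ℝ) ≤ n)]))] with E e1 e2
    exact ⟨fun _ => e2, e1⟩
  obtain ⟨E, h3, h4⟩ := (h2.and h1).exists
  exact ⟨E, h3, h4⟩

theorem exists_lt_mem_cell {n : ℕ} {f : ℝ → ℝ} (hf : Continuous f) {t : ℝ}
    (h : t < f ((n : ℝ) ^ 2)) : ∃ E ∈ cell n, t < f E := by
  have h1 : ∀ᶠ E in 𝓝[>] ((n : ℝ) ^ 2), t < f E :=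
    nhdsWithin_le_nhds (continuousAt_const.eventually_lt hf.continuousAt h)
  have h2 : ∀ᶠ E in 𝓝[>] ((n : ℝ) ^ 2), E ∈ cell n := by
    have hlt : (n : ℝ) ^ 2 < ((n : ℝ) + 1) ^ 2 := by
      nlinarith [(Nat.cast_nonneg n : (0 : ℝ) ≤ n)]
    filter_upwards [self_mem_nhdsWithin, nhdsWithin_le_nhds (Iio_mem_nhds hlt)] with E e1 e2
    exact ⟨fun _ => e1, e2⟩
  obtain ⟨E, h3, h4⟩ := (h2.and h1).exists
  exact ⟨E, h3, h4⟩

/-- The band in the `n`-th cell. -/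
theorem exists_band (α : ℝ) {c : ℝ} (hc0 : 0 ≤ c) (hc : c < 1) (n : ℕ) :
    ∃ a ∈ cell n, ∃ b ∈ cell n, a ≤ b ∧ (-1) ^ n * xi α a = c ∧ (-1) ^ n * xi α b = -c ∧
      ∀ E ∈ cell n, (E < a ↔ c < (-1) ^ n * xi α E) ∧ (b < E ↔ (-1) ^ n * xi α E < -c) := by
  have hcont : Continuous fun E => (-1) ^ n * xi α E := (continuous_xi α).const_mul _
  -- The signed discriminant is `-1 < -c` at the right end of the cell; at the left end it is `1 >
  -- c`, or large far to the left if `n = 0`.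
  obtain ⟨E₂, m₂, h₂⟩ := exists_mem_cell_lt (n := n) (t := -c) hcont
    (by rw [xi_add_one_sq_nat]; linarith)
  obtain ⟨E₁, m₁, h₁⟩ : ∃ E ∈ cell n, c < (-1) ^ n * xi α E := by
    rcases Nat.eq_zero_or_pos n with rfl | hn
    · obtain ⟨E₀, h0, H⟩ := exists_cosE_dominates (K := |α| / 4) (by positivity)
      refine ⟨E₀, by rw [cell_zero]; exact h0.trans one_pos, ?_⟩
      have hS := sinE_pi_pos_of_lt_one (E := E₀) (by linarith)
      have := mul_le_mul_of_nonneg_right (neg_abs_le α) hS.le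
      have := H E₀ le_rfl
      rw [pow_zero, one_mul, xi]
      linarith
    · exact exists_lt_mem_cell hcont (by rw [xi_sq_nat α hn, neg_one_pow_mul_self]; exact hc)
  have hivt := (ordConnected_cell n).isPreconnected.intermediate_value m₂ m₁ hcont.continuousOn
  obtain ⟨a, ha, hxa⟩ := hivt ⟨by linarith, h₁.le⟩
  obtain ⟨b, hb, hxb⟩ := hivt ⟨h₂.le, (by linarith : -c ≤ _)⟩
  simp only at hxa hxb
  have habs : |c| ≤ 1 := by rw [abs_of_nonneg hc0]; exact hc.le
  refine ⟨a, ha, b, hb, ?_, hxa, hxb, fun E hE => ⟨(xi_lt_iff habs hE ha hxa).1,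
    (xi_lt_iff (by rwa [abs_neg]) hE hb hxb).2⟩⟩
  by_contra! hlt
  have := (xi_lt_iff habs hb ha hxa).1.1 hlt
  linarith

end MagneticChain

end

section

open Set

/-! ### Numbering of the gaps of an increasing sequence of closed intervals -/

/-- The gaps between the intervals `[l m, r m]`. -/
def gapSet (l r : ℕ → ℝ) : ℕ → Set ℝ
  | 0 => Iio (l 0)
  | m + 1 => Ioo (r m) (l (m + 1))

theorem ordConnected_gapSet (l r : ℕ → ℝ) (m : ℕ) : (gapSet l r m).OrdConnected := by
  cases m
  · exact ordConnected_Iio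
  · exact ordConnected_Ioo

theorem isOpen_gapSet (l r : ℕ → ℝ) (m : ℕ) : IsOpen (gapSet l r m) := by
  cases m
  · exact isOpen_Iio
  · exact isOpen_Ioo

section

variable {l r : ℕ → ℝ}

theorem lt_of_mem_gapSet {m : ℕ} {x : ℝ} (hx : x ∈ gapSet l r m) : x < l m := by
  cases m
  · exact hx
  · exact hx.2

theorem strictMono_of_interlacing (hlr : ∀ m, l m ≤ r m) (hrl : ∀ m, r m < l (m + 1)) :
    StrictMono l := strictMono_nat_of_lt_succ fun m => (hlr m).trans_lt (hrl m)

theorem right_lt_of_mem_gapSet (hlr : ∀ m, l m ≤ r m) (hrl : ∀ m, r m < l (m + 1)) {i m : ℕ}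
    (him : i < m) {x : ℝ} (hx : x ∈ gapSet l r m) : r i < x := by
  obtain ⟨k, rfl⟩ : ∃ k, m = k + 1 := ⟨m - 1, by omega⟩
  rcases Nat.lt_or_eq_of_le (Nat.lt_succ_iff.1 him) with h | rfl
  · calc r i < l (i + 1) := hrl i
      _ ≤ l k := (strictMono_of_interlacing hlr hrl).monotone h
      _ ≤ r k := hlr k
      _ < x := hx.1
  · exact hx.1

theorem nonempty_gapSet (hrl : ∀ m, r m < l (m + 1)) (m : ℕ) : (gapSet l r m).Nonempty := by
  cases m
  · exact nonempty_Iio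
  · exact nonempty_Ioo.2 (hrl _)

theorem disjoint_gapSet (hlr : ∀ m, l m ≤ r m) (hrl : ∀ m, r m < l (m + 1)) (m : ℕ) :
    Disjoint (gapSet l r m) (⋃ k, Icc (l k) (r k)) := by
  refine disjoint_left.2 fun x hx h => ?_
  obtain ⟨k, hk⟩ := mem_iUnion.1 h
  rcases lt_or_ge k m with h | h
  · exact absurd hk.2 (not_le.2 (right_lt_of_mem_gapSet hlr hrl h hx))
  · exact absurd hk.1 (not_le.2 ((lt_of_mem_gapSet hx).trans_le
      ((strictMono_of_interlacing hlr hrl).monotone h)))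

theorem exists_mem_gapSet (hl : ∀ x, ∃ m, x < l m) {x : ℝ} (hx : x ∉ ⋃ k, Icc (l k) (r k)) :
    ∃ m, x ∈ gapSet l r m := by
  classical
  refine ⟨Nat.find (hl x), ?_⟩
  rcases h : Nat.find (hl x) with _ | m
  · have := Nat.find_spec (hl x)
    rwa [h] at this
  · have h1 := Nat.find_spec (hl x)
    have h2 := Nat.find_min (hl x) (m := m) (by omega)
    rw [h] at h1
    refine ⟨?_, h1⟩
    by_contra! h3
    exact hx (mem_iUnion.2 ⟨m, not_lt.1 h2, h3⟩)

/-- A component is order connected, while between a gap with index `k` and any later one lies the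
point `l k` of the set. -/
theorem connectedComponentIn_eq_gapSet (hlr : ∀ m, l m ≤ r m) (hrl : ∀ m, r m < l (m + 1))
    (hl : ∀ x, ∃ m, x < l m) {m : ℕ} {x : ℝ} (hx : x ∈ gapSet l r m) :
    connectedComponentIn (⋃ k, Icc (l k) (r k))ᶜ x = gapSet l r m := by
  set S := ⋃ k, Icc (l k) (r k) with hS
  have hmem (k : ℕ) : l k ∈ S := mem_iUnion.2 ⟨k, le_rfl, hlr k⟩
  have hsub : gapSet l r m ⊆ Sᶜ := fun y hy => disjoint_left.1 (disjoint_gapSet hlr hrl m) hy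
  refine Subset.antisymm (fun y hy => ?_)
    ((ordConnected_gapSet l r m).isPreconnected.subset_connectedComponentIn hx hsub)
  have hoc := (isPreconnected_connectedComponentIn (x := x) (F := Sᶜ)).ordConnected
  have hxc := mem_connectedComponentIn (hsub hx)
  have hcS := connectedComponentIn_subset Sᶜ x
  obtain ⟨k, hk⟩ := exists_mem_gapSet hl (hcS hy)
  rcases lt_trichotomy k m with h | rfl | h
  · exact absurd (hmem k) (hcS (hoc.out hy hxc ⟨(lt_of_mem_gapSet hk).le,
      (hlr k).trans (right_lt_of_mem_gapSet hlr hrl h hx).le⟩))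
  · exact hk
  · exact absurd (hmem m) (hcS (hoc.out hxc hy ⟨(lt_of_mem_gapSet hx).le,
      (hlr m).trans (right_lt_of_mem_gapSet hlr hrl h hk).le⟩))

/-- The `n`-th gap is the `n`-th of the intervals between `[l m, r m]`. -/
theorem IsNthGap.eq_gapSet (hlr : ∀ m, l m ≤ r m) (hrl : ∀ m, r m < l (m + 1))
    (hl : ∀ x, ∃ m, x < l m) {n : ℕ} {I : Set ℝ} (h : IsNthGap (⋃ k, Icc (l k) (r k)) n I) :
    ∃ m, n = m + 1 ∧ I = gapSet l r m := by
  have hgap (J : Set ℝ) : IsGap (⋃ k, Icc (l k) (r k)) J ↔ ∃ m, J = gapSet l r m := by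
    constructor
    · rintro ⟨x, hx, rfl⟩
      obtain ⟨m, hm⟩ := exists_mem_gapSet hl hx
      exact ⟨m, connectedComponentIn_eq_gapSet hlr hrl hl hm⟩
    · rintro ⟨m, rfl⟩
      obtain ⟨x, hx⟩ := nonempty_gapSet hrl m
      exact ⟨x, disjoint_left.1 (disjoint_gapSet hlr hrl m) hx,
        (connectedComponentIn_eq_gapSet hlr hrl hl hx).symm⟩
  obtain ⟨h1, h2⟩ := h
  obtain ⟨m, rfl⟩ := (hgap I).1 h1
  refine ⟨m, ?_, rfl⟩
  have hlt {i j : ℕ} (hij : i < j) : ∀ x ∈ gapSet l r i, ∀ y ∈ gapSet l r j, x < y :=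
    fun x hx y hy => (lt_of_mem_gapSet hx).trans_le
      ((hlr i).trans (right_lt_of_mem_gapSet hlr hrl hij hy).le)
  -- Exactly the gaps with index below `m` lie to the left, hence the shift between the index `m`
  -- and the number `m + 1`.
  have hset : {J | IsGap (⋃ k, Icc (l k) (r k)) J ∧ ∀ x ∈ J, ∀ y ∈ gapSet l r m, x < y} =
      gapSet l r '' Iio m := by
    ext J
    constructor
    · rintro ⟨hJ, hJm⟩
      obtain ⟨i, rfl⟩ := (hgap J).1 hJ
      refine ⟨i, ?_, rfl⟩
      by_contra hi
      obtain ⟨x, hx⟩ := nonempty_gapSet (r := r) hrl i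
      obtain ⟨y, hy⟩ := nonempty_gapSet (r := r) hrl m
      rcases Nat.lt_or_eq_of_le (not_lt.1 hi) with h | rfl
      · exact lt_asymm (hlt h y hy x hx) (hJm x hx y hy)
      · exact lt_irrefl x (hJm x hx x hx)
    · rintro ⟨i, hi, rfl⟩
      exact ⟨(hgap _).2 ⟨i, rfl⟩, hlt hi⟩
  have hinj : Function.Injective (gapSet l r) := by
    intro i j he
    obtain ⟨x, hx⟩ := nonempty_gapSet (r := r) hrl i
    by_contra hne
    rcases lt_or_gt_of_ne hne with h | h
    · exact lt_irrefl x (hlt h x hx x (he ▸ hx))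
    · exact lt_irrefl x (hlt h x (he ▸ hx) x hx)
  rw [hset, hinj.encard_image, ← Finset.coe_Iio, encard_coe_eq_coe_finsetCard, Nat.card_Iio] at h2
  exact_mod_cast h2.symm

end

end

section

open Set

namespace MagneticChain

/-! ### The bands -/

/-- Left ends of the bands and the points `(k + 1)²`, in increasing order. -/
noncomputable def bandLeft (a : ℕ → ℝ) (m : ℕ) : ℝ :=
  if Even m then a (m / 2) else (((m / 2 : ℕ) : ℝ) + 1) ^ 2

theorem bandLeft_even (a : ℕ → ℝ) (k : ℕ) : bandLeft a (2 * k) = a k := by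
  rw [bandLeft, if_pos (even_two_mul k), Nat.mul_div_cancel_left k two_pos]

theorem bandLeft_odd (a : ℕ → ℝ) (k : ℕ) : bandLeft a (2 * k + 1) = ((k : ℝ) + 1) ^ 2 := by
  rw [bandLeft, if_neg (by simp), show (2 * k + 1) / 2 = k by omega]

theorem exists_mem_cell {E : ℝ} (h : ∀ n : ℕ, 1 ≤ n → E ≠ (n : ℝ) ^ 2) : ∃ n, E ∈ cell n := by
  rcases lt_or_ge E 1 with h1 | h1
  · exact ⟨0, by rwa [cell_zero]⟩
  · obtain ⟨n, hn, h2, h3⟩ := exists_nat_sq_le h1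
    exact ⟨n, fun _ => lt_of_le_of_ne h2 (h n hn).symm, h3⟩

/-- The band edges `a n ≤ b n` in the cells. -/
structure IsBandEdges (A α : ℝ) (a b : ℕ → ℝ) : Prop where
  left_mem : ∀ n, a n ∈ cell n
  right_mem : ∀ n, b n ∈ cell n
  le : ∀ n, a n ≤ b n
  left_eq : ∀ n, (-1) ^ n * xi α (a n) = |Real.cos (A * Real.pi)|
  right_eq : ∀ n, (-1) ^ n * xi α (b n) = -|Real.cos (A * Real.pi)|
  lt_left_iff : ∀ n, ∀ E ∈ cell n, E < a n ↔ |Real.cos (A * Real.pi)| < (-1) ^ n * xi α E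
  right_lt_iff : ∀ n, ∀ E ∈ cell n, b n < E ↔ (-1) ^ n * xi α E < -|Real.cos (A * Real.pi)|

theorem exists_isBandEdges {A : ℝ} (hA : |Real.cos (A * Real.pi)| < 1) (α : ℝ) :
    ∃ a b, IsBandEdges A α a b := by
  choose a ha b hb h1 h2 h3 h4 using exists_band α (abs_nonneg _) hA
  exact ⟨a, b, ha, hb, h1, h2, h3, fun n E hE => (h4 n E hE).1, fun n E hE => (h4 n E hE).2⟩

namespace IsBandEdges

variable {A α : ℝ} {a b : ℕ → ℝ}

/-- `bandLeft b` serves as the sequence of right ends: even indices are the bands `[a k, b k]`, and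
odd indices the degenerate intervals `{(k + 1)²}`. -/
theorem bandLeft_le (h : IsBandEdges A α a b) (m : ℕ) : bandLeft a m ≤ bandLeft b m := by
  obtain ⟨k, rfl | rfl⟩ := Nat.even_or_odd' m
  · rw [bandLeft_even, bandLeft_even]; exact h.le k
  · rw [bandLeft_odd, bandLeft_odd]

theorem bandLeft_lt (h : IsBandEdges A α a b) (m : ℕ) : bandLeft b m < bandLeft a (m + 1) := by
  obtain ⟨k, rfl | rfl⟩ := Nat.even_or_odd' m
  · rw [bandLeft_even, bandLeft_odd]; exact (h.right_mem k).2
  · rw [bandLeft_odd, show 2 * k + 1 + 1 = 2 * (k + 1) by ring, bandLeft_even]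
    have := (h.left_mem (k + 1)).1 (by omega)
    exact_mod_cast this

theorem mem_essSet_iff (h : IsBandEdges A α a b) {n : ℕ} {E : ℝ} (hE : E ∈ cell n) :
    |xi α E| ≤ |Real.cos (A * Real.pi)| ↔ E ∈ Icc (a n) (b n) := by
  have hs : |(-1 : ℝ) ^ n * xi α E| = |xi α E| := by rw [abs_mul, abs_neg_one_pow, one_mul]
  rw [← hs, abs_le, mem_Icc, ← not_lt, ← not_lt, ← h.right_lt_iff n E hE, ← h.lt_left_iff n E hE,
    not_lt, not_lt, and_comm]

theorem essSet_eq (h : IsBandEdges A α a b) :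
    essSet A α = ⋃ m, Icc (bandLeft a m) (bandLeft b m) := by
  ext E
  rw [mem_iUnion]
  constructor
  · intro hE
    by_cases hsq : ∃ n : ℕ, 1 ≤ n ∧ E = (n : ℝ) ^ 2
    · obtain ⟨n, hn, rfl⟩ := hsq
      obtain ⟨k, rfl⟩ : ∃ k, n = k + 1 := ⟨n - 1, by omega⟩
      refine ⟨2 * k + 1, ?_⟩
      rw [bandLeft_odd, bandLeft_odd]
      push_cast
      exact ⟨le_rfl, le_rfl⟩
    · obtain ⟨n, hn⟩ := exists_mem_cell (E := E) fun n hn he => hsq ⟨n, hn, he⟩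
      refine ⟨2 * n, ?_⟩
      rw [bandLeft_even, bandLeft_even]
      exact (h.mem_essSet_iff hn).1 (hE.resolve_right hsq)
  · rintro ⟨m, hm⟩
    obtain ⟨k, rfl | rfl⟩ := Nat.even_or_odd' m
    · rw [bandLeft_even, bandLeft_even] at hm
      exact Or.inl ((h.mem_essSet_iff
        ((ordConnected_cell k).out (h.left_mem k) (h.right_mem k) hm)).2 hm)
    · rw [bandLeft_odd, bandLeft_odd] at hm
      exact Or.inr ⟨k + 1, by omega, by push_cast; exact le_antisymm hm.2 hm.1⟩

theorem eq_gapSet (h : IsBandEdges A α a b) {n : ℕ} {I : Set ℝ} (hI : IsNthGap (essSet A α) n I) :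
    ∃ m, n = m + 1 ∧ I = gapSet (bandLeft a) (bandLeft b) m := by
  rw [h.essSet_eq] at hI
  refine IsNthGap.eq_gapSet h.bandLeft_le h.bandLeft_lt (fun x => ?_) hI
  obtain ⟨k, hk⟩ := exists_nat_gt x
  refine ⟨2 * k + 1, ?_⟩
  rw [bandLeft_odd]
  nlinarith [(Nat.cast_nonneg k : (0 : ℝ) ≤ k)]

end IsBandEdges

/-! ### Eigenvalues in the gaps -/

/-- The normalized decay factor of the half-line solutions in the gaps where `s ξ > |c|`. -/
noncomputable def decay (s c α E : ℝ) : ℝ := s * xi α E + √((s * xi α E) ^ 2 - c ^ 2)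

/-- The secular function of two impurities. -/
noncomputable def secular (s c α γ₁ γ₂ E : ℝ) : ℝ :=
  decay s c α E + (γ₁ + γ₂) / 4 * (s * sinE E Real.pi) -
    √(((γ₁ - γ₂) / 4 * (s * sinE E Real.pi)) ^ 2 + c ^ 2)

theorem continuous_secular (s c α γ₁ γ₂ : ℝ) : Continuous (secular s c α γ₁ γ₂) := by
  have h1 := continuous_xi α
  have h2 := continuous_sinE_left Real.pi
  unfold secular decay
  fun_prop

/-- At a band edge `decay` equals `|c|`, which the square root in `secular` is at least. -/
theorem secular_neg {s c α γ₁ γ₂ E : ℝ} (h1 : s * xi α E = |c|)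
    (h2 : (γ₁ + γ₂) * (s * sinE E Real.pi) < 0) : secular s c α γ₁ γ₂ E < 0 := by
  have h3 : |c| ≤ √(((γ₁ - γ₂) / 4 * (s * sinE E Real.pi)) ^ 2 + c ^ 2) :=
    Real.abs_le_sqrt (by nlinarith [sq_nonneg ((γ₁ - γ₂) / 4 * (s * sinE E Real.pi))])
  rw [secular, decay, h1, sq_abs, sub_self, Real.sqrt_zero]
  linarith

/-- At `n²` the impurities drop out and `1 + √(1 - c²) - |c|` remains. -/
theorem secular_pos_of_sinE_eq_zero {s c α γ₁ γ₂ E : ℝ} (hc : |c| < 1) (h1 : s * xi α E = 1)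
    (h2 : sinE E Real.pi = 0) : 0 < secular s c α γ₁ γ₂ E := by
  rw [secular, decay, h1, h2]
  have h3 : √(((γ₁ - γ₂) / 4 * (s * 0)) ^ 2 + c ^ 2) = |c| := by
    rw [← Real.sqrt_sq_eq_abs]; congr 1; ring
  rw [h3]
  have := Real.sqrt_nonneg (1 ^ 2 - c ^ 2)
  simp only [mul_zero]
  linarith

theorem exists_secular_pos {c : ℝ} (hc : |c| < 1) (α γ₁ γ₂ : ℝ) :
    ∃ E₀ : ℝ, ∀ E ≤ E₀, 0 < secular 1 c α γ₁ γ₂ E := by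
  -- The constant `K` collects all coefficients of `S`, so that the secular function is at least `C
  -- - KS - |c|`. This replaces the missing left end of the first gap.
  obtain ⟨E₀, h0, H⟩ := exists_cosE_dominates
    (K := |α| / 4 + |γ₁ + γ₂| / 4 + |γ₁ - γ₂| / 4) (by positivity)
  refine ⟨E₀, fun E hE => ?_⟩
  have h1 := H E hE
  have hS := (sinE_pi_pos_of_lt_one (E := E) (by linarith)).le
  have h2 := mul_le_mul_of_nonneg_right (neg_abs_le α) hS
  have h3 := mul_le_mul_of_nonneg_right (neg_abs_le (γ₁ + γ₂)) hS
  have h4 : √(((γ₁ - γ₂) / 4 * (1 * sinE E Real.pi)) ^ 2 + c ^ 2) ≤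
      |γ₁ - γ₂| / 4 * sinE E Real.pi + |c| := by
    refine Real.sqrt_le_iff.2 ⟨by positivity, ?_⟩
    have h5 : 0 ≤ |γ₁ - γ₂| / 4 * sinE E Real.pi * |c| := by positivity
    have h6 := sq_abs (γ₁ - γ₂)
    have h7 := sq_abs c
    linear_combination (exp := 1) 2 * h5 - sinE E Real.pi ^ 2 / 16 * h6 - h7
  have h5 := Real.sqrt_nonneg ((1 * xi α E) ^ 2 - c ^ 2)
  rw [secular, decay]
  have h6 : xi α E = cosE E Real.pi + α / 4 * sinE E Real.pi := rfl
  linarith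

/-- The secular function vanishes in every gap in which the total perturbation is attractive. -/
theorem IsBandEdges.exists_secular_eq_zero_even {A α : ℝ} {a b : ℕ → ℝ}
    (h : IsBandEdges A α a b) (hA : |Real.cos (A * Real.pi)| < 1) {γ₁ γ₂ : ℝ} (hγ : γ₁ + γ₂ < 0)
    (k : ℕ) : ∃ E ∈ gapSet (bandLeft a) (bandLeft b) (2 * k), E ∈ cell k ∧ E < a k ∧
      secular ((-1) ^ k) (Real.cos (A * Real.pi)) α γ₁ γ₂ E = 0 := by
  have hneg : secular ((-1) ^ k) (Real.cos (A * Real.pi)) α γ₁ γ₂ (a k) < 0 :=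
    secular_neg (h.left_eq k) (mul_neg_of_neg_of_pos hγ
      (neg_one_pow_mul_sinE_pos_of_mem_cell (h.left_mem k)))
  have ivt {e : ℝ} (he : e ≤ a k)
      (hpos : 0 < secular ((-1) ^ k) (Real.cos (A * Real.pi)) α γ₁ γ₂ e) :
      ∃ E ∈ Ioo e (a k), secular ((-1) ^ k) (Real.cos (A * Real.pi)) α γ₁ γ₂ E = 0 :=
    intermediate_value_Ioo' he (continuous_secular _ _ _ _ _).continuousOn ⟨hneg, hpos⟩
  rcases Nat.eq_zero_or_pos k with rfl | hk
  · obtain ⟨E₀, H⟩ := exists_secular_pos hA α γ₁ γ₂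
    obtain ⟨E, hE, h0⟩ := ivt (min_le_right E₀ (a 0)) (by
      rw [pow_zero]
      exact H _ (min_le_left _ _))
    refine ⟨E, ?_, ?_, hE.2, h0⟩
    · change E < bandLeft a (2 * 0)
      rw [bandLeft_even]; exact hE.2
    · rw [cell_zero]
      have := h.left_mem 0
      rw [cell_zero] at this
      exact hE.2.trans this
  · obtain ⟨i, rfl⟩ : ∃ i, k = i + 1 := ⟨k - 1, by omega⟩
    have hm := h.left_mem (i + 1)
    obtain ⟨E, hE, h0⟩ := ivt (hm.1 hk).le (secular_pos_of_sinE_eq_zero hA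
      (by rw [xi_sq_nat α hk, neg_one_pow_mul_self]) (sinE_sq_nat hk))
    refine ⟨E, ?_, ⟨fun _ => hE.1, hE.2.trans hm.2⟩, hE.2, h0⟩
    change bandLeft b (2 * i + 1) < E ∧ E < bandLeft a (2 * (i + 1))
    rw [bandLeft_odd, bandLeft_even]
    exact_mod_cast hE

/-- To the right of the band the sign `s = -(-1)^k` restores `sξ > |c|` but makes `sS` negative, so
now a positive `γ₁ + γ₂` pushes the secular function below zero at the band edge. -/
theorem IsBandEdges.exists_secular_eq_zero_odd {A α : ℝ} {a b : ℕ → ℝ}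
    (h : IsBandEdges A α a b) (hA : |Real.cos (A * Real.pi)| < 1) {γ₁ γ₂ : ℝ} (hγ : 0 < γ₁ + γ₂)
    (k : ℕ) : ∃ E ∈ gapSet (bandLeft a) (bandLeft b) (2 * k + 1), E ∈ cell k ∧ b k < E ∧
      secular (-(-1) ^ k) (Real.cos (A * Real.pi)) α γ₁ γ₂ E = 0 := by
  have hm := h.right_mem k
  have hneg : secular (-(-1) ^ k) (Real.cos (A * Real.pi)) α γ₁ γ₂ (b k) < 0 := by
    refine secular_neg (by rw [neg_mul, h.right_eq k, neg_neg]) ?_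
    have := mul_pos hγ (neg_one_pow_mul_sinE_pos_of_mem_cell hm)
    linarith
  have hpos : 0 < secular (-(-1) ^ k) (Real.cos (A * Real.pi)) α γ₁ γ₂ (((k : ℝ) + 1) ^ 2) := by
    refine secular_pos_of_sinE_eq_zero hA (by rw [neg_mul, xi_add_one_sq_nat, neg_neg]) ?_
    have := sinE_sq_nat (n := k + 1) (by omega)
    exact_mod_cast this
  obtain ⟨E, hE, h0⟩ := intermediate_value_Ioo hm.2.le
    (continuous_secular _ _ _ _ _).continuousOn ⟨hneg, hpos⟩
  refine ⟨E, ?_, ⟨fun hk => (hm.1 hk).trans hE.1, hE.2⟩, hE.1, h0⟩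
  · change bandLeft b (2 * k) < E ∧ E < bandLeft a (2 * k + 1)
    rw [bandLeft_odd, bandLeft_even]
    exact hE

end MagneticChain

end

/-! ### Eigenfunctions from zeros of the secular function, and the theorem. -/

section

open Set UnboundedOperator

namespace MagneticChain

/-- A sequence decaying geometrically away from the vertices `1` and `2`. -/
noncomputable def bump (q y₁ y₂ : ℂ) (j : ℤ) : ℂ :=
  if 2 ≤ j then q ^ (j - 2).toNat * y₂ else q ^ (1 - j).toNat * y₁

theorem bump_right (q y₁ y₂ : ℂ) (k : ℕ) : bump q y₁ y₂ (k + 2) = q ^ k * y₂ := by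
  rw [bump, if_pos (by omega)]
  simp

theorem bump_left (q y₁ y₂ : ℂ) (k : ℕ) : bump q y₁ y₂ (1 - k) = q ^ k * y₁ := by
  rw [bump, if_neg (by omega)]
  simp

theorem memℓp_bump {q : ℂ} (hq : ‖q‖ < 1) (y₁ y₂ : ℂ) :
    Memℓp (E := fun _ : ℤ => ℂ) (bump q y₁ y₂) 2 := by
  refine memℓp_gen ?_
  simp only [ENNReal.toReal_ofNat, Real.rpow_ofNat]
  have hgeo : Summable fun k : ℕ => (‖q‖ ^ 2) ^ k :=
    summable_geometric_of_lt_one (by positivity) (pow_lt_one₀ (norm_nonneg q) hq two_ne_zero)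
  refine Summable.of_nat_of_neg ?_ ?_
  · rw [← summable_nat_add_iff 2]
    refine (hgeo.mul_right (‖y₂‖ ^ 2)).congr fun k => ?_
    push_cast
    rw [bump_right, norm_mul, norm_pow, mul_pow]
    ring
  · rw [← summable_nat_add_iff 0]
    refine (hgeo.mul_right (‖q‖ ^ 2 * ‖y₁‖ ^ 2)).congr fun k => ?_
    have : (-((k + 0 : ℕ) : ℤ)) = 1 - ((k + 1 : ℕ) : ℤ) := by push_cast; ring
    rw [this, bump_left, norm_mul, norm_pow, mul_pow]
    ring

/-- The symmetric matrix with diagonal `p₁, p₂` and off-diagonal `-d` is singular; `(d, p₁)` spans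
its kernel unless it vanishes. -/
theorem exists_kernel_vector (p₁ p₂ d : ℝ) (h : p₁ * p₂ = d ^ 2) :
    ∃ y₁ y₂ : ℝ, (y₁ ≠ 0 ∨ y₂ ≠ 0) ∧ p₁ * y₁ = d * y₂ ∧ p₂ * y₂ = d * y₁ := by
  by_cases h0 : d ≠ 0 ∨ p₁ ≠ 0
  · exact ⟨d, p₁, h0, mul_comm _ _, by linarith⟩
  · push Not at h0
    exact ⟨1, 0, Or.inl one_ne_zero, by rw [h0.1, h0.2]; ring, by rw [h0.1]; ring⟩

/-- A zero of the secular function is an eigenvalue. -/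
theorem eigenspace_ne_bot_of_secular_eq_zero {A α γ₁ γ₂ s E : ℝ} (hs : s * s = 1)
    (hS : sinE E Real.pi ≠ 0) (hE : |Real.cos (A * Real.pi)| < s * xi α E)
    (h0 : secular s (Real.cos (A * Real.pi)) α γ₁ γ₂ E = 0) :
    eigenspace (hamiltonian A (twoImpurities α γ₁ γ₂)) (E : ℂ) ≠ ⊥ := by
  set c := Real.cos (A * Real.pi) with hc
  set X := s * xi α E with hX
  set T := s * sinE E Real.pi with hT
  set μ := decay s c α E with hμ
  have hcX : c ^ 2 < X ^ 2 := by
    rw [← sq_abs c]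
    exact pow_lt_pow_left₀ hE (abs_nonneg c) two_ne_zero
  have hsq := Real.sq_sqrt (sub_nonneg.2 hcX.le)
  have hμX : μ = X + √(X ^ 2 - c ^ 2) := rfl
  have hμlt : |c| < μ := by
    have := Real.sqrt_nonneg (X ^ 2 - c ^ 2)
    linarith
  have hμ0 : 0 < μ := (abs_nonneg c).trans_lt hμlt
  -- `μ` is the larger root of this quadratic equation.
  have hquad : μ ^ 2 + c ^ 2 = 2 * X * μ := by
    rw [hμX]; linear_combination hsq
  -- The root of `c(q² + 1) = 2ξq` inside the unit disc, written without dividing by `c`. For `c =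
  -- 0` it is `0`, and as `0 ^ 0 = 1` the sequence below then lives on the vertices `1` and `2`.
  set q := s * c / μ with hq
  have hqμ : q * μ = s * c := div_mul_cancel₀ _ hμ0.ne'
  have habs : |s| = 1 := by
    have := abs_mul s s
    rw [hs, abs_one] at this
    nlinarith [abs_nonneg s]
  have hq1 : |q| < 1 := by
    rw [hq, abs_div, abs_mul, habs, one_mul, abs_of_pos hμ0, div_lt_one hμ0]
    exact hμlt
  -- Squaring `secular = 0` gives the vanishing determinant of the matching conditions.
  have hdet : (μ + γ₁ / 2 * T) * (μ + γ₂ / 2 * T) = (s * c) ^ 2 := by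
    have h1 : μ + (γ₁ + γ₂) / 4 * T = √(((γ₁ - γ₂) / 4 * T) ^ 2 + c ^ 2) := sub_eq_zero.1 h0
    have h2 := Real.sq_sqrt (show 0 ≤ ((γ₁ - γ₂) / 4 * T) ^ 2 + c ^ 2 by positivity)
    rw [← h1] at h2
    linear_combination h2 - c ^ 2 * hs
  obtain ⟨y₁, y₂, hy, e1, e2⟩ := exists_kernel_vector _ _ _ hdet
  have hrec : 4 * xi α E * q = 2 * c * (q ^ 2 + 1) := by
    have : μ * μ * (4 * xi α E * q - 2 * c * (q ^ 2 + 1)) = 0 := by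
      have e3 : xi α E = s * X := by rw [hX, ← mul_assoc, hs, one_mul]
      rw [e3]
      linear_combination (4 * s * X * μ - 2 * c * (q * μ + s * c)) * hqμ - 2 * c * hquad +
        (4 * X * μ * c - 2 * c ^ 3) * hs
    linarith [(mul_eq_zero.1 this).resolve_left (mul_pos hμ0 hμ0).ne']
  -- What the diagonal coefficient at an impurity becomes once the adjacent decaying tail is
  -- eliminated. With it, the equations at `1` and `2` turn into `e1` and `e2`.
  have hedge : 4 * xi α E - 2 * c * q = 2 * s * μ := by
    have : μ * (4 * xi α E - 2 * c * q - 2 * s * μ) = 0 := by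
      have e3 : xi α E = s * X := by rw [hX, ← mul_assoc, hs, one_mul]
      rw [e3]
      linear_combination -2 * s * hquad - 2 * c * hqμ
    linarith [(mul_eq_zero.1 this).resolve_left hμ0.ne']
  have hcoef (γ : ℝ) : 4 * cosE E Real.pi + (α + γ) * sinE E Real.pi =
      4 * xi α E + γ * sinE E Real.pi := by rw [xi]; ring
  have hST : sinE E Real.pi = s * T := by rw [hT, ← mul_assoc, hs, one_mul]
  set y : ℤ → ℂ := bump q y₁ y₂ with hydef
  have hR (k : ℕ) : y (k + 2) = (q : ℂ) ^ k * y₂ := bump_right _ _ _ k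
  have hL (k : ℕ) : y (1 - k) = (q : ℂ) ^ k * y₁ := bump_left _ _ _ k
  have hjac (j : ℤ) : jacobi A (twoImpurities α γ₁ γ₂) E y j = 0 := by
    have hrec' : (4 * xi α E * q : ℂ) = 2 * c * (q ^ 2 + 1) := by exact_mod_cast hrec
    rw [jacobi, ← hc]
    by_cases j1 : j = 1
    · have v2 := hR 0
      have v1 := hL 0
      have v0 := hL 1
      norm_num at v2 v1 v0
      have hb : twoImpurities α γ₁ γ₂ 1 = α + γ₁ := by simp [twoImpurities]
      rw [j1, hb, hcoef, one_add_one_eq_two, sub_self, v2, v1, v0]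
      have : 2 * c * (y₂ + q * y₁) - (4 * xi α E + γ₁ * sinE E Real.pi) * y₁ = 0 := by
        rw [hST]
        linear_combination -y₁ * hedge - 2 * s * e1 - 2 * c * y₂ * hs
      exact_mod_cast this
    by_cases j2 : j = 2
    · have v2 := hR 0
      have v1 := hL 0
      have v3 := hR 1
      norm_num at v2 v1 v3
      have hb : twoImpurities α γ₁ γ₂ 2 = α + γ₂ := by simp [twoImpurities]
      rw [j2, hb, hcoef, show (2 : ℤ) + 1 = 3 by norm_num, show (2 : ℤ) - 1 = 1 by norm_num, v2,
        v1, v3]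
      have : 2 * c * (q * y₂ + y₁) - (4 * xi α E + γ₂ * sinE E Real.pi) * y₂ = 0 := by
        rw [hST]
        linear_combination -y₂ * hedge - 2 * s * e2 - 2 * c * y₁ * hs
      exact_mod_cast this
    have hb := hcoef 0
    rw [add_zero, zero_mul, add_zero] at hb
    rw [twoImpurities_of_ne j1 j2, hb]
    push_cast
    rcases lt_or_ge 2 j with h | h
    · obtain ⟨k, rfl⟩ : ∃ k : ℕ, j = k + 3 := ⟨(j - 3).toNat, by omega⟩
      rw [show (k : ℤ) + 3 + 1 = ((k + 2 : ℕ) : ℤ) + 2 by push_cast; ring,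
        show (k : ℤ) + 3 - 1 = ((k : ℕ) : ℤ) + 2 by ring,
        show (k : ℤ) + 3 = ((k + 1 : ℕ) : ℤ) + 2 by push_cast; ring, hR, hR, hR]
      linear_combination -(q : ℂ) ^ k * y₂ * hrec'
    · obtain ⟨k, rfl⟩ : ∃ k : ℕ, j = -k := ⟨(-j).toNat, by omega⟩
      rw [show -(k : ℤ) + 1 = 1 - (k : ℕ) by ring,
        show -(k : ℤ) - 1 = 1 - ((k + 2 : ℕ) : ℤ) by push_cast; ring,
        show -(k : ℤ) = 1 - ((k + 1 : ℕ) : ℤ) by push_cast; ring, hL, hL, hL]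
      linear_combination -(q : ℂ) ^ k * y₁ * hrec'
  obtain ⟨f, u, v, g, H, hu⟩ := exists_isAction_of_jacobi (A := A) hS (y := y)
    (memℓp_bump (by rwa [Complex.norm_real]) _ _) 0
    fun j => by rw [hjac, source_zero, neg_zero]
  rw [add_zero] at H
  refine (Submodule.ne_bot_iff _).2 ⟨f, mem_eigenspace_hamiltonian_iff.2 ⟨u, v, g, H⟩, ?_⟩
  rintro rfl
  have h1 := H.vertex_eq_zero (1, true)
  have h2 := H.vertex_eq_zero (2, true)
  have v1 := hL 0
  have v2 := hR 0
  norm_num at v1 v2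
  rw [hu, v1] at h1
  rw [hu, v2] at h2
  rcases hy with hy | hy
  · exact hy (by exact_mod_cast h1)
  · exact hy (by exact_mod_cast h2)

theorem hasOneOrTwoEigenvaluesIn {A α γ₁ γ₂ : ℝ} {I : Set ℝ} (hI : IsOpen I)
    (hIc : I.OrdConnected) (hd : Disjoint I (essSet A α)) {E : ℝ} (hE : E ∈ I)
    (h : eigenspace (hamiltonian A (twoImpurities α γ₁ γ₂)) (E : ℂ) ≠ ⊥) :
    HasOneOrTwoEigenvaluesIn (hamiltonian A (twoImpurities α γ₁ γ₂)) I :=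
  ⟨one_le_encard_iff_nonempty.2 ⟨E, hE, h⟩, encard_eigenvaluesIn_le A α γ₁ γ₂ hI hIc hd,
    rank_eigenfunctionsIn_le A α γ₁ γ₂ hI hIc hd⟩

theorem abs_cos_mul_pi_lt_one {A : ℝ} (hA : ∀ n : ℤ, A ≠ n) : |Real.cos (A * Real.pi)| < 1 := by
  refine lt_of_le_of_ne (Real.abs_cos_le_one _) fun h => ?_
  have h1 : Real.sin (A * Real.pi) = 0 := by
    have h2 := Real.sin_sq_add_cos_sq (A * Real.pi)
    rw [← sq_abs (Real.cos _), h] at h2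
    nlinarith
  obtain ⟨n, hn⟩ := Real.sin_eq_zero_iff.1 h1
  exact hA n (mul_right_cancel₀ Real.pi_ne_zero hn).symm

namespace IsBandEdges

variable {A α γ₁ γ₂ : ℝ} {a b : ℕ → ℝ}

theorem disjoint_gapSet (h : IsBandEdges A α a b) (m : ℕ) :
    Disjoint (gapSet (bandLeft a) (bandLeft b) m) (essSet A α) := by
  rw [h.essSet_eq]
  exact _root_.disjoint_gapSet h.bandLeft_le h.bandLeft_lt m

theorem hasOneOrTwoEigenvaluesIn_even (h : IsBandEdges A α a b)
    (hA : |Real.cos (A * Real.pi)| < 1) (hγ : γ₁ + γ₂ < 0) (k : ℕ) :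
    HasOneOrTwoEigenvaluesIn (hamiltonian A (twoImpurities α γ₁ γ₂))
      (gapSet (bandLeft a) (bandLeft b) (2 * k)) := by
  obtain ⟨E, hE, hcell, hlt, h0⟩ := h.exists_secular_eq_zero_even hA hγ k
  refine hasOneOrTwoEigenvaluesIn (isOpen_gapSet _ _ _) (ordConnected_gapSet _ _ _)
    (h.disjoint_gapSet _) hE (eigenspace_ne_bot_of_secular_eq_zero (neg_one_pow_mul_self k)
    (fun hS => ?_) ((h.lt_left_iff k E hcell).1 hlt) h0)
  simpa [hS] using neg_one_pow_mul_sinE_pos_of_mem_cell hcell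

theorem hasOneOrTwoEigenvaluesIn_odd (h : IsBandEdges A α a b)
    (hA : |Real.cos (A * Real.pi)| < 1) (hγ : 0 < γ₁ + γ₂) (k : ℕ) :
    HasOneOrTwoEigenvaluesIn (hamiltonian A (twoImpurities α γ₁ γ₂))
      (gapSet (bandLeft a) (bandLeft b) (2 * k + 1)) := by
  obtain ⟨E, hE, hcell, hlt, h0⟩ := h.exists_secular_eq_zero_odd hA hγ k
  refine hasOneOrTwoEigenvaluesIn (isOpen_gapSet _ _ _) (ordConnected_gapSet _ _ _)
    (h.disjoint_gapSet _) hE (eigenspace_ne_bot_of_secular_eq_zero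
    (by rw [neg_mul_neg, neg_one_pow_mul_self]) (fun hS => ?_) ?_ h0)
  · simpa [hS] using neg_one_pow_mul_sinE_pos_of_mem_cell hcell
  · have := (h.right_lt_iff k E hcell).1 hlt
    linarith

end IsBandEdges

end MagneticChain

end

theorem mainTheorem7 (A α γ₁ γ₂ : ℝ) (hA : ∀ n : ℤ, A ≠ n) :
    UnboundedOperator.essentialSpectrum
        (MagneticChain.hamiltonian A (MagneticChain.twoImpurities α γ₁ γ₂)) =
      UnboundedOperator.essentialSpectrum (MagneticChain.hamiltonian A (fun _ => α)) ∧
    (γ₁ + γ₂ < 0 → ∀ (n : ℕ) (I : Set ℝ), Odd n →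
      IsNthGap (UnboundedOperator.realEssentialSpectrum
        (MagneticChain.hamiltonian A (MagneticChain.twoImpurities α γ₁ γ₂))) n I →
      UnboundedOperator.HasOneOrTwoEigenvaluesIn
        (MagneticChain.hamiltonian A (MagneticChain.twoImpurities α γ₁ γ₂)) I) ∧
    (0 < γ₁ + γ₂ → ∀ (n : ℕ) (I : Set ℝ), Even n →
      IsNthGap (UnboundedOperator.realEssentialSpectrum
        (MagneticChain.hamiltonian A (MagneticChain.twoImpurities α γ₁ γ₂))) n I →
      UnboundedOperator.HasOneOrTwoEigenvaluesIn
        (MagneticChain.hamiltonian A (MagneticChain.twoImpurities α γ₁ γ₂)) I) := by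
  have hA' := MagneticChain.abs_cos_mul_pi_lt_one hA
  obtain ⟨a, b, h⟩ := MagneticChain.exists_isBandEdges hA' α
  rw [MagneticChain.realEssentialSpectrum_eq]
  refine ⟨?_, fun hγ n I hn hI => ?_, fun hγ n I hn hI => ?_⟩
  · rw [MagneticChain.essentialSpectrum_eq, ← MagneticChain.twoImpurities_zero,
      MagneticChain.essentialSpectrum_eq]
  · obtain ⟨m, rfl, rfl⟩ := h.eq_gapSet hI
    -- The gap number is `m + 1`, so odd gaps have even index `m = 2k` and end at the left edge of
    -- the band in cell `k`.
    obtain ⟨k, rfl | rfl⟩ := Nat.even_or_odd' m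
    · exact h.hasOneOrTwoEigenvaluesIn_even hA' hγ k
    · exact absurd hn (by simp [parity_simps])
  · obtain ⟨m, rfl, rfl⟩ := h.eq_gapSet hI
    obtain ⟨k, rfl | rfl⟩ := Nat.even_or_odd' m
    · exact absurd hn (by simp [parity_simps])
    · exact h.hasOneOrTwoEigenvaluesIn_odd hA' hγ k
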